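/- Let $\gamma>0$ and let $g:[0,\infty)\to\mathbb R$ be strictly decreasing with $-V^0\le g\le -v_0$ for some constants $V^0,v_0>0$, with bounded derivative, and such that $g$ and its inverse $g^{-1}:g([0,\infty))\to[0,\infty)$ are twice continuously differentiable. For functions on $\mathbb R$ let $\|\cdot\|$ be the $L^2(\mathbb R)$ norm, $\|f\|_1=(\|f\|^2+\|f'\|^2)^{1/2}$ the $H^1(\mathbb R)$ norm, $|f|_\alpha=\sup_x e^{\alpha|x|}|f(x)|$, and $C_\alpha=\{f\in C(\mathbb R):|f|_\alpha<\infty\}$, $\alpha\ge 0$. Write $[f_x(0)]=f_x(0^+)-f_x(0^-)$ for the jump of the derivative at $0$. A classical solution below is a function $u(x,t)$ which is continuous on $\mathbb R\times[0,\infty)$, bounded on $\mathbb R\times[0,T]$ for every $T$, has continuous derivatives $u_t,u_x,u_{xx}$ for $t>0$, $x\ne0$, and has one-sided $x$-derivatives at $x=0$ for every $t>0$. An orbit $U=T(t)U_0$ of the free-interface problem, written in the frame attached to the interface, is a nonnegative classical solution of $$U_t=U_{xx}+[U_x(0,t)]\,U_x-\gamma U\ \ (x\neq 0,\ t>0),\qquad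 g(U(0,t))=[U_x(0,t)]\ \ (t>0),\qquad U(\cdot,0)=U_0 .$$ The problem linearized about the orbit $U$, with initial data $z_0$, is the problem of finding a classical solution $z$ of $$z_t=z_{xx}+[U_x(0,t)]\,z_x+[z_x(0,t)]\,U_x-\gamma z\ \ (x\ne 0,\ t>0),\qquad z(0,t)=(g^{-1})'\big([U_x(0,t)]\big)\,[z_x(0,t)]\ \ (t>0),\qquad z(\cdot,0)=z_0 .$$ **Theorem.** For every $\alpha\ge0$ and $R\ge 0$ there are constants $B,C$, depending only on $\gamma,g,\alpha,R$, such that the following holds for every orbit $U=T(t)U_0$ with $0\le U_0\in H^1\cap C_\alpha$, $\|U_0\|_1\le R$, $|U_0|_\alpha\le R$. (i) For every $z_0\in H^1\cap C_\alpha$ the problem linearized about $U$ with initial data $z_0$ has exactly one solution $z(t)=:D(t)z_0$; the map $z_0\mapsto D(t)z_0$ is linear, and $\|D(t)z_0\|\le Be^{Ct}\|z_0\|_1$ for all $t\ge0$. (ii) For every orbit $W=T(t)W_0$ with $0\le W_0\in H^1\cap C_\alpha$, $\|W_0\|_1\le R$, $|W_0|_\alpha\le R$, the solution $z(t)=D(t)(U_0-W_0)$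 satisfies $$\|U(t)-W(t)-z(t)\|\le Be^{Ct}\,\|U_0-W_0\|_1^2\qquad\text{for all }t\ge 0 .$$ That is, $T(t)$ is Fréchet differentiable at $U_0$, with respect to the $H^1$ norm of the initial data and the $L^2$ norm of the solution, uniformly on bounded sets, and its differential is $D(t)$. -/

import Mathlib

open MeasureTheory Set
open scoped ENNReal NNReal

namespace FreeInterface

/-! ### Function spaces on the line -/

/-- `f'` is the weak derivative of `f` on `ℝ`. -/
def HasWeakDeriv (f f' : ℝ → ℝ) : Prop :=
  LocallyIntegrable f ∧ LocallyIntegrable f' ∧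
    ∀ φ : ℝ → ℝ, ContDiff ℝ (⊤ : ℕ∞) φ → HasCompactSupport φ →
      ∫ x, f x * deriv φ x = -∫ x, f' x * φ x

/-- The Sobolev norm `‖f‖₁ = (‖f‖² + ‖f'‖²)^{1/2}` of `H¹(ℝ)`, with `‖·‖` the norm of `L²(ℝ)` and
`f'` the weak derivative. It is `∞` if there is no weak derivative, or if `f` or `f'` is not in
`L²(ℝ)`; since weak derivatives are unique almost everywhere, the infimum is over a single value. -/
noncomputable def h1Norm (f : ℝ → ℝ) : ℝ≥0∞ :=
  ⨅ (f' : ℝ → ℝ) (_ : HasWeakDeriv f f'),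
    (eLpNorm f 2 volume ^ 2 + eLpNorm f' 2 volume ^ 2) ^ (1 / 2 : ℝ)

/-- The weighted uniform norm `|f|_α = sup_x e^{α|x|} |f(x)|`. -/
noncomputable def weightedNorm (α : ℝ) (f : ℝ → ℝ) : ℝ≥0∞ :=
  ⨆ x : ℝ, ENNReal.ofReal (Real.exp (α * |x|) * |f x|)

/-- Membership in `H¹ ∩ C_α`, where `C_α` consists of the continuous `f` with `|f|_α < ∞`. -/
structure MemH1C (α : ℝ) (f : ℝ → ℝ) : Prop where
  continuous : Continuous f
  weighted_lt_top : weightedNorm α f < ⊤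
  h1_lt_top : h1Norm f < ⊤

/-! ### The kinetics -/

/-- The inverse of the kinetics function `g : [0, ∞) → ℝ`, defined on the range `g([0, ∞))`. -/
noncomputable def kineticsInv (g : ℝ → ℝ) : ℝ → ℝ :=
  Function.invFunOn g (Ici 0)

/-- The derivative `(g⁻¹)'` on the range `g([0, ∞))`. -/
noncomputable def kineticsInvDeriv (g : ℝ → ℝ) (V : ℝ) : ℝ :=
  derivWithin (kineticsInv g) (g '' Ici 0) V

/-- The assumptions on the kinetics: `g` is decreasing on `[0, ∞)`, takes values in `[-V⁰, -v₀]`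
for some `V⁰, v₀ > 0`, has a bounded derivative, and both `g` and `g⁻¹` are twice continuously
differentiable. Values of `g` on `(-∞, 0)` are irrelevant. -/
structure IsKinetics (g : ℝ → ℝ) : Prop where
  strictAnti : StrictAntiOn g (Ici 0)
  bounds : ∃ V0 v0 : ℝ, 0 < V0 ∧ 0 < v0 ∧ ∀ u, 0 ≤ u → -V0 ≤ g u ∧ g u ≤ -v0
  deriv_bounded : ∃ L : ℝ, ∀ u, 0 ≤ u → |derivWithin g (Ici 0) u| ≤ L
  contDiffOn : ContDiffOn ℝ 2 g (Ici 0)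
  contDiffOn_inv : ContDiffOn ℝ 2 (kineticsInv g) (g '' Ici 0)

/-! ### Classical solutions in the frame attached to the interface

Functions of time and space are written `u t x`; the interface is at `x = 0`, and only times
`t ≥ 0` matter. -/

/-- The jump `[f_x(0)] = f_x(0+) - f_x(0-)` of the space derivative at the interface. -/
noncomputable def jump (f : ℝ → ℝ) : ℝ :=
  derivWithin f (Ici 0) 0 - derivWithin f (Iic 0) 0

/-- Time derivative `u_t`. -/
noncomputable def dt (u : ℝ → ℝ → ℝ) (t x : ℝ) : ℝ := deriv (fun s => u s x) t

/-- Space derivative `u_x`. -/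
noncomputable def dx (u : ℝ → ℝ → ℝ) (t x : ℝ) : ℝ := deriv (u t) x

/-- Second space derivative `u_xx`. -/
noncomputable def dxx (u : ℝ → ℝ → ℝ) (t x : ℝ) : ℝ := deriv (deriv (u t)) x

/-- The open domain off the interface, `t > 0`, `x ≠ 0`. -/
def offInterface : Set (ℝ × ℝ) := {p | 0 < p.1 ∧ p.2 ≠ 0}

/-- Regularity of a classical solution: `u` is continuous on `[0, ∞) × ℝ`, bounded on `[0, T] × ℝ`
for every `T`, has continuous derivatives `u_t`, `u_x`, `u_xx` for `t > 0`, `x ≠ 0`, and for every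
`t > 0` it has both one-sided space derivatives at the interface. -/
structure IsClassical (u : ℝ → ℝ → ℝ) : Prop where
  continuousOn : ContinuousOn (fun p : ℝ × ℝ => u p.1 p.2) {p | 0 ≤ p.1}
  bounded : ∀ T : ℝ, ∃ M : ℝ, ∀ t, 0 ≤ t → t ≤ T → ∀ x, |u t x| ≤ M
  differentiableAt_t : ∀ t x, 0 < t → x ≠ 0 → DifferentiableAt ℝ (fun s => u s x) t
  differentiableAt_x : ∀ t x, 0 < t → x ≠ 0 → DifferentiableAt ℝ (u t) x
  differentiableAt_xx : ∀ t x, 0 < t → x ≠ 0 → DifferentiableAt ℝ (deriv (u t)) x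
  continuousOn_dt : ContinuousOn (fun p : ℝ × ℝ => dt u p.1 p.2) offInterface
  continuousOn_dx : ContinuousOn (fun p : ℝ × ℝ => dx u p.1 p.2) offInterface
  continuousOn_dxx : ContinuousOn (fun p : ℝ × ℝ => dxx u p.1 p.2) offInterface
  right_deriv : ∀ t, 0 < t → DifferentiableWithinAt ℝ (u t) (Ici 0) 0
  left_deriv : ∀ t, 0 < t → DifferentiableWithinAt ℝ (u t) (Iic 0) 0

/-- `U` is the orbit `U(t) = T(t) U₀`: the nonnegative classical solution of
`U_t = U_xx + v U_x - γ U` for `x ≠ 0`, with `g(U(0,t)) = v(t) = [U_x(0,t)]`, `U(·,0) = U₀`. -/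
structure IsOrbit (γ : ℝ) (g : ℝ → ℝ) (U₀ : ℝ → ℝ) (U : ℝ → ℝ → ℝ) : Prop where
  classical : IsClassical U
  nonneg : ∀ t x, 0 ≤ t → 0 ≤ U t x
  initial : ∀ x, U 0 x = U₀ x
  equation : ∀ t x, 0 < t → x ≠ 0 →
    dt U t x = dxx U t x + jump (U t) * dx U t x - γ * U t x
  kinetic : ∀ t, 0 < t → g (U t 0) = jump (U t)

/-- `z` is a classical solution of the problem linearized about the orbit `U`, with initial data
`z₀`: `z_t = z_xx + [U_x(0,t)] z_x + [z_x(0,t)] U_x - γ z` for `x ≠ 0`, with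
`z(0,t) = (g⁻¹)'([U_x(0,t)]) [z_x(0,t)]`, `z(·,0) = z₀`. -/
structure IsLinearizedSolution (γ : ℝ) (g : ℝ → ℝ) (U : ℝ → ℝ → ℝ) (z₀ : ℝ → ℝ)
    (z : ℝ → ℝ → ℝ) : Prop where
  classical : IsClassical z
  initial : ∀ x, z 0 x = z₀ x
  equation : ∀ t x, 0 < t → x ≠ 0 →
    dt z t x = dxx z t x + jump (U t) * dx z t x + jump (z t) * dx U t x - γ * z t x
  kinetic : ∀ t, 0 < t → z t 0 = kineticsInvDeriv g (jump (U t)) * jump (z t)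

end FreeInterface

namespace FreeInterface

open Filter Topology

/-! In the laboratory frame an orbit solves the damped heat equation with a source of strength
`-v(t)` concentrated on the interface `s(t) = ∫₀ᵗ v`. Duhamel's formula, read in the moving frame,
is `rep`: the shifted heat flow of the data minus a single layer potential with density `v`. The
jump relation for layer potentials gives `[U_x] = v`, and the maximum principle `IsClassical.nonpos`
shows that drift, jump and initial data determine a classical solution. An orbit is therefore `rep`
with `v = g(U(0,·))`, which closes up as a Volterra equation for the trace at the interface.

Formal differentiation of `rep` in the direction `(z₀, q)` yields `linRep`, which solves the
linearized equation with jump `q`. Since `(g⁻¹)'(g(u)) g'(u) = 1`, the linearized kinetic condition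
says `q(t) = g'(U(0,t)) z(0,t)`, a linear Volterra equation.

The kernels have the integrable singularity `(t-τ)^{-1/2}`. Double layers are more singular, but
they occur only with the factor `∫_τ^t q`, which compensates. With the time weight `e^{-λt}` each
potential costs `λ^{-1/2}`, so for large `λ` the feedback through the interface has a factor at most
`1/2`. This gives existence (`exists_kinetic_density`), uniqueness (`linRep_unique`) and bounds
linear in the data (`bd_of_volterra`).

For two orbits with velocities `v`, `w`, the identity `remainder_eq` splits `U - W - z` into terms
linear in `v - w - q`, products of two first-order small quantities, and second-order Taylor
remainders of the heat kernel. First-order quantities are `O(δ e^{λt})`, where `δ` is the size of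
`U₀ - W₀`, and Taylor's formula for `g` bounds `v - w - q` by a multiple of `|U - W - z| + |U - W|²`
at the interface. The Volterra argument with weight `e^{-2λt}` then gives `O(δ² e^{2λt})`.

Every estimate is made at once in the uniform norm, which the trace needs, and in `L²`, which the
theorem asks for; this is the role of `Bd`. The `H¹` norm of the data controls both, by the Sobolev
inequality `HasWeakDeriv.enorm_le`. -/

/-! ### The heat kernel, extended by zero to nonpositive times -/

/-- `r^{-k/2} e^{-X²/(4r)}` for `r > 0`, and `0` for `r ≤ 0` (if `k ≥ 1`). -/
noncomputable def gaussPow (k : ℕ) (r X : ℝ) : ℝ :=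
  (√r)⁻¹ ^ k * Real.exp (-X ^ 2 / (4 * r))

lemma gaussPow_of_nonpos {k : ℕ} (hk : k ≠ 0) {r : ℝ} (hr : r ≤ 0) (X : ℝ) :
    gaussPow k r X = 0 := by
  simp [gaussPow, Real.sqrt_eq_zero_of_nonpos hr, hk]

lemma gaussPow_nonneg (k : ℕ) (r X : ℝ) : 0 ≤ gaussPow k r X := by
  unfold gaussPow; positivity

/-- Away from `X = 0` the Gaussian beats every power of `1/r`, by `e^{-y} ≤ n!/yⁿ` with `n = k + 2`.
The power `r²` is what makes the extension by zero differentiable across `r = 0`. -/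
lemma gaussPow_le_sq {k : ℕ} (hk : k ≠ 0) {r X : ℝ} (hr : r ≤ 1) (hX : X ≠ 0) :
    gaussPow k r X ≤ ((k + 2).factorial * (4 / X ^ 2) ^ (k + 2)) * r ^ 2 := by
  rcases le_or_gt r 0 with h0 | h0
  · rw [gaussPow_of_nonpos hk h0]; positivity
  have hX2 : 0 < X ^ 2 := by positivity
  have hy : 0 ≤ X ^ 2 / (4 * r) := by positivity
  have h1 := Real.pow_div_factorial_le_exp (X ^ 2 / (4 * r)) hy (k + 2)
  have hexp : Real.exp (-X ^ 2 / (4 * r)) ≤ (k + 2).factorial * (4 / X ^ 2 * r) ^ (k + 2) := by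
    rw [neg_div, Real.exp_neg]
    have h2 : 0 < (X ^ 2 / (4 * r)) ^ (k + 2) / ((k + 2).factorial : ℝ) := by positivity
    refine (inv_anti₀ h2 h1).trans (le_of_eq ?_)
    rw [inv_div, div_eq_mul_inv, ← inv_pow]
    congr 2
    field_simp
  have hs : 0 < √r := Real.sqrt_pos.2 h0
  have hs1 : √r ≤ 1 := Real.sqrt_le_one.2 hr
  have hrs : r = √r ^ 2 := (Real.sq_sqrt h0.le).symm
  calc gaussPow k r X ≤ (√r)⁻¹ ^ k * ((k + 2).factorial * (4 / X ^ 2 * r) ^ (k + 2)) := by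
        unfold gaussPow; gcongr
    _ = ((k + 2).factorial * (4 / X ^ 2) ^ (k + 2)) * r ^ 2 * ((√r)⁻¹ ^ k * r ^ k) := by ring
    _ ≤ ((k + 2).factorial * (4 / X ^ 2) ^ (k + 2)) * r ^ 2 * 1 := by
        gcongr
        rw [← mul_pow]
        apply pow_le_one₀ (by positivity)
        nth_rw 2 [hrs]
        rw [sq, ← mul_assoc, inv_mul_cancel₀ hs.ne', one_mul]
        exact hs1
    _ = _ := by ring

lemma continuousAt_gaussPow {k : ℕ} (hk : k ≠ 0) {p : ℝ × ℝ} (hp : p.1 ≠ 0 ∨ p.2 ≠ 0) :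
    ContinuousAt (fun p : ℝ × ℝ => gaussPow k p.1 p.2) p := by
  rcases lt_trichotomy p.1 0 with h | h | h
  · have : (fun p : ℝ × ℝ => gaussPow k p.1 p.2) =ᶠ[𝓝 p] fun _ => 0 := by
      filter_upwards [continuousAt_fst.eventually (gt_mem_nhds h)] with q hq
      exact gaussPow_of_nonpos hk (le_of_lt hq) _
    exact this.continuousAt
  · have hX : p.2 ≠ 0 := by tauto
    have hval : gaussPow k p.1 p.2 = 0 := gaussPow_of_nonpos hk h.le _
    show Tendsto _ _ (𝓝 (gaussPow k p.1 p.2))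
    rw [hval]
    have hb : Tendsto (fun q : ℝ × ℝ =>
        ((k + 2).factorial * (4 / q.2 ^ 2) ^ (k + 2)) * q.1 ^ 2) (𝓝 p) (𝓝 0) := by
      have : ContinuousAt (fun q : ℝ × ℝ =>
        (((k + 2).factorial : ℝ) * (4 / q.2 ^ 2) ^ (k + 2)) * q.1 ^ 2) p := by
        have : p.2 ^ 2 ≠ 0 := by positivity
        fun_prop (disch := assumption)
      simpa [ContinuousAt, h] using this
    refine squeeze_zero' (Eventually.of_forall fun q => gaussPow_nonneg _ _ _) ?_ hb
    filter_upwards [continuousAt_snd.eventually (isOpen_ne.mem_nhds hX),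
      continuousAt_fst.eventually (gt_mem_nhds (h.trans_lt one_pos))] with q h2 h1
    exact gaussPow_le_sq hk (le_of_lt h1) h2
  · have h1 : √p.1 ≠ 0 := (Real.sqrt_pos.2 h).ne'
    have h2 : 4 * p.1 ≠ 0 := by positivity
    unfold gaussPow
    fun_prop (disch := assumption)

/-- Formulated along a curve that may cross `r = 0` away from the origin; there all terms of the
formula vanish, in accordance with the flatness of the Gaussian. This later permits differentiation
of time integrals whose range extends beyond the present time. -/
lemma hasDerivAt_gaussPow_comp {k : ℕ} (hk : k ≠ 0) {ρ X : ℝ → ℝ} {ρ' X' θ : ℝ}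
    (hρ : HasDerivAt ρ ρ' θ) (hX : HasDerivAt X X' θ) (h : ρ θ ≠ 0 ∨ X θ ≠ 0) :
    HasDerivAt (fun θ => gaussPow k (ρ θ) (X θ))
      (ρ' * (-(k / 2) * gaussPow (k + 2) (ρ θ) (X θ)
          + X θ ^ 2 / 4 * gaussPow (k + 4) (ρ θ) (X θ))
        - X' * (X θ / 2) * gaussPow (k + 2) (ρ θ) (X θ)) θ := by
  rcases le_or_gt (ρ θ) 0 with h0 | h0
  · have hE2 : gaussPow (k + 2) (ρ θ) (X θ) = 0 := gaussPow_of_nonpos (by simp) h0 _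
    have hE4 : gaussPow (k + 4) (ρ θ) (X θ) = 0 := gaussPow_of_nonpos (by simp) h0 _
    have hE : gaussPow k (ρ θ) (X θ) = 0 := gaussPow_of_nonpos hk h0 _
    simp only [hE2, hE4, mul_zero, add_zero, sub_zero]
    rcases h0.lt_or_eq with h0 | h0
    · refine (hasDerivAt_const θ (0 : ℝ)).congr_of_eventuallyEq ?_
      filter_upwards [hρ.continuousAt.eventually (gt_mem_nhds h0)] with q hq
      exact gaussPow_of_nonpos hk (le_of_lt hq) _
    · have hX0 : X θ ≠ 0 := by tauto
      rw [hasDerivAt_iff_isLittleO]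
      simp only [hE, smul_zero, sub_zero]
      -- Where `ρ` vanishes, `ρ²` has derivative zero, so a bound by a multiple of `ρ²` is already
      -- `o(x - θ)`.
      have h2 := (hρ.pow 2).isLittleO
      simp only [h0, Pi.pow_apply] at h2
      norm_num at h2
      set K : ℝ := (k + 2).factorial * (4 / (X θ ^ 2 / 2)) ^ (k + 2)
      refine Asymptotics.IsBigO.trans_isLittleO (g := fun x => ρ x ^ 2) ?_ h2
      refine Asymptotics.IsBigO.of_bound K ?_
      have hsq : X θ ^ 2 / 2 < X θ ^ 2 := by have : 0 < X θ ^ 2 := by positivity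
                                             linarith
      filter_upwards [hX.continuousAt.eventually (isOpen_ne.mem_nhds hX0),
        hρ.continuousAt.eventually (gt_mem_nhds (h0.trans_lt one_pos)),
        (hX.continuousAt.pow 2).eventually (lt_mem_nhds hsq)] with q h2 h1 h3
      rw [Real.norm_of_nonneg (gaussPow_nonneg _ _ _), Real.norm_of_nonneg (by positivity)]
      refine (gaussPow_le_sq hk (le_of_lt h1) h2).trans ?_
      have h3' : X θ ^ 2 / 2 < X q ^ 2 := h3
      simp only [K]
      gcongr
  · have hs : √(ρ θ) ≠ 0 := (Real.sqrt_pos.2 h0).ne'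
    have hsq : ρ θ = √(ρ θ) ^ 2 := (Real.sq_sqrt h0.le).symm
    have h1 := (((hρ.sqrt h0.ne').inv hs).pow k).mul
      ((((hX.pow 2).neg).div (hρ.const_mul 4) (by positivity)).exp)
    refine h1.congr_deriv ?_
    simp only [gaussPow, Pi.inv_apply, Pi.pow_apply, Pi.neg_apply, Pi.div_apply]
    obtain ⟨j, rfl⟩ := Nat.exists_eq_succ_of_ne_zero hk
    set e := Real.exp (-X θ ^ 2 / (4 * ρ θ))
    set w := √(ρ θ)
    rw [hsq]
    simp only [Nat.succ_eq_add_one, Nat.add_sub_cancel, inv_pow]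
    push_cast
    field_simp
    ring

/-- The space derivatives `∂ₓⁿ` (for `n ≤ 4`) of `e^{-γr}` times the heat kernel. -/
noncomputable def ker (γ : ℝ) : ℕ → ℝ → ℝ → ℝ
  | 0, r, X => Real.exp (-γ * r) * (√(4 * Real.pi))⁻¹ * gaussPow 1 r X
  | 1, r, X => Real.exp (-γ * r) * (√(4 * Real.pi))⁻¹ * (-(X / 2) * gaussPow 3 r X)
  | 2, r, X => Real.exp (-γ * r) * (√(4 * Real.pi))⁻¹ *
      (-(1 / 2) * gaussPow 3 r X + X ^ 2 / 4 * gaussPow 5 r X)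
  | 3, r, X => Real.exp (-γ * r) * (√(4 * Real.pi))⁻¹ *
      (3 / 4 * X * gaussPow 5 r X - X ^ 3 / 8 * gaussPow 7 r X)
  | 4, r, X => Real.exp (-γ * r) * (√(4 * Real.pi))⁻¹ *
      (3 / 4 * gaussPow 5 r X - 3 / 4 * X ^ 2 * gaussPow 7 r X + X ^ 4 / 16 * gaussPow 9 r X)
  | _, _, _ => 0

variable {γ : ℝ}

lemma ker_of_nonpos (n : ℕ) {r : ℝ} (hr : r ≤ 0) (X : ℝ) : ker γ n r X = 0 := by
  match n with
  | 0 | 1 | 2 | 3 | 4 => simp [ker, gaussPow_of_nonpos, hr]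
  | _ + 5 => simp [ker]

lemma continuousAt_ker (n : ℕ) {p : ℝ × ℝ} (hp : p.1 ≠ 0 ∨ p.2 ≠ 0) :
    ContinuousAt (fun p : ℝ × ℝ => ker γ n p.1 p.2) p := by
  have h1 := continuousAt_gaussPow (k := 1) (by simp) hp
  have h3 := continuousAt_gaussPow (k := 3) (by simp) hp
  have h5 := continuousAt_gaussPow (k := 5) (by simp) hp
  have h7 := continuousAt_gaussPow (k := 7) (by simp) hp
  have h9 := continuousAt_gaussPow (k := 9) (by simp) hp
  match n with
  | 0 | 1 | 2 | 3 | 4 => simp only [ker]; fun_prop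
  | _ + 5 => simp only [ker]; fun_prop

/-- This is the damped heat equation `∂_r = ∂_X² - γ` for the kernels combined with the chain rule.
The curve form yields space derivatives and time derivatives in the moving frame from one
computation. -/
lemma hasDerivAt_ker_comp {n : ℕ} (hn : n ≤ 2) {ρ X : ℝ → ℝ} {ρ' X' θ : ℝ}
    (hρ : HasDerivAt ρ ρ' θ) (hX : HasDerivAt X X' θ) (h : ρ θ ≠ 0 ∨ X θ ≠ 0) :
    HasDerivAt (fun θ => ker γ n (ρ θ) (X θ))
      (ρ' * (ker γ (n + 2) (ρ θ) (X θ) - γ * ker γ n (ρ θ) (X θ))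
        + X' * ker γ (n + 1) (ρ θ) (X θ)) θ := by
  have h1 := hasDerivAt_gaussPow_comp (k := 1) (by simp) hρ hX h
  have h3 := hasDerivAt_gaussPow_comp (k := 3) (by simp) hρ hX h
  have h5 := hasDerivAt_gaussPow_comp (k := 5) (by simp) hρ hX h
  have he := ((hρ.const_mul (-γ)).exp).mul_const ((√(4 * Real.pi))⁻¹)
  interval_cases n
  · refine (he.mul h1).congr_deriv ?_
    simp only [ker]; push_cast; ring
  · refine (he.mul (((hX.div_const 2).neg).mul h3)).congr_deriv ?_
    simp only [ker, Pi.neg_apply, Pi.mul_apply]; push_cast; ring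
  · refine (he.mul ((h3.const_mul (-(1 / 2))).add (((hX.pow 2).div_const 4).mul h5))).congr_deriv ?_
    simp only [ker, Pi.mul_apply, Pi.add_apply, Pi.pow_apply]
    push_cast; ring

lemma hasDerivAt_ker {n : ℕ} (hn : n ≤ 2) {r X : ℝ} (h : r ≠ 0 ∨ X ≠ 0) :
    HasDerivAt (ker γ n r) (ker γ (n + 1) r X) X := by
  simpa using hasDerivAt_ker_comp (γ := γ) hn (hasDerivAt_const X r) (hasDerivAt_id X) h

lemma measurable_ker (n : ℕ) : Measurable (fun p : ℝ × ℝ => ker γ n p.1 p.2) := by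
  match n with
  | 0 | 1 | 2 | 3 | 4 => simp only [ker, gaussPow]; fun_prop
  | _ + 5 => simp only [ker]; fun_prop

lemma ker_zero_neg (r X : ℝ) : ker γ 0 r (-X) = ker γ 0 r X := by simp [ker, gaussPow]

lemma ker_one_neg (r X : ℝ) : ker γ 1 r (-X) = -ker γ 1 r X := by
  simp [ker, gaussPow]; ring

lemma ker_zero_nonneg (r X : ℝ) : 0 ≤ ker γ 0 r X := by
  have := gaussPow_nonneg 1 r X
  simp only [ker]; positivity

lemma ker_one_eq {r : ℝ} (hr : 0 < r) (X : ℝ) : ker γ 1 r X = -(X / (2 * r)) * ker γ 0 r X := by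
  have hs : √r ≠ 0 := (Real.sqrt_pos.2 hr).ne'
  have hsq : r = √r ^ 2 := (Real.sq_sqrt hr.le).symm
  simp only [ker, gaussPow]
  set e := Real.exp (-X ^ 2 / (4 * r))
  set e' := Real.exp (-γ * r)
  set w := √r
  rw [hsq]
  field_simp

/-- Half of the Gaussian exponent absorbs the powers of `y = |X|/√r`: `y^j ≤ 1 + y⁴` and `y⁴/128 ≤
e^{y²/8}`, whence 129. -/
lemma pow_mul_gaussPow_le {j k : ℕ} (hj : j ≤ 4) {r : ℝ} (hr : 0 < r) (X : ℝ) :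
    |X| ^ j * gaussPow (k + j) r X ≤ 129 * ((√r)⁻¹ ^ k * Real.exp (-X ^ 2 / (8 * r))) := by
  have hs : 0 < √r := Real.sqrt_pos.2 hr
  have hsq : √r ^ 2 = r := Real.sq_sqrt hr.le
  set y := |X| * (√r)⁻¹ with hy
  have hy0 : 0 ≤ y := by positivity
  have hy2 : y ^ 2 = X ^ 2 / r := by
    rw [hy, mul_pow, sq_abs, inv_pow, hsq]; rfl
  have hpow : y ^ j ≤ 129 * Real.exp (y ^ 2 / 8) := by
    have h1 : y ^ j ≤ 1 + y ^ 4 := by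
      rcases le_total y 1 with h | h
      · exact (pow_le_one₀ hy0 h).trans (by have : 0 ≤ y ^ 4 := by positivity
                                            linarith)
      · exact (pow_le_pow_right₀ h hj).trans (by linarith)
    have h2 := Real.pow_div_factorial_le_exp (y ^ 2 / 8) (by positivity) 2
    have h3 : 1 ≤ Real.exp (y ^ 2 / 8) := Real.one_le_exp (by positivity)
    norm_num [Nat.factorial] at h2
    nlinarith
  have he : Real.exp (-X ^ 2 / (4 * r)) =
      Real.exp (-(y ^ 2 / 8)) * Real.exp (-X ^ 2 / (8 * r)) := by
    rw [← Real.exp_add, hy2]; congr 1; field_simp; ring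
  calc |X| ^ j * gaussPow (k + j) r X
      = y ^ j * Real.exp (-(y ^ 2 / 8)) * ((√r)⁻¹ ^ k * Real.exp (-X ^ 2 / (8 * r))) := by
        rw [gaussPow, he, hy]; ring
    _ ≤ (129 * Real.exp (y ^ 2 / 8)) * Real.exp (-(y ^ 2 / 8)) *
        ((√r)⁻¹ ^ k * Real.exp (-X ^ 2 / (8 * r))) := by gcongr
    _ = _ := by rw [mul_assoc 129, ← Real.exp_add]; simp

/-- The coefficients in `ker` have absolute sum at most `25/16`, and `129 · 25/16 < 300`. -/
lemma abs_ker_le (n : ℕ) {r : ℝ} (hr : 0 < r) (X : ℝ) :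
    |ker γ n r X| ≤ 300 * (√r)⁻¹ ^ (n + 1) * Real.exp (-γ * r) * Real.exp (-X ^ 2 / (8 * r)) := by
  have hπ : (√(4 * Real.pi))⁻¹ ≤ 1 := by
    apply inv_le_one_of_one_le₀
    rw [Real.one_le_sqrt]; linarith [Real.pi_gt_three]
  have hπ0 : 0 < (√(4 * Real.pi))⁻¹ := by positivity
  have key : ∀ P : ℝ, |P| ≤ 300 * ((√r)⁻¹ ^ (n + 1) * Real.exp (-X ^ 2 / (8 * r))) →
      |Real.exp (-γ * r) * (√(4 * Real.pi))⁻¹ * P| ≤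
      300 * (√r)⁻¹ ^ (n + 1) * Real.exp (-γ * r) * Real.exp (-X ^ 2 / (8 * r)) := by
    intro P hP
    rw [abs_mul, abs_of_nonneg (by positivity)]
    calc Real.exp (-γ * r) * (√(4 * Real.pi))⁻¹ * |P| ≤ Real.exp (-γ * r) * 1 * |P| := by gcongr
      _ ≤ Real.exp (-γ * r) * 1 * (300 * ((√r)⁻¹ ^ (n + 1) * Real.exp (-X ^ 2 / (8 * r)))) := by
        gcongr
      _ = _ := by ring
  have hb := fun (j k : ℕ) (hj : j ≤ 4) => pow_mul_gaussPow_le (k := k) hj hr X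
  have hg := fun k => gaussPow_nonneg k r X
  match n with
  | 0 =>
    refine key _ ?_
    have := hb 0 1 (by simp)
    rw [abs_of_nonneg (hg 1)]
    simp at this ⊢; nlinarith [hg 1]
  | 1 =>
    refine key _ ?_
    have := hb 1 2 (by simp)
    rw [abs_mul, abs_of_nonneg (hg 3), abs_neg, abs_div, abs_two]
    simp only [pow_one] at this
    nlinarith [mul_nonneg (abs_nonneg X) (hg 3)]
  | 2 =>
    refine key _ ?_
    have h0 := hb 0 3 (by simp)
    have h2 := hb 2 3 (by simp)
    refine (abs_add_le _ _).trans ?_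
    rw [abs_mul, abs_mul, abs_of_nonneg (hg 3), abs_of_nonneg (hg 5), abs_div, abs_pow]
    norm_num at h0 h2 ⊢
    nlinarith [hg 3, mul_nonneg (sq_nonneg X) (hg 5)]
  | 3 =>
    refine key _ ?_
    have h0 := hb 1 4 (by simp)
    have h2 := hb 3 4 (by simp)
    refine (abs_sub _ _).trans ?_
    simp only [abs_mul, abs_of_nonneg (hg 7), abs_of_nonneg (hg 5), abs_div, abs_pow]
    norm_num at h0 h2 ⊢
    nlinarith [mul_nonneg (abs_nonneg X) (hg 5), mul_nonneg (pow_nonneg (abs_nonneg X) 3) (hg 7)]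
  | 4 =>
    refine key _ ?_
    have h0 := hb 0 5 (by simp)
    have h2 := hb 2 5 (by simp)
    have h4 := hb 4 5 (by simp)
    refine (abs_add_le _ _).trans ((add_le_add_left (abs_sub _ _) _).trans ?_)
    simp only [abs_mul, abs_of_nonneg (hg 7), abs_of_nonneg (hg 5), abs_of_nonneg (hg 9),
      abs_div, abs_pow]
    norm_num at h0 h2 h4 ⊢
    have e4 : |X| ^ 4 = X ^ 4 := by rw [← abs_pow, abs_of_nonneg (by positivity)]
    nlinarith [hg 5, mul_nonneg (sq_nonneg X) (hg 7), mul_nonneg (pow_nonneg (abs_nonneg X) 4) (hg 9)]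
  | _ + 5 => simp only [ker, abs_zero]; positivity

/-! ### Simultaneous sup- and `L²`-bounds -/

/-- `f` is bounded by `c` in the uniform norm and in `L²(ℝ)`. -/
structure Bd (f : ℝ → ℝ) (c : ℝ) : Prop where
  meas : AEStronglyMeasurable f volume
  sup : ∀ x, |f x| ≤ c
  l2 : eLpNorm f 2 volume ≤ ENNReal.ofReal c

namespace Bd

variable {f h : ℝ → ℝ} {c d : ℝ}

lemma nonneg (hf : Bd f c) : 0 ≤ c := (abs_nonneg _).trans (hf.sup 0)

lemma mono (hf : Bd f c) (hcd : c ≤ d) : Bd f d :=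
  ⟨hf.meas, fun x => (hf.sup x).trans hcd, hf.l2.trans (ENNReal.ofReal_le_ofReal hcd)⟩

lemma add (hf : Bd f c) (hh : Bd h d) : Bd (fun x => f x + h x) (c + d) where
  meas := hf.meas.add hh.meas
  sup x := (abs_add_le _ _).trans (add_le_add (hf.sup x) (hh.sup x))
  l2 := by
    rw [ENNReal.ofReal_add hf.nonneg hh.nonneg]
    exact (eLpNorm_add_le hf.meas hh.meas (by norm_num)).trans (add_le_add hf.l2 hh.l2)

lemma const_mul (a : ℝ) (hf : Bd f c) : Bd (fun x => a * f x) (|a| * c) where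
  meas := hf.meas.const_mul a
  sup x := by rw [abs_mul]; exact mul_le_mul_of_nonneg_left (hf.sup x) (abs_nonneg a)
  l2 := by
    rw [ENNReal.ofReal_mul (abs_nonneg a)]
    refine (eLpNorm_const_smul_le (c := a) (f := f)).trans ?_
    gcongr
    · rw [Real.enorm_eq_ofReal_abs]
    · exact hf.l2

lemma sub (hf : Bd f c) (hh : Bd h d) : Bd (fun x => f x - h x) (c + d) := by
  simpa [sub_eq_add_neg] using hf.add (hh.const_mul (-1))

lemma comp_add (hf : Bd f c) (a : ℝ) : Bd (fun x => f (x + a)) c where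
  meas := hf.meas.comp_measurePreserving (measurePreserving_add_right volume a)
  sup x := hf.sup _
  l2 := by
    have := eLpNorm_comp_measurePreserving (p := 2) hf.meas (measurePreserving_add_right volume a)
    exact this.trans_le hf.l2

lemma zero : Bd (fun _ => 0) 0 := ⟨aestronglyMeasurable_const, by simp, by simp⟩

lemma lintegral_sq_le (hf : Bd f c) : ∫⁻ x, ‖f x‖ₑ ^ 2 ≤ ENNReal.ofReal c ^ 2 := by
  have h := hf.l2
  rw [eLpNorm_eq_lintegral_rpow_enorm_toReal (by norm_num) (by norm_num)] at h
  simp only [ENNReal.toReal_ofNat] at h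
  have h2 : ∫⁻ x, ‖f x‖ₑ ^ 2 = ((∫⁻ x, ‖f x‖ₑ ^ (2 : ℝ)) ^ (1 / (2 : ℝ))) ^ 2 := by
    rw [← ENNReal.rpow_natCast (_ ^ (1 / (2 : ℝ))), ← ENNReal.rpow_mul]
    norm_num
  rw [h2]; gcongr

lemma of_lintegral_sq_le (hm : AEStronglyMeasurable f volume) (hs : ∀ x, |f x| ≤ c)
    (h : ∫⁻ x, ‖f x‖ₑ ^ 2 ≤ ENNReal.ofReal c ^ 2) : Bd f c := by
  refine ⟨hm, hs, ?_⟩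
  rw [eLpNorm_eq_lintegral_rpow_enorm_toReal (by norm_num) (by norm_num)]
  simp only [ENNReal.toReal_ofNat]
  have h2 : ENNReal.ofReal c = (ENNReal.ofReal c ^ 2) ^ (1 / (2 : ℝ)) := by
    rw [← ENNReal.rpow_natCast, ← ENNReal.rpow_mul]; norm_num
  rw [h2]
  gcongr
  simpa using h

end Bd

/-- Minkowski's integral inequality, in the uniform norm and in `L²(ℝ)` at once. -/
lemma Bd.integral {T : Type*} [MeasurableSpace T] {μ : Measure T} [SFinite μ] {k : T → ℝ → ℝ}
    {ω : T → ℝ} (hk : Measurable (Function.uncurry k)) (hω : Integrable ω μ)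
    (hb : ∀ᵐ τ ∂μ, Bd (k τ) (ω τ)) : Bd (fun x => ∫ τ, k τ x ∂μ) (∫ τ, ω τ ∂μ) := by
  have hkx : ∀ x, Measurable fun τ => k τ x := fun x => hk.comp (measurable_id.prodMk measurable_const)
  have hω0 : 0 ≤ᵐ[μ] ω := by filter_upwards [hb] with τ h using h.nonneg
  refine Bd.of_lintegral_sq_le ?_ (fun x => ?_) ?_
  · have h1 : StronglyMeasurable (fun p : ℝ × T => k p.2 p.1) :=
      (hk.comp measurable_swap).stronglyMeasurable
    exact (StronglyMeasurable.integral_prod_right (ν := μ) (f := fun x τ => k τ x)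
      h1).aestronglyMeasurable
  · rw [← Real.norm_eq_abs]
    refine norm_integral_le_of_norm_le hω ?_
    filter_upwards [hb] with τ h using h.sup x
  · have hI : ENNReal.ofReal (∫ τ, ω τ ∂μ) = ∫⁻ τ, ENNReal.ofReal (ω τ) ∂μ :=
      ofReal_integral_eq_lintegral_ofReal hω hω0
    set w : T → ℝ≥0∞ := fun τ => ENNReal.ofReal (ω τ) with hw
    have hwm : AEMeasurable w μ := hω.aemeasurable.ennreal_ofReal
    set I := ∫⁻ τ, w τ ∂μ with hIdef
    -- Cauchy–Schwarz with weight `ω`: `(∫ k)² ≤ ∫ ω · ∫ k²/ω`. Integrating in `x` and exchanging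
    -- integrals leaves `∫ ω²/ω`.
    have hcs : ∀ x, ‖∫ τ, k τ x ∂μ‖ₑ ^ 2 ≤ I * ∫⁻ τ, (w τ)⁻¹ * ‖k τ x‖ₑ ^ 2 ∂μ := by
      intro x
      have h1 : ‖∫ τ, k τ x ∂μ‖ₑ ≤
          ∫⁻ τ, ((fun τ => w τ ^ (1 / 2 : ℝ)) * fun τ => (w τ)⁻¹ ^ (1 / 2 : ℝ) * ‖k τ x‖ₑ) τ ∂μ := by
        refine (enorm_integral_le_lintegral_enorm _).trans (lintegral_mono_ae ?_)
        filter_upwards [hb] with τ h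
        simp only [Pi.mul_apply]
        -- Where `ω = 0` the weight `ω⁻¹` is infinite, but the uniform bound forces `k τ` to vanish
        -- identically, so nothing is lost.
        rcases h.nonneg.eq_or_lt with h0 | h0
        · have : k τ x = 0 := by simpa [← h0] using h.sup x
          simp [this]
        · have h3 : w τ ≠ 0 := by simpa [hw] using h0
          have h4 : w τ ≠ ⊤ := ENNReal.ofReal_ne_top
          rw [← mul_assoc, ← ENNReal.mul_rpow_of_nonneg _ _ (by norm_num),
            ENNReal.mul_inv_cancel h3 h4]
          simp
      have h2 := ENNReal.lintegral_mul_le_Lp_mul_Lq μ Real.HolderConjugate.two_two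
        (f := fun τ => w τ ^ (1 / 2 : ℝ)) (g := fun τ => (w τ)⁻¹ ^ (1 / 2 : ℝ) * ‖k τ x‖ₑ)
        (hwm.pow_const _) ((hwm.inv.pow_const _).mul (hkx x).enorm.aemeasurable)
      have h3 := h1.trans h2
      refine (pow_le_pow_left' h3 2).trans (le_of_eq ?_)
      rw [mul_pow, ← ENNReal.rpow_natCast, ← ENNReal.rpow_natCast, ← ENNReal.rpow_mul,
        ← ENNReal.rpow_mul]
      simp only [ENNReal.mul_rpow_of_nonneg _ _ (show (0 : ℝ) ≤ 2 by norm_num),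
        ← ENNReal.rpow_mul]
      norm_num [hIdef]
    calc ∫⁻ x, ‖∫ τ, k τ x ∂μ‖ₑ ^ 2
        ≤ ∫⁻ x, I * ∫⁻ τ, (w τ)⁻¹ * ‖k τ x‖ₑ ^ 2 ∂μ := lintegral_mono hcs
      _ ≤ I * ∫⁻ x, ∫⁻ τ, (w τ)⁻¹ * ‖k τ x‖ₑ ^ 2 ∂μ := by
          rw [lintegral_const_mul' _ _ (by rw [← hI]; exact ENNReal.ofReal_ne_top)]
      _ = I * ∫⁻ τ, ∫⁻ x, (w τ)⁻¹ * ‖k τ x‖ₑ ^ 2 ∂volume ∂μ := by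
          rw [lintegral_lintegral_swap]
          have h1 : AEMeasurable (fun p : ℝ × T => (w p.2)⁻¹) (volume.prod μ) :=
            hwm.inv.comp_quasiMeasurePreserving Measure.quasiMeasurePreserving_snd
          exact h1.mul ((hk.comp measurable_swap).enorm.pow_const 2).aemeasurable
      _ ≤ I * ∫⁻ τ, w τ ∂μ := by
          gcongr 1
          refine lintegral_mono_ae ?_
          filter_upwards [hb] with τ h
          have hm : Measurable fun x => ‖k τ x‖ₑ ^ 2 :=
            (hk.comp (measurable_const.prodMk measurable_id)).enorm.pow_const 2
          rw [lintegral_const_mul _ hm]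
          rcases h.nonneg.eq_or_lt with h0 | h0
          · have h1 : ∀ x, k τ x = 0 := fun x => by simpa [← h0] using h.sup x
            simp [h1]
          · have h3 : w τ ≠ 0 := by simpa [hw] using h0
            have h4 : w τ ≠ ⊤ := ENNReal.ofReal_ne_top
            calc (w τ)⁻¹ * ∫⁻ x, ‖k τ x‖ₑ ^ 2 ≤ (w τ)⁻¹ * (w τ) ^ 2 := by
                  gcongr; exact h.lintegral_sq_le
              _ = w τ := by rw [sq, ← mul_assoc, ENNReal.inv_mul_cancel h3 h4, one_mul]
      _ = _ := by rw [hI, sq]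

/-! ### Bounds for the heat kernel and its Taylor remainders -/

/-- The decaying Gaussian majorant of the kernels. -/
noncomputable def majorant (γ β r X : ℝ) : ℝ :=
  Real.exp (-(3 / 4 * γ) * r) * Real.exp (-(β / r) * X ^ 2)

/-- A shift of the argument by at most `V r` changes the Gaussian exponent by `O(r)`. A quarter of
the damping `e^{-γr}` pays for this, so the kernel at nearby points `ξ` is dominated by one Gaussian
centred at zero in `X`. -/
lemma exists_abs_ker_le_majorant (hγ : 0 < γ) (V : ℝ) :
    ∃ β : ℝ, 0 < β ∧ ∀ n : ℕ, ∀ r X ξ : ℝ, 0 < r → |ξ - X| ≤ V * r →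
      |ker γ n r ξ| ≤ 300 * (√r)⁻¹ ^ (n + 1) * majorant γ β r X := by
  -- The weight in `X² ≤ (1+a)ξ² + (1+1/a)(ξ-X)²`, chosen with `V² ≤ 2aγ` so that the second term
  -- costs at most `γr/4` in the exponent.
  set a : ℝ := V ^ 2 / (2 * γ) + 1 with ha
  have ha0 : 0 < a := by positivity
  refine ⟨1 / (8 * (1 + a)), by positivity, fun n r X ξ hr h => (abs_ker_le n hr ξ).trans ?_⟩
  rw [mul_assoc]
  gcongr
  rw [majorant, ← Real.exp_add, ← Real.exp_add]
  apply Real.exp_le_exp.2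
  have h2 : (ξ - X) ^ 2 ≤ V ^ 2 * r ^ 2 := by
    rw [← mul_pow, ← sq_abs]; gcongr
  have h3 : X ^ 2 ≤ (1 + a) * ξ ^ 2 + (1 + 1 / a) * (ξ - X) ^ 2 := by
    have : 0 ≤ (a * ξ + (ξ - X)) ^ 2 / a := by positivity
    have e : (a * ξ + (ξ - X)) ^ 2 / a =
      (1 + a) * ξ ^ 2 + (1 + 1 / a) * (ξ - X) ^ 2 - X ^ 2 := by
      field_simp; ring
    linarith
  have h4 : V ^ 2 ≤ 2 * a * γ := by
    rw [ha]; field_simp; linarith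
  have h5 : V ^ 2 * r ^ 2 ≤ 2 * a * γ * r ^ 2 := by gcongr
  have key : X ^ 2 / (1 + a) ≤ ξ ^ 2 + 2 * γ * r ^ 2 := by
    have e : (1 + a) * (ξ ^ 2 + (ξ - X) ^ 2 / a) =
      (1 + a) * ξ ^ 2 + (1 + 1 / a) * (ξ - X) ^ 2 := by field_simp; ring
    rw [div_le_iff₀ (by positivity), mul_comm]
    have : (ξ - X) ^ 2 / a ≤ 2 * γ * r ^ 2 := by
      rw [div_le_iff₀ ha0]; linarith
    nlinarith
  have e1 : -γ * r + -ξ ^ 2 / (8 * r) = -(8 * γ * r ^ 2 + ξ ^ 2) / (8 * r) := by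
    field_simp; ring
  have e2 : -(3 / 4 * γ) * r + -(1 / (8 * (1 + a)) / r) * X ^ 2 =
      -(6 * γ * r ^ 2 + X ^ 2 / (1 + a)) / (8 * r) := by
    field_simp; ring
  rw [e1, e2]
  exact div_le_div_of_nonneg_right (by linarith) (by positivity)

lemma majorant_nonneg (γ β r X : ℝ) : 0 ≤ majorant γ β r X := by
  unfold majorant; positivity

lemma measurable_majorant (γ β r : ℝ) : Measurable (majorant γ β r) := by
  unfold majorant; fun_prop

lemma majorant_integral {β : ℝ} (hγ : 0 < γ) (hβ : 0 < β) {r : ℝ} (hr : 0 < r) :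
    Integrable (majorant γ β r) ∧ ∫ X, majorant γ β r X ≤ √(Real.pi / β) * √r := by
  have hb : 0 < β / r := by positivity
  refine ⟨(integrable_exp_neg_mul_sq hb).const_mul _, ?_⟩
  unfold majorant
  rw [integral_const_mul, integral_gaussian]
  have : √(Real.pi / (β / r)) = √(Real.pi / β) * √r := by
    rw [← Real.sqrt_mul (by positivity)]; congr 1; field_simp
  rw [this]
  apply mul_le_of_le_one_left (by positivity)
  apply Real.exp_le_one_iff.2; nlinarith

/-- The squared `L²` norm of the Gaussian grows like `√r`; another quarter of the damping absorbs
this growth, leaving `e^{-γr/2}` in both norms. -/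
lemma exists_bd_majorant {β : ℝ} (hγ : 0 < γ) (hβ : 0 < β) :
    ∃ C : ℝ, 0 < C ∧ ∀ r c : ℝ, 0 < r →
      Bd (fun x => majorant γ β r (x + c)) (C * Real.exp (-(γ / 2) * r)) := by
  set k : ℝ := Real.pi / (2 * β) with hk
  have hk0 : 0 < k := by positivity
  have hC : (1 : ℝ) ≤ 1 + 2 * k / γ := by
    have : 0 < 2 * k / γ := by positivity
    linarith
  refine ⟨1 + 2 * k / γ, by positivity, fun r c hr => ?_⟩
  suffices Bd (majorant γ β r) ((1 + 2 * k / γ) * Real.exp (-(γ / 2) * r)) from this.comp_add c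
  refine Bd.of_lintegral_sq_le (measurable_majorant _ _ _).aestronglyMeasurable (fun x => ?_) ?_
  · rw [abs_of_nonneg (majorant_nonneg _ _ _ _), majorant]
    calc _ ≤ Real.exp (-(γ / 2) * r) * 1 := by
          gcongr
          · linarith
          · apply Real.exp_le_one_iff.2
            have : 0 ≤ β / r * x ^ 2 := by positivity
            linarith
      _ = 1 * Real.exp (-(γ / 2) * r) := by ring
      _ ≤ _ := by gcongr
  · have hb : 0 < 2 * β / r := by positivity
    have hsq : ∀ x, ‖majorant γ β r x‖ₑ ^ 2 =
        ENNReal.ofReal (Real.exp (-(3 / 2 * γ) * r) * Real.exp (-(2 * β / r) * x ^ 2)) := by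
      intro x
      rw [Real.enorm_of_nonneg (majorant_nonneg _ _ _ _),
        ← ENNReal.ofReal_pow (majorant_nonneg _ _ _ _)]
      congr 1
      rw [majorant, ← Real.exp_add, ← Real.exp_add, ← Real.exp_nat_mul]
      congr 1; push_cast; ring
    simp_rw [hsq]
    rw [← ofReal_integral_eq_lintegral_ofReal ((integrable_exp_neg_mul_sq hb).const_mul _)
      (ae_of_all _ fun x => by positivity), integral_const_mul, integral_gaussian,
      ← ENNReal.ofReal_pow (by positivity)]
    apply ENNReal.ofReal_le_ofReal
    have e1 : Real.pi / (2 * β / r) = k * r := by rw [hk]; field_simp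
    have h1 : √(k * r) ≤ 1 + k * r := by
      rw [Real.sqrt_le_left (by positivity)]; nlinarith [mul_pos hk0 hr]
    have h2 : 1 + k * r ≤ (1 + 2 * k / γ) * Real.exp (γ / 2 * r) := by
      have h3 := Real.add_one_le_exp (γ / 2 * r)
      have h4 : 0 < 2 * k / γ := by positivity
      have h5 : k * r = 2 * k / γ * (γ / 2 * r) := by field_simp
      have h6 : 0 ≤ γ / 2 * r := by positivity
      rw [h5]; nlinarith
    have h3 : Real.exp (-(3 / 2 * γ) * r) * Real.exp (γ / 2 * r) = Real.exp (-(γ / 2) * r) ^ 2 := by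
      rw [← Real.exp_add, ← Real.exp_nat_mul]; congr 1; push_cast; ring
    rw [e1]
    calc Real.exp (-(3 / 2 * γ) * r) * √(k * r)
        ≤ Real.exp (-(3 / 2 * γ) * r) * ((1 + 2 * k / γ) * Real.exp (γ / 2 * r)) := by
          gcongr; exact h1.trans h2
      _ = (1 + 2 * k / γ) * Real.exp (-(γ / 2) * r) ^ 2 := by rw [← h3]; ring
      _ ≤ _ := by
        rw [mul_pow]; gcongr
        nlinarith

/-- Bounds of the kernel `ker γ n`, `n ≤ 4`, and of the first two Taylor remainders of `ker γ 0`,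
for steps `|h| ≤ V r`. -/
structure KernelBounds (γ V A : ℝ) : Prop where
  pos : 0 < A
  bd : ∀ (n : ℕ) (r c : ℝ), 0 < r →
    Bd (fun x => ker γ n r (x + c)) (A * (√r)⁻¹ ^ (n + 1) * Real.exp (-(γ / 2) * r))
  bd_taylor₁ : ∀ (r c h : ℝ), 0 < r → |h| ≤ V * r →
    Bd (fun x => ker γ 0 r (x + c) - ker γ 0 r (x + c - h))
      (A * (√r)⁻¹ ^ 2 * Real.exp (-(γ / 2) * r) * |h|)
  bd_taylor₂ : ∀ (r c h : ℝ), 0 < r → |h| ≤ V * r →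
    Bd (fun x => ker γ 0 r (x + c) - ker γ 0 r (x + c - h) - h * ker γ 1 r (x + c))
      (A * (√r)⁻¹ ^ 3 * Real.exp (-(γ / 2) * r) * h ^ 2)
  int : ∀ (n : ℕ) (r : ℝ), 0 < r → Integrable (ker γ n r) ∧
    ∫ X, |ker γ n r X| ≤ A * (√r)⁻¹ ^ n
  int_taylor₁ : ∀ (r h : ℝ), 0 < r → |h| ≤ V * r →
    Integrable (fun X => ker γ 0 r X - ker γ 0 r (X - h)) ∧
    ∫ X, |ker γ 0 r X - ker γ 0 r (X - h)| ≤ A * (√r)⁻¹ ^ 1 * |h|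
  int_taylor₂ : ∀ (r h : ℝ), 0 < r → |h| ≤ V * r →
    Integrable (fun X => ker γ 0 r X - ker γ 0 r (X - h) - h * ker γ 1 r X) ∧
    ∫ X, |ker γ 0 r X - ker γ 0 r (X - h) - h * ker γ 1 r X| ≤ A * (√r)⁻¹ ^ 2 * h ^ 2

lemma measurable_ker_right (n : ℕ) (r : ℝ) : Measurable (ker γ n r) :=
  (measurable_ker n).comp (measurable_const.prodMk measurable_id)

lemma continuous_ker_right (n : ℕ) {r : ℝ} (hr : 0 < r) : Continuous (ker γ n r) := by
  rw [continuous_iff_continuousAt]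
  intro X
  exact (continuousAt_ker (γ := γ) n (p := (r, X)) (Or.inl hr.ne')).comp
    (f := fun X => (r, X)) (by fun_prop)

/-- All intermediate points in the mean value theorem lie within `V r` of `X`, where the common
Gaussian majorant applies. The `Bd` fields serve the layer potentials, the `L¹` fields serve
convolution with the initial data. -/
lemma exists_kernelBounds (hγ : 0 < γ) {V : ℝ} (hV : 0 ≤ V) : ∃ A, KernelBounds γ V A := by
  obtain ⟨β, hβ, hk⟩ := exists_abs_ker_le_majorant hγ V
  obtain ⟨C, hC, hB⟩ := exists_bd_majorant hγ hβ
  set D := √(Real.pi / β)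
  have hD : 0 ≤ D := Real.sqrt_nonneg _
  set A := 300 * (C + D)
  have hmeas := fun n r => measurable_ker_right (γ := γ) n r
  have gen_bd : ∀ (K : ℝ → ℝ) (r a c : ℝ), 0 < r → 0 ≤ a → Measurable K →
      (∀ X, |K X| ≤ 300 * a * majorant γ β r X) →
      Bd (fun x => K (x + c)) (A * a * Real.exp (-(γ / 2) * r)) := by
    intro K r a c hr ha hK h
    have h1 := (hB r c hr).const_mul (300 * a)
    rw [abs_of_nonneg (by positivity)] at h1
    have h2 : 300 * a * (C * Real.exp (-(γ / 2) * r)) ≤ A * a * Real.exp (-(γ / 2) * r) := by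
      have : 0 ≤ D * a * Real.exp (-(γ / 2) * r) := by positivity
      simp only [A]; nlinarith
    have h3 := h1.mono h2
    have hle : ∀ x, ‖K (x + c)‖ ≤ ‖300 * a * majorant γ β r (x + c)‖ := fun x => by
      rw [Real.norm_eq_abs]; exact (h _).trans (le_abs_self _)
    exact ⟨(hK.comp (measurable_add_const c)).aestronglyMeasurable,
      fun x => (hle x).trans (h3.sup x), (eLpNorm_mono hle).trans h3.l2⟩
  have gen_int : ∀ (K : ℝ → ℝ) (r a : ℝ), 0 < r → 0 ≤ a → Measurable K →
      (∀ X, |K X| ≤ 300 * a * majorant γ β r X) →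
      Integrable K ∧ ∫ X, |K X| ≤ A * (a * √r) := by
    intro K r a hr ha hK h
    obtain ⟨h1, h2⟩ := majorant_integral hγ hβ hr
    have hi : Integrable K := (h1.const_mul (300 * a)).mono' hK.aestronglyMeasurable
      (ae_of_all _ h)
    refine ⟨hi, (integral_mono hi.abs (h1.const_mul (300 * a)) h).trans ?_⟩
    rw [integral_const_mul]
    calc 300 * a * ∫ X, majorant γ β r X ≤ 300 * a * (D * √r) := by gcongr
      _ ≤ _ := by
        have : 0 ≤ C * (a * √r) := by positivity
        simp only [A]; nlinarith
  have hker : ∀ (n : ℕ) (r X : ℝ), 0 < r →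
      |ker γ n r X| ≤ 300 * (√r)⁻¹ ^ (n + 1) * majorant γ β r X := fun n r X hr =>
    hk n r X X hr (by simp; positivity)
  have hseg : ∀ X h ξ : ℝ, ξ ∈ uIcc (X - h) X → |ξ - X| ≤ |h| := by
    intro X h ξ hξ
    rw [mem_uIcc] at hξ
    rcases hξ with hξ | hξ
    · rw [abs_of_nonpos (by linarith)]
      exact le_trans (by linarith) (le_abs_self h)
    · rw [abs_of_nonneg (by linarith)]
      exact le_trans (by linarith) (neg_le_abs h)
  have mvt : ∀ (f f' : ℝ → ℝ) (X h M : ℝ), (∀ ξ, HasDerivAt f (f' ξ) ξ) →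
      (∀ ξ ∈ uIcc (X - h) X, |f' ξ| ≤ M) → |f X - f (X - h)| ≤ M * |h| := by
    intro f f' X h M hf hM
    have := Convex.norm_image_sub_le_of_norm_hasDerivWithin_le
      (fun ξ _ => (hf ξ).hasDerivWithinAt) hM (convex_uIcc (X - h) X)
      left_mem_uIcc right_mem_uIcc
    simpa using this
  have hd : ∀ (n : ℕ) (r : ℝ), n ≤ 2 → 0 < r → ∀ ξ, HasDerivAt (ker γ n r) (ker γ (n + 1) r ξ) ξ :=
    fun n r hn hr ξ => hasDerivAt_ker hn (Or.inl hr.ne')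
  have ht1 : ∀ (n : ℕ) (r h X : ℝ), n ≤ 2 → 0 < r → |h| ≤ V * r →
      |ker γ n r X - ker γ n r (X - h)| ≤ 300 * ((√r)⁻¹ ^ (n + 2) * |h|) * majorant γ β r X := by
    intro n r h X hn hr hh
    refine (mvt _ _ X h _ (hd n r hn hr) fun ξ hξ => hk (n + 1) r X ξ hr
      ((hseg X h ξ hξ).trans hh)).trans (le_of_eq (by ring))
  have ht2 : ∀ (r h X : ℝ), 0 < r → |h| ≤ V * r →
      |ker γ 0 r X - ker γ 0 r (X - h) - h * ker γ 1 r X| ≤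
        300 * ((√r)⁻¹ ^ 3 * h ^ 2) * majorant γ β r X := by
    intro r h X hr hh
    -- The mean value theorem twice: first for `ξ ↦ ker₀ ξ - ξ ker₁ X`, whose derivative `ker₁ ξ -
    -- ker₁ X` is then estimated through `ker₂`.
    have h1 := mvt (fun ξ => ker γ 0 r ξ - ξ * ker γ 1 r X) (fun ξ => ker γ 1 r ξ - ker γ 1 r X)
      X h (300 * (√r)⁻¹ ^ 3 * majorant γ β r X * |h|)
      (fun ξ => by
        have := (hd 0 r (by simp) hr ξ).sub ((hasDerivAt_id ξ).mul_const (ker γ 1 r X))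
        rwa [one_mul] at this)
      (fun ξ hξ => by
        have hξ' := hseg X h ξ hξ
        have := mvt (ker γ 1 r) _ ξ (ξ - X) (300 * (√r)⁻¹ ^ 3 * majorant γ β r X)
          (hd 1 r (by simp) hr) (fun ζ hζ => hk 2 r X ζ hr ?_)
        · simp only [sub_sub_cancel] at this
          refine this.trans ?_
          gcongr
          have := majorant_nonneg γ β r X
          positivity
        · simp only [sub_sub_cancel] at hζ
          refine le_trans ?_ (hξ'.trans hh)
          rw [abs_sub_comm ξ X]
          exact abs_sub_left_of_mem_uIcc hζ |>.trans (le_of_eq (abs_sub_comm _ _)))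
    have e : ker γ 0 r X - ker γ 0 r (X - h) - h * ker γ 1 r X =
      (ker γ 0 r X - X * ker γ 1 r X) - (ker γ 0 r (X - h) - (X - h) * ker γ 1 r X) := by ring
    rw [e]
    refine h1.trans (le_of_eq ?_)
    rw [← sq_abs h]; ring
  have hsr : ∀ r : ℝ, 0 < r → (√r)⁻¹ * √r = 1 := fun r hr =>
    inv_mul_cancel₀ (Real.sqrt_pos.2 hr).ne'
  refine ⟨A, ⟨by positivity, fun n r c hr => ?_, fun r c h hr hh => ?_, fun r c h hr hh => ?_,
    fun n r hr => ?_, fun r h hr hh => ?_, fun r h hr hh => ?_⟩⟩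
  · exact gen_bd _ r _ c hr (by positivity) (hmeas n r) fun X => hker n r X hr
  · refine (gen_bd (fun X => ker γ 0 r X - ker γ 0 r (X - h)) r _ c hr (by positivity)
      ((hmeas 0 r).sub ((hmeas 0 r).comp (measurable_sub_const h)))
      fun X => ht1 0 r h X (by simp) hr hh).mono (le_of_eq (by ring))
  · refine (gen_bd (fun X => ker γ 0 r X - ker γ 0 r (X - h) - h * ker γ 1 r X) r _ c hr
      (by positivity)
      (((hmeas 0 r).sub ((hmeas 0 r).comp (measurable_sub_const h))).sub
        ((hmeas 1 r).const_mul h)) fun X => ht2 r h X hr hh).mono (le_of_eq (by ring))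
  · refine (gen_int _ r _ hr (by positivity) (hmeas n r) fun X => hker n r X hr).imp_right
      fun h => h.trans (le_of_eq ?_)
    rw [pow_succ, mul_assoc ((√r)⁻¹ ^ n), hsr r hr, mul_one]
  · refine (gen_int (fun X => ker γ 0 r X - ker γ 0 r (X - h)) r _ hr (by positivity)
      ((hmeas 0 r).sub ((hmeas 0 r).comp (measurable_sub_const h)))
      fun X => ht1 0 r h X (by simp) hr hh).imp_right fun hi => hi.trans (le_of_eq ?_)
    linear_combination (A * (√r)⁻¹ * |h|) * hsr r hr
  · refine (gen_int (fun X => ker γ 0 r X - ker γ 0 r (X - h) - h * ker γ 1 r X) r _ hr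
      (by positivity)
      (((hmeas 0 r).sub ((hmeas 0 r).comp (measurable_sub_const h))).sub
        ((hmeas 1 r).const_mul h)) fun X => ht2 r h X hr hh).imp_right fun hi => hi.trans
        (le_of_eq ?_)
    linear_combination (A * (√r)⁻¹ ^ 2 * h ^ 2) * hsr r hr

/-! ### Linear combinations of classical solutions -/

namespace IsClassical

variable {u w : ℝ → ℝ → ℝ}

lemma dx_comb (hu : IsClassical u) (hw : IsClassical w) (a b : ℝ) {t x : ℝ} (ht : 0 < t)
    (hx : x ≠ 0) : dx (fun t x => a * u t x + b * w t x) t x = a * dx u t x + b * dx w t x :=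
  (((hu.differentiableAt_x t x ht hx).hasDerivAt.const_mul a).add
    ((hw.differentiableAt_x t x ht hx).hasDerivAt.const_mul b)).deriv

lemma deriv_comb_eventuallyEq (hu : IsClassical u) (hw : IsClassical w) (a b : ℝ) {t x : ℝ}
    (ht : 0 < t) (hx : x ≠ 0) : deriv (fun x => a * u t x + b * w t x) =ᶠ[𝓝 x]
      fun x => a * deriv (u t) x + b * deriv (w t) x := by
  filter_upwards [isOpen_ne.mem_nhds hx] with y hy using hu.dx_comb hw a b ht hy

lemma dt_comb (hu : IsClassical u) (hw : IsClassical w) (a b : ℝ) {t x : ℝ} (ht : 0 < t)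
    (hx : x ≠ 0) : dt (fun t x => a * u t x + b * w t x) t x = a * dt u t x + b * dt w t x :=
  (((hu.differentiableAt_t t x ht hx).hasDerivAt.const_mul a).add
    ((hw.differentiableAt_t t x ht hx).hasDerivAt.const_mul b)).deriv

lemma dxx_comb (hu : IsClassical u) (hw : IsClassical w) (a b : ℝ) {t x : ℝ} (ht : 0 < t)
    (hx : x ≠ 0) : dxx (fun t x => a * u t x + b * w t x) t x = a * dxx u t x + b * dxx w t x := by
  unfold dxx
  rw [(hu.deriv_comb_eventuallyEq hw a b ht hx).deriv_eq]
  exact (((hu.differentiableAt_xx t x ht hx).hasDerivAt.const_mul a).add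
    ((hw.differentiableAt_xx t x ht hx).hasDerivAt.const_mul b)).deriv

lemma jump_comb (hu : IsClassical u) (hw : IsClassical w) (a b : ℝ) {t : ℝ} (ht : 0 < t) :
    jump (fun x => a * u t x + b * w t x) = a * jump (u t) + b * jump (w t) := by
  have hr : HasDerivWithinAt (fun x => a * u t x + b * w t x) _ (Ici 0) 0 :=
    ((hu.right_deriv t ht).hasDerivWithinAt.const_mul a).add
      ((hw.right_deriv t ht).hasDerivWithinAt.const_mul b)
  have hl : HasDerivWithinAt (fun x => a * u t x + b * w t x) _ (Iic 0) 0 :=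
    ((hu.left_deriv t ht).hasDerivWithinAt.const_mul a).add
      ((hw.left_deriv t ht).hasDerivWithinAt.const_mul b)
  unfold jump
  rw [hr.derivWithin (uniqueDiffOn_Ici 0 0 self_mem_Ici),
    hl.derivWithin (uniqueDiffOn_Iic 0 0 self_mem_Iic)]
  ring

lemma comb (hu : IsClassical u) (hw : IsClassical w) (a b : ℝ) :
    IsClassical (fun t x => a * u t x + b * w t x) where
  continuousOn := (hu.continuousOn.const_mul a).add (hw.continuousOn.const_mul b)
  bounded T := by
    obtain ⟨M, hM⟩ := hu.bounded T
    obtain ⟨N, hN⟩ := hw.bounded T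
    refine ⟨|a| * M + |b| * N, fun t h0 hT x => (abs_add_le _ _).trans ?_⟩
    rw [abs_mul, abs_mul]
    gcongr
    · exact hM t h0 hT x
    · exact hN t h0 hT x
  differentiableAt_t t x ht hx := ((hu.differentiableAt_t t x ht hx).const_mul a).add
    ((hw.differentiableAt_t t x ht hx).const_mul b)
  differentiableAt_x t x ht hx := ((hu.differentiableAt_x t x ht hx).const_mul a).add
    ((hw.differentiableAt_x t x ht hx).const_mul b)
  differentiableAt_xx t x ht hx := by
    refine DifferentiableAt.congr_of_eventuallyEq ?_ (hu.deriv_comb_eventuallyEq hw a b ht hx)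
    exact ((hu.differentiableAt_xx t x ht hx).const_mul a).add
      ((hw.differentiableAt_xx t x ht hx).const_mul b)
  continuousOn_dt := ((hu.continuousOn_dt.const_mul a).add (hw.continuousOn_dt.const_mul b)).congr
    fun p hp => hu.dt_comb hw a b hp.1 hp.2
  continuousOn_dx := ((hu.continuousOn_dx.const_mul a).add (hw.continuousOn_dx.const_mul b)).congr
    fun p hp => hu.dx_comb hw a b hp.1 hp.2
  continuousOn_dxx :=
    ((hu.continuousOn_dxx.const_mul a).add (hw.continuousOn_dxx.const_mul b)).congr
      fun p hp => hu.dxx_comb hw a b hp.1 hp.2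
  right_deriv t ht := ((hu.right_deriv t ht).const_mul a).add ((hw.right_deriv t ht).const_mul b)
  left_deriv t ht := ((hu.left_deriv t ht).const_mul a).add ((hw.left_deriv t ht).const_mul b)

end IsClassical

/-! ### The maximum principle -/

lemma deriv_nonneg_of_le_left {f : ℝ → ℝ} {f' a : ℝ} (hf : HasDerivWithinAt f f' (Iio a) a)
    (h : ∀ᶠ x in 𝓝[<] a, f x ≤ f a) : 0 ≤ f' := by
  rw [hasDerivWithinAt_iff_tendsto_slope' (by simp)] at hf
  refine ge_of_tendsto hf ?_
  filter_upwards [h, self_mem_nhdsWithin] with x hx hxa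
  rw [slope_def_field]
  exact div_nonneg_of_nonpos (by linarith) (by have := mem_Iio.1 hxa; linarith)

lemma deriv_nonpos_of_le_right {f : ℝ → ℝ} {f' a : ℝ} (hf : HasDerivWithinAt f f' (Ioi a) a)
    (h : ∀ᶠ x in 𝓝[>] a, f x ≤ f a) : f' ≤ 0 := by
  rw [hasDerivWithinAt_iff_tendsto_slope' (by simp)] at hf
  refine le_of_tendsto hf ?_
  filter_upwards [h, self_mem_nhdsWithin] with x hx hxa
  rw [slope_def_field]
  exact div_nonpos_of_nonpos_of_nonneg (by linarith) (by have := mem_Ioi.1 hxa; linarith)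

/-- A positive second derivative would make the point a local minimum too, so `f` would be locally
constant and its second derivative zero. -/
lemma deriv_deriv_nonpos_of_isLocalMax {f : ℝ → ℝ} {a : ℝ} (hf : IsLocalMax f a)
    (hc : ContinuousAt f a) : deriv (deriv f) a ≤ 0 := by
  by_contra! h
  have hmin := isLocalMin_of_deriv_deriv_pos h hf.deriv_eq_zero hc
  have hconst : f =ᶠ[𝓝 a] fun _ => f a := by
    filter_upwards [hf, hmin] with x h1 h2 using le_antisymm h1 h2
  have h2 : deriv (deriv f) a = 0 := by
    rw [hconst.deriv.deriv_eq]; simp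
  linarith

/-- The maximum principle: a bounded classical subsolution with zero initial data and without a
kink at the interface is nonpositive. -/
lemma IsClassical.nonpos {y : ℝ → ℝ → ℝ} (hy : IsClassical y) (hγ : 0 ≤ γ) {v : ℝ → ℝ} {V : ℝ}
    (hv : ∀ t, |v t| ≤ V)
    (heq : ∀ t x, 0 < t → x ≠ 0 → dt y t x = dxx y t x + v t * dx y t x - γ * y t x)
    (hjump : ∀ t, 0 < t → jump (y t) = 0) (h0 : ∀ x, y 0 x = 0) :
    ∀ t x, 0 ≤ t → y t x ≤ 0 := by
  intro T x₁ hT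
  have hV : 0 ≤ V := (abs_nonneg _).trans (hv 0)
  -- Barrier `ε e^{Kt} ψ(x)`. The growth of `x²` confines the maximum to a compact set, and the
  -- concave kink `-|x|` excludes a maximum at the interface. The rate `K` dominates `ψ'' = 2 < 3ψ`
  -- and `V|ψ'| ≤ 2Vψ`.
  set K := 3 + 2 * V with hK
  set ψ : ℝ → ℝ := fun x => x ^ 2 - |x| + 2 with hψ
  have hψ1 : ∀ x, x ^ 2 / 2 + 1 ≤ ψ x := fun x => by
    simp only [hψ]; nlinarith [sq_nonneg (|x| - 1), sq_abs x]
  suffices H : ∀ ε > 0, y T x₁ ≤ ε * (Real.exp (K * T) * ψ x₁) by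
    have hpos : 0 < Real.exp (K * T) * ψ x₁ :=
      mul_pos (Real.exp_pos _) (by nlinarith [hψ1 x₁, sq_nonneg x₁])
    by_contra! hcon
    have := H (y T x₁ / (2 * (Real.exp (K * T) * ψ x₁))) (by positivity)
    have e : y T x₁ / (2 * (Real.exp (K * T) * ψ x₁)) * (Real.exp (K * T) * ψ x₁) = y T x₁ / 2 := by
      generalize Real.exp (K * T) * ψ x₁ = P at hpos
      field_simp
    linarith
  intro ε hε
  by_contra! hcon
  obtain ⟨M, hM⟩ := hy.bounded T
  have hM0 : 0 ≤ M := (abs_nonneg _).trans (hM 0 le_rfl hT 0)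
  -- At distance `N` the barrier is at least `ε(N-1)/2 ≥ M`, hence exceeds `y`, and `x₁` still lies
  -- inside.
  set N := |x₁| + 2 * M / ε + 1 with hN
  have hN1 : |x₁| < N := by
    have : 0 ≤ 2 * M / ε := by positivity
    linarith
  have hNpos : 0 < N := (abs_nonneg _).trans_lt hN1
  set Φ : ℝ × ℝ → ℝ := fun p => y p.1 p.2 - ε * (Real.exp (K * p.1) * ψ p.2) with hΦ
  have hΦc : ContinuousOn Φ (Icc 0 T ×ˢ Icc (-N) N) := by
    refine (hy.continuousOn.mono fun p hp => hp.1.1).sub ?_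
    simp only [hψ]
    fun_prop
  obtain ⟨⟨t₀, x₀⟩, ⟨ht₀, hx₀⟩, hmax⟩ := (isCompact_Icc.prod isCompact_Icc).exists_isMaxOn
    ⟨(T, x₁), ⟨hT, le_rfl⟩, abs_le.1 hN1.le⟩ hΦc
  simp only at ht₀ hx₀
  have hpos : 0 < Φ (t₀, x₀) := by
    have h1 : Φ (T, x₁) ≤ Φ (t₀, x₀) := hmax ⟨⟨hT, le_rfl⟩, abs_le.1 hN1.le⟩
    have h2 : 0 < Φ (T, x₁) := by simp only [hΦ]; linarith
    linarith
  set E := ε * Real.exp (K * t₀) with hE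
  have hE0 : 0 < E := by positivity
  have hEε : ε ≤ E := by
    rw [hE]; exact le_mul_of_one_le_right hε.le (Real.one_le_exp (mul_nonneg (by positivity) ht₀.1))
  have hΦ0 : Φ (t₀, x₀) = y t₀ x₀ - E * ψ x₀ := by simp only [hΦ, hE]; ring
  have hypos : 0 < y t₀ x₀ := by
    have : 0 < E * ψ x₀ := mul_pos hE0 (by nlinarith [hψ1 x₀, sq_nonneg x₀])
    linarith
  have ht₀pos : 0 < t₀ := by
    rcases ht₀.1.eq_or_lt with h | h
    · rw [← h, h0] at hypos; exact absurd hypos (lt_irrefl _)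
    · exact h
  have hx₀N : |x₀| < N := by
    by_contra! hge
    have h1 : y t₀ x₀ ≤ M := (le_abs_self _).trans (hM t₀ ht₀.1 ht₀.2 x₀)
    have h2 : 2 * M / ε ≤ N - 1 := by rw [hN]; linarith [abs_nonneg x₁]
    have h2' : 2 * M ≤ (N - 1) * ε := by rwa [div_le_iff₀ hε] at h2
    have h3 : N - 1 ≤ ψ x₀ * 2 := by
      have := hψ1 x₀
      have h4 : N ^ 2 ≤ x₀ ^ 2 := by rw [← sq_abs x₀]; gcongr
      nlinarith [sq_nonneg (N - 1)]
    have h5 : ε * (N - 1) ≤ ε * (ψ x₀ * 2) := by gcongr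
    have h6 : ε * ψ x₀ ≤ E * ψ x₀ := by
      have := hψ1 x₀
      gcongr
      nlinarith [sq_nonneg x₀]
    linarith
  have hnear : ∀ᶠ x in 𝓝 x₀, y t₀ x - E * ψ x ≤ y t₀ x₀ - E * ψ x₀ := by
    filter_upwards [Ioo_mem_nhds (abs_lt.1 hx₀N).1 (abs_lt.1 hx₀N).2] with x hx
    have h1 : Φ (t₀, x) ≤ Φ (t₀, x₀) := hmax ⟨ht₀, hx.1.le, hx.2.le⟩
    rw [hΦ0] at h1
    refine le_trans (le_of_eq ?_) h1
    simp only [hΦ, hE]; ring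
  rcases eq_or_ne x₀ 0 with rfl | hx0
  -- At a maximum on the interface the one-sided derivatives satisfy `r + E ≤ 0 ≤ l - E`,
  -- contradicting `r = l`.
  · obtain hr := (hy.right_deriv t₀ ht₀pos).hasDerivWithinAt
    obtain hl := (hy.left_deriv t₀ ht₀pos).hasDerivWithinAt
    have hj := hjump t₀ ht₀pos
    unfold jump at hj
    set r := derivWithin (y t₀) (Ici 0) 0
    set l := derivWithin (y t₀) (Iic 0) 0
    have hq : HasDerivAt (fun x : ℝ => x ^ 2 + 2) 0 0 := by
      simpa using (hasDerivAt_pow 2 (0 : ℝ)).add_const 2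
    have hR : HasDerivWithinAt (fun x => y t₀ x - E * ψ x) (r - E * (0 - 1)) (Ioi 0) 0 := by
      have h1 : HasDerivWithinAt ψ (0 - 1) (Ioi 0) 0 := by
        refine (hq.hasDerivWithinAt.sub (hasDerivWithinAt_id _ _)).congr (fun x hx => ?_) ?_
        · simp only [hψ, abs_of_pos (mem_Ioi.1 hx), Pi.sub_apply, id]; ring
        · simp [hψ]
      exact (hr.mono Ioi_subset_Ici_self).sub (h1.const_mul E)
    have hL : HasDerivWithinAt (fun x => y t₀ x - E * ψ x) (l - E * (0 + 1)) (Iio 0) 0 := by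
      have h1 : HasDerivWithinAt ψ (0 + 1) (Iio 0) 0 := by
        refine (hq.hasDerivWithinAt.add (hasDerivWithinAt_id _ _)).congr (fun x hx => ?_) ?_
        · simp only [hψ, abs_of_neg (mem_Iio.1 hx), Pi.add_apply, id]; ring
        · simp [hψ]
      exact (hl.mono Iio_subset_Iic_self).sub (h1.const_mul E)
    have h1 := deriv_nonpos_of_le_right hR (hnear.filter_mono nhdsWithin_le_nhds)
    have h2 := deriv_nonneg_of_le_left hL (hnear.filter_mono nhdsWithin_le_nhds)
    linarith
  · obtain ⟨c, hc, hcx⟩ : ∃ c : ℝ, |c| = 1 ∧ ∀ᶠ x in 𝓝 x₀, |x| = c * x := by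
      rcases hx0.lt_or_gt with h | h
      · refine ⟨-1, by simp, ?_⟩
        filter_upwards [gt_mem_nhds h] with x hx
        rw [abs_of_neg hx]; ring
      · refine ⟨1, by simp, ?_⟩
        filter_upwards [lt_mem_nhds h] with x hx
        rw [abs_of_pos hx]; ring
    set f : ℝ → ℝ := fun x => y t₀ x - E * (x ^ 2 - c * x + 2) with hf
    have hfd : ∀ x, x ≠ 0 → HasDerivAt f (dx y t₀ x - E * (2 * x - c)) x := by
      intro x hx
      have h1 : HasDerivAt (fun x : ℝ => x ^ 2 - c * x + 2) (2 * x - c) x := by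
        simpa using ((hasDerivAt_pow 2 x).sub ((hasDerivAt_id x).const_mul c)).add_const 2
      exact (hy.differentiableAt_x t₀ x ht₀pos hx).hasDerivAt.sub (h1.const_mul E)
    have hfdd : deriv (deriv f) x₀ = dxx y t₀ x₀ - E * 2 := by
      have h1 : deriv f =ᶠ[𝓝 x₀] fun x => dx y t₀ x - E * (2 * x - c) := by
        filter_upwards [isOpen_ne.mem_nhds hx0] with x hx using (hfd x hx).deriv
      rw [h1.deriv_eq]
      have h2 : HasDerivAt (fun x : ℝ => 2 * x - c) 2 x₀ := by
        simpa using ((hasDerivAt_id x₀).const_mul 2).sub_const c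
      exact ((hy.differentiableAt_xx t₀ x₀ ht₀pos hx0).hasDerivAt.sub (h2.const_mul E)).deriv
    have hfmax : IsLocalMax f x₀ := by
      filter_upwards [hnear, hcx] with x h1 h2
      have h3 := hcx.self_of_nhds
      simp only [hf, hψ, h2, h3] at h1 ⊢
      exact h1
    have h1 : dx y t₀ x₀ - E * (2 * x₀ - c) = 0 := by
      rw [← (hfd x₀ hx0).deriv]; exact hfmax.deriv_eq_zero
    have h2 := deriv_deriv_nonpos_of_isLocalMax hfmax (hfd x₀ hx0).continuousAt
    rw [hfdd] at h2
    have h3 : HasDerivAt (fun t => Φ (t, x₀)) (dt y t₀ x₀ - ε * (Real.exp (K * t₀) * K * ψ x₀)) t₀ := by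
      have h4 : HasDerivAt (fun t => Real.exp (K * t) * ψ x₀) (Real.exp (K * t₀) * K * ψ x₀) t₀ := by
        simpa using (((hasDerivAt_id t₀).const_mul K).exp).mul_const (ψ x₀)
      exact (hy.differentiableAt_t t₀ x₀ ht₀pos hx0).hasDerivAt.sub (h4.const_mul ε)
    have h4 : 0 ≤ dt y t₀ x₀ - ε * (Real.exp (K * t₀) * K * ψ x₀) := by
      refine deriv_nonneg_of_le_left h3.hasDerivWithinAt ?_
      filter_upwards [Ioo_mem_nhdsLT ht₀pos] with t ht
      exact hmax ⟨⟨ht.1.le, ht.2.le.trans ht₀.2⟩, hx₀⟩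
    have h5 : ε * (Real.exp (K * t₀) * K * ψ x₀) = E * K * ψ x₀ := by rw [hE]; ring
    -- At a maximum off the interface `y_t ≥ EKψ`, whereas the equation gives at most `2E + 2VEψ -
    -- γy`, which is smaller since `2 < 3ψ` and `y > 0`.
    rw [h5, heq t₀ x₀ ht₀pos hx0] at h4
    have h6 : dx y t₀ x₀ = E * (2 * x₀ - c) := by linarith
    have h7 : v t₀ * dx y t₀ x₀ ≤ E * (V * (2 * ψ x₀)) := by
      have h8 : |2 * x₀ - c| ≤ 2 * ψ x₀ := by
        have := hψ1 x₀
        refine (abs_sub _ _).trans ?_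
        rw [hc, abs_mul, abs_two]
        nlinarith [sq_abs x₀, sq_nonneg (|x₀| - 1)]
      rw [h6]
      calc v t₀ * (E * (2 * x₀ - c)) = E * (v t₀ * (2 * x₀ - c)) := by ring
        _ ≤ E * |v t₀ * (2 * x₀ - c)| := by gcongr; exact le_abs_self _
        _ ≤ E * (V * (2 * ψ x₀)) := by
          rw [abs_mul]; gcongr; exact hv t₀
    have h8 : 0 ≤ γ * y t₀ x₀ := by positivity
    have h9 : E * 2 < E * (3 * ψ x₀) := by
      gcongr
      nlinarith [hψ1 x₀, sq_nonneg x₀]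
    have h10 : E * K * ψ x₀ = E * (3 * ψ x₀) + E * (V * (2 * ψ x₀)) := by rw [hK]; ring
    linarith

/-- Uniqueness for the linear problem with given drift and given jump. -/
lemma IsClassical.eq_of_jump_eq {u w : ℝ → ℝ → ℝ} (hu : IsClassical u) (hw : IsClassical w)
    (hγ : 0 ≤ γ) {v : ℝ → ℝ} {F : ℝ → ℝ → ℝ} {V : ℝ} (hv : ∀ t, |v t| ≤ V)
    (hueq : ∀ t x, 0 < t → x ≠ 0 → dt u t x = dxx u t x + v t * dx u t x + F t x - γ * u t x)
    (hweq : ∀ t x, 0 < t → x ≠ 0 → dt w t x = dxx w t x + v t * dx w t x + F t x - γ * w t x)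
    (hjump : ∀ t, 0 < t → jump (u t) = jump (w t)) (h0 : ∀ x, u 0 x = w 0 x) :
    ∀ t x, 0 ≤ t → u t x = w t x := by
  have key : ∀ {u w : ℝ → ℝ → ℝ}, IsClassical u → IsClassical w →
      (∀ t x, 0 < t → x ≠ 0 → dt u t x = dxx u t x + v t * dx u t x + F t x - γ * u t x) →
      (∀ t x, 0 < t → x ≠ 0 → dt w t x = dxx w t x + v t * dx w t x + F t x - γ * w t x) →
      (∀ t, 0 < t → jump (u t) = jump (w t)) → (∀ x, u 0 x = w 0 x) →
      ∀ t x, 0 ≤ t → u t x ≤ w t x := by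
    intro u w hu hw hueq hweq hjump h0 t x ht
    have := (hu.comb hw 1 (-1)).nonpos hγ hv (fun t x ht hx => ?_) (fun t ht => ?_) (fun x => ?_)
      t x ht
    · linarith
    · rw [hu.dt_comb hw _ _ ht hx, hu.dx_comb hw _ _ ht hx, hu.dxx_comb hw _ _ ht hx,
        hueq t x ht hx, hweq t x ht hx]
      ring
    · rw [hu.jump_comb hw _ _ ht, hjump t ht]; ring
    · rw [h0]; ring
  exact fun t x ht => le_antisymm (key hu hw hueq hweq hjump h0 t x ht)
    (key hw hu hweq hueq (fun t ht => (hjump t ht).symm) (fun x => (h0 x).symm) t x ht)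

/-! ### The heat semigroup applied to bounded data -/

/-- The `n`-th space derivative of the heat semigroup (damped by `e^{-γt}`) applied to `f`. -/
noncomputable def hom (γ : ℝ) (n : ℕ) (f : ℝ → ℝ) (t y : ℝ) : ℝ := ∫ w, ker γ n t (y - w) * f w

/-- A single integrable Gaussian for all `(t, y)` near `(t₀, y₀)`; it is the dominating function for
continuity and for differentiation under the integral. -/
lemma exists_ker_le_gaussian (hγ : 0 ≤ γ) (n : ℕ) {t₀ : ℝ} (ht₀ : 0 < t₀) (y₀ : ℝ) :
    ∃ C : ℝ, 0 ≤ C ∧ ∀ t y w, t₀ / 2 ≤ t → t ≤ 2 * t₀ → |y - y₀| ≤ 1 →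
      |ker γ n t (y - w)| ≤ C * Real.exp (-(1 / (32 * t₀)) * (w - y₀) ^ 2) := by
  refine ⟨300 * (√(t₀ / 2))⁻¹ ^ (n + 1) * 1 * Real.exp (1 / (16 * t₀)), by positivity,
    fun t y w h1 h2 h3 => ?_⟩
  have ht : 0 < t := by linarith
  refine (abs_ker_le n ht _).trans ?_
  rw [mul_assoc _ (Real.exp (1 / (16 * t₀))), ← Real.exp_add]
  have hs : 0 < √(t₀ / 2) := Real.sqrt_pos.2 (by linarith)
  have hB : Real.exp (-γ * t) ≤ 1 := Real.exp_le_one_iff.2 (by nlinarith)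
  have hE : -(y - w) ^ 2 / (8 * t) ≤ 1 / (16 * t₀) + -(1 / (32 * t₀)) * (w - y₀) ^ 2 := by
    have h4 : (w - y₀) ^ 2 ≤ 2 * (y - w) ^ 2 + 2 := by
      have : (y - y₀) ^ 2 ≤ 1 := by rw [← sq_abs]; exact pow_le_one₀ (abs_nonneg _) h3
      nlinarith [sq_nonneg ((y - w) + (y - y₀) ), sq_nonneg ((y - w) - (y - y₀) )]
    calc -(y - w) ^ 2 / (8 * t) ≤ -(y - w) ^ 2 / (8 * (2 * t₀)) := by
          rw [neg_div, neg_div]; gcongr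
      _ ≤ -((w - y₀) ^ 2 / 2 - 1) / (8 * (2 * t₀)) := by gcongr; linarith
      _ = _ := by field_simp; ring
  gcongr

lemma integrable_gaussian_sub {b : ℝ} (hb : 0 < b) (c y : ℝ) :
    Integrable fun w : ℝ => c * Real.exp (-b * (w - y) ^ 2) :=
  ((integrable_exp_neg_mul_sq hb).comp_sub_right y).const_mul c

section hom

variable {f : ℝ → ℝ} {c : ℝ}

lemma aestronglyMeasurable_hom_integrand (hf : Continuous f) (n : ℕ) (t y : ℝ) :
    AEStronglyMeasurable (fun w => ker γ n t (y - w) * f w) volume := by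
  have h : Measurable fun w => ker γ n t (y - w) :=
    (measurable_ker_right n t).comp (measurable_const.sub measurable_id)
  exact (h.mul hf.measurable).aestronglyMeasurable

lemma integrable_hom (hγ : 0 ≤ γ) (hf : Continuous f) (hc : ∀ x, |f x| ≤ c) (n : ℕ) {t : ℝ}
    (ht : 0 < t) (y : ℝ) : Integrable fun w => ker γ n t (y - w) * f w := by
  obtain ⟨C, hC, hb⟩ := exists_ker_le_gaussian hγ n ht y
  refine (integrable_gaussian_sub (b := 1 / (32 * t)) (by positivity) (C * c) y).mono'
    (aestronglyMeasurable_hom_integrand hf n t y) (ae_of_all _ fun w => ?_)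
  rw [Real.norm_eq_abs, abs_mul, mul_right_comm]
  gcongr
  · exact hb t y w (by linarith) (by linarith) (by simp)
  · exact hc w

lemma continuousAt_hom (hγ : 0 ≤ γ) (hf : Continuous f) (hc : ∀ x, |f x| ≤ c) (n : ℕ)
    {p : ℝ × ℝ} (hp : 0 < p.1) : ContinuousAt (fun p : ℝ × ℝ => hom γ n f p.1 p.2) p := by
  obtain ⟨C, hC, hb⟩ := exists_ker_le_gaussian hγ n hp p.2
  refine continuousAt_of_dominated
    (bound := fun w => C * c * Real.exp (-(1 / (32 * p.1)) * (w - p.2) ^ 2))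
    (Eventually.of_forall fun q => aestronglyMeasurable_hom_integrand hf n q.1 q.2) ?_
    (integrable_gaussian_sub (by positivity) _ _) (ae_of_all _ fun w => ?_)
  · have h1 : ∀ᶠ q : ℝ × ℝ in 𝓝 p, q.1 ∈ Ioo (p.1 / 2) (2 * p.1) :=
      continuousAt_fst.eventually (Ioo_mem_nhds (by linarith) (by linarith))
    have h2 : ∀ᶠ q : ℝ × ℝ in 𝓝 p, q.2 ∈ Metric.ball p.2 1 :=
      continuousAt_snd.eventually (Metric.ball_mem_nhds _ one_pos)
    filter_upwards [h1, h2] with q hq1 hq2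
    refine ae_of_all _ fun w => ?_
    rw [Real.norm_eq_abs, abs_mul, mul_right_comm]
    rw [Metric.mem_ball, Real.dist_eq] at hq2
    gcongr
    · exact hb _ _ w hq1.1.le hq1.2.le hq2.le
    · exact hc w
  · have := (continuousAt_ker (γ := γ) n (p := (p.1, p.2 - w)) (Or.inl hp.ne'))
    exact (ContinuousAt.comp (f := fun q : ℝ × ℝ => (q.1, q.2 - w)) this (by fun_prop)).mul_const _

lemma hasDerivAt_hom_comp (hγ : 0 ≤ γ) (hf : Continuous f) (hc : ∀ x, |f x| ≤ c) {n : ℕ}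
    (hn : n ≤ 2) {ρ Y ρ' Y' : ℝ → ℝ} {θ : ℝ} (hρ : ∀ θ, HasDerivAt ρ (ρ' θ) θ)
    (hY : ∀ θ, HasDerivAt Y (Y' θ) θ) (hρ' : Continuous ρ') (hY' : Continuous Y')
    (hpos : 0 < ρ θ) :
    HasDerivAt (fun θ => hom γ n f (ρ θ) (Y θ))
      (ρ' θ * (hom γ (n + 2) f (ρ θ) (Y θ) - γ * hom γ n f (ρ θ) (Y θ))
        + Y' θ * hom γ (n + 1) f (ρ θ) (Y θ)) θ := by
  obtain ⟨C₀, hC₀, hb₀⟩ := exists_ker_le_gaussian hγ n hpos (Y θ)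
  obtain ⟨C₁, hC₁, hb₁⟩ := exists_ker_le_gaussian hγ (n + 1) hpos (Y θ)
  obtain ⟨C₂, hC₂, hb₂⟩ := exists_ker_le_gaussian hγ (n + 2) hpos (Y θ)
  set P := |ρ' θ| + 1 with hP
  set Q := |Y' θ| + 1 with hQ
  have hnear : ∀ᶠ η in 𝓝 θ, (ρ θ / 2 < ρ η ∧ ρ η < 2 * ρ θ) ∧ |Y η - Y θ| ≤ 1 ∧ |ρ' η| ≤ P ∧
      |Y' η| ≤ Q := by
    have e1 := (hρ θ).continuousAt.eventually
      (Ioo_mem_nhds (show ρ θ / 2 < ρ θ by linarith) (show ρ θ < 2 * ρ θ by linarith))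
    have e2 := (hY θ).continuousAt.eventually (Metric.ball_mem_nhds _ one_pos)
    have e3 := hρ'.continuousAt.abs.eventually (gt_mem_nhds (show |ρ' θ| < P by simp [hP]))
    have e4 := hY'.continuousAt.abs.eventually (gt_mem_nhds (show |Y' θ| < Q by simp [hQ]))
    filter_upwards [e1, e2, e3, e4] with η h1 h2 h3 h4
    rw [Real.dist_eq] at h2
    exact ⟨h1, h2.le, le_of_lt h3, le_of_lt h4⟩
  set F' : ℝ → ℝ → ℝ := fun η w => (ρ' η * (ker γ (n + 2) (ρ η) (Y η - w)
      - γ * ker γ n (ρ η) (Y η - w)) + Y' η * ker γ (n + 1) (ρ η) (Y η - w)) * f w with hF'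
  have main := hasDerivAt_integral_of_dominated_loc_of_deriv_le (μ := volume) (x₀ := θ)
    (F := fun η w => ker γ n (ρ η) (Y η - w) * f w) (F' := F')
    (bound := fun w => ((P * (C₂ + γ * C₀) + Q * C₁) * c) *
      Real.exp (-(1 / (32 * ρ θ)) * (w - Y θ) ^ 2)) hnear
    (Eventually.of_forall fun η => aestronglyMeasurable_hom_integrand hf n _ _)
    (integrable_hom hγ hf hc n hpos _) ?_ (ae_of_all _ fun w η hη => ?_)
    (integrable_gaussian_sub (by positivity) _ _) (ae_of_all _ fun w η hη => ?_)
  · refine main.2.congr_deriv ?_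
    have i0 := integrable_hom hγ hf hc n hpos (Y θ)
    have i1 := integrable_hom hγ hf hc (n + 1) hpos (Y θ)
    have i2 := integrable_hom hγ hf hc (n + 2) hpos (Y θ)
    simp only [hom, hF']
    rw [← integral_const_mul γ, ← integral_sub i2 (i0.const_mul γ), ← integral_const_mul,
      ← integral_const_mul (Y' θ), ← integral_add]
    · congr 1; ext w; ring
    · exact (i2.sub (i0.const_mul γ)).const_mul (ρ' θ)
    · exact i1.const_mul (Y' θ)
  · have h : ∀ n, Measurable fun w => ker γ n (ρ θ) (Y θ - w) := fun n =>
      (measurable_ker_right n _).comp (measurable_const.sub measurable_id)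
    exact (((((h _).sub ((h _).const_mul _)).const_mul _).add ((h _).const_mul _)).mul
      hf.measurable).aestronglyMeasurable
  · obtain ⟨⟨h1, h1'⟩, h2, h3, h4⟩ := hη
    have k0 := hb₀ _ _ w h1.le h1'.le h2
    have k1 := hb₁ _ _ w h1.le h1'.le h2
    have k2 := hb₂ _ _ w h1.le h1'.le h2
    set e := Real.exp (-(1 / (32 * ρ θ)) * (w - Y θ) ^ 2)
    rw [hF', Real.norm_eq_abs, abs_mul]
    have hP0 : 0 ≤ P := by positivity
    have hQ0 : 0 ≤ Q := by positivity
    have hA : |ρ' η * (ker γ (n + 2) (ρ η) (Y η - w) - γ * ker γ n (ρ η) (Y η - w))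
        + Y' η * ker γ (n + 1) (ρ η) (Y η - w)| ≤ P * (C₂ * e + γ * (C₀ * e)) + Q * (C₁ * e) := by
      refine (abs_add_le _ _).trans ?_
      rw [abs_mul, abs_mul]
      gcongr
      refine (abs_sub _ _).trans ?_
      rw [abs_mul, abs_of_nonneg hγ]
      gcongr
    calc _ ≤ (P * (C₂ * e + γ * (C₀ * e)) + Q * (C₁ * e)) * c := by
          gcongr
          exact hc w
      _ = _ := by ring
  · obtain ⟨⟨h1, h1'⟩, -⟩ := hη
    have hne : ρ η ≠ 0 := by linarith
    exact (hasDerivAt_ker_comp hn (hρ η) ((hY η).sub_const w) (Or.inl hne)).mul_const (f w)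

end hom

/-- The damped heat semigroup, in a form which is continuous up to `t = 0`. -/
noncomputable def flow (γ : ℝ) (f : ℝ → ℝ) (t y : ℝ) : ℝ :=
  Real.exp (-γ * t) * ∫ ζ, ker 0 0 1 ζ * f (y - √t * ζ)

lemma integral_ker_zero_one : Integrable (ker 0 0 1) ∧ ∫ ζ, ker 0 0 1 ζ = 1 := by
  have e : ker 0 0 1 = fun ζ => (√(4 * Real.pi))⁻¹ * Real.exp (-(1 / 4) * ζ ^ 2) := by
    ext ζ; simp only [ker, gaussPow]; norm_num; left; ring
  rw [e]
  refine ⟨(integrable_exp_neg_mul_sq (by norm_num)).const_mul _, ?_⟩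
  rw [integral_const_mul, integral_gaussian]
  have : Real.pi / (1 / 4) = 4 * Real.pi := by ring
  rw [this, inv_mul_cancel₀ (by positivity)]

lemma flow_zero (f : ℝ → ℝ) (y : ℝ) : flow γ f 0 y = f y := by
  simp [flow, integral_mul_const, integral_ker_zero_one.2]

lemma continuous_flow {f : ℝ → ℝ} {c : ℝ} (hf : Continuous f) (hc : ∀ x, |f x| ≤ c) :
    Continuous fun p : ℝ × ℝ => flow γ f p.1 p.2 := by
  unfold flow
  refine Continuous.mul (by fun_prop) ?_
  refine continuous_of_dominated (bound := fun ζ => ker 0 0 1 ζ * c) (fun p => ?_) (fun p => ?_)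
    (integral_ker_zero_one.1.mul_const c) (ae_of_all _ fun ζ => by fun_prop)
  · exact ((measurable_ker_right 0 1).mul
      (hf.measurable.comp (by fun_prop))).aestronglyMeasurable
  · refine ae_of_all _ fun ζ => ?_
    rw [Real.norm_eq_abs, abs_mul, abs_of_nonneg (ker_zero_nonneg _ _)]
    exact mul_le_mul_of_nonneg_left (hc _) (ker_zero_nonneg _ _)

lemma flow_eq_hom (f : ℝ → ℝ) {t : ℝ} (ht : 0 < t) (y : ℝ) : flow γ f t y = hom γ 0 f t y := by
  have hs : 0 < √t := Real.sqrt_pos.2 ht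
  have h1 : hom γ 0 f t y = ∫ w, ker γ 0 t w * f (y - w) := by
    rw [hom, ← integral_sub_left_eq_self _ volume y]
    simp
  have h2 := Measure.integral_comp_mul_left (fun w => ker γ 0 t w * f (y - w)) (√t)
  rw [h1, flow]
  have h3 : ∀ ζ, ker γ 0 t (√t * ζ) = Real.exp (-γ * t) * (√t)⁻¹ * ker 0 0 1 ζ := by
    intro ζ
    simp only [ker, gaussPow, mul_pow, Real.sq_sqrt ht.le]
    have e : -(t * ζ ^ 2) / (4 * t) = -ζ ^ 2 / (4 * 1) := by field_simp
    rw [e]; simp; ring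
  simp only [h3, mul_assoc, smul_eq_mul] at h2
  rw [integral_const_mul, integral_const_mul, abs_of_pos (inv_pos.2 hs)] at h2
  have h4 : (√t)⁻¹ ≠ 0 := (inv_pos.2 hs).ne'
  apply mul_left_cancel₀ h4
  rw [← h2]; ring

/-- Young's inequality for the uniform norm and the norm of `L²(ℝ)`. -/
lemma Bd.conv {K f : ℝ → ℝ} {a c : ℝ} (hf : Bd f c) (hfc : Continuous f) (hK : Measurable K)
    (hi : Integrable K) (ha : ∫ X, |K X| ≤ a) (y : ℝ) :
    Bd (fun x => ∫ w, K (x + y - w) * f w) (a * c) := by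
  have h1 : ∀ x, ∫ w, K (x + y - w) * f w = ∫ w, K w * f (x + y - w) := by
    intro x
    rw [← integral_sub_left_eq_self _ volume (x + y)]
    simp
  simp_rw [h1]
  have h2 := Bd.integral (μ := volume) (k := fun w x => K w * f (x + y - w))
    (ω := fun w => |K w| * c) ?_ (hi.abs.mul_const c) (ae_of_all _ fun w => ?_)
  · refine h2.mono ?_
    rw [integral_mul_const]
    exact mul_le_mul_of_nonneg_right ha hf.nonneg
  · exact (hK.comp measurable_fst).mul (hfc.measurable.comp (by fun_prop))
  · simpa [sub_eq_add_neg, add_assoc] using (hf.comp_add (y - w)).const_mul (K w)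

lemma KernelBounds.bd_hom {V A : ℝ} (hA : KernelBounds γ V A) {f : ℝ → ℝ} {c : ℝ} (hf : Bd f c)
    (hfc : Continuous f) (n : ℕ) {t : ℝ} (ht : 0 < t) (y : ℝ) :
    Bd (fun x => hom γ n f t (x + y)) (A * (√t)⁻¹ ^ n * c) :=
  hf.conv hfc (measurable_ker_right n t) (hA.int n t ht).1 (hA.int n t ht).2 y

/-! ### Regularity off the interface -/

/-- `F` has the space derivatives `Fx`, `Fxx` and the time derivative `Ft` off the interface, and
these are continuous there. -/
structure HasDerivs (F Fx Fxx Ft : ℝ → ℝ → ℝ) : Prop where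
  x : ∀ t x, 0 < t → x ≠ 0 → HasDerivAt (F t) (Fx t x) x
  xx : ∀ t x, 0 < t → x ≠ 0 → HasDerivAt (Fx t) (Fxx t x) x
  t : ∀ t x, 0 < t → x ≠ 0 → HasDerivAt (fun s => F s x) (Ft t x) t
  cx : ContinuousOn (fun p : ℝ × ℝ => Fx p.1 p.2) offInterface
  cxx : ContinuousOn (fun p : ℝ × ℝ => Fxx p.1 p.2) offInterface
  ct : ContinuousOn (fun p : ℝ × ℝ => Ft p.1 p.2) offInterface

namespace HasDerivs

variable {F Fx Fxx Ft H Hx Hxx Ht : ℝ → ℝ → ℝ}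

lemma add (h : HasDerivs F Fx Fxx Ft) (h' : HasDerivs H Hx Hxx Ht) :
    HasDerivs (fun t x => F t x + H t x) (fun t x => Fx t x + Hx t x)
      (fun t x => Fxx t x + Hxx t x) (fun t x => Ft t x + Ht t x) :=
  ⟨fun t x ht hx => (h.x t x ht hx).add (h'.x t x ht hx),
    fun t x ht hx => (h.xx t x ht hx).add (h'.xx t x ht hx),
    fun t x ht hx => (h.t t x ht hx).add (h'.t t x ht hx),
    h.cx.add h'.cx, h.cxx.add h'.cxx, h.ct.add h'.ct⟩

lemma time_mul {σ σ' : ℝ → ℝ} (hσ : ∀ t, HasDerivAt σ (σ' t) t) (hσ' : Continuous σ')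
    (hF : ContinuousOn (fun p : ℝ × ℝ => F p.1 p.2) offInterface) (h : HasDerivs F Fx Fxx Ft) :
    HasDerivs (fun t x => σ t * F t x) (fun t x => σ t * Fx t x) (fun t x => σ t * Fxx t x)
      (fun t x => σ' t * F t x + σ t * Ft t x) := by
  have hc : Continuous σ := continuous_iff_continuousAt.2 fun t => (hσ t).continuousAt
  have h1 : ContinuousOn (fun p : ℝ × ℝ => σ p.1) offInterface := by fun_prop
  have h2 : ContinuousOn (fun p : ℝ × ℝ => σ' p.1) offInterface := by fun_prop
  exact ⟨fun t x ht hx => (h.x t x ht hx).const_mul _, fun t x ht hx => (h.xx t x ht hx).const_mul _,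
    fun t x ht hx => (hσ t).mul (h.t t x ht hx), h1.mul h.cx, h1.mul h.cxx,
    (h2.mul hF).add (h1.mul h.ct)⟩

lemma sub (h : HasDerivs F Fx Fxx Ft) (h' : HasDerivs H Hx Hxx Ht) :
    HasDerivs (fun t x => F t x - H t x) (fun t x => Fx t x - Hx t x)
      (fun t x => Fxx t x - Hxx t x) (fun t x => Ft t x - Ht t x) :=
  ⟨fun t x ht hx => (h.x t x ht hx).sub (h'.x t x ht hx),
    fun t x ht hx => (h.xx t x ht hx).sub (h'.xx t x ht hx),
    fun t x ht hx => (h.t t x ht hx).sub (h'.t t x ht hx),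
    h.cx.sub h'.cx, h.cxx.sub h'.cxx, h.ct.sub h'.ct⟩

lemma congr (h : HasDerivs F Fx Fxx Ft) (hF : ∀ t x, 0 < t → x ≠ 0 → H t x = F t x) :
    HasDerivs H Fx Fxx Ft := by
  refine ⟨fun t x ht hx => (h.x t x ht hx).congr_of_eventuallyEq ?_, h.xx,
    fun t x ht hx => (h.t t x ht hx).congr_of_eventuallyEq ?_, h.cx, h.cxx, h.ct⟩
  · filter_upwards [isOpen_ne.mem_nhds hx] with y hy using hF t y ht hy
  · filter_upwards [lt_mem_nhds ht] with s hs using hF s x hs hx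

lemma dx_eq (h : HasDerivs F Fx Fxx Ft) {t x : ℝ} (ht : 0 < t) (hx : x ≠ 0) :
    dx F t x = Fx t x := (h.x t x ht hx).deriv

lemma deriv_eventuallyEq (h : HasDerivs F Fx Fxx Ft) {t x : ℝ} (ht : 0 < t) (hx : x ≠ 0) :
    deriv (F t) =ᶠ[𝓝 x] Fx t := by
  filter_upwards [isOpen_ne.mem_nhds hx] with y hy using h.dx_eq ht hy

lemma dxx_eq (h : HasDerivs F Fx Fxx Ft) {t x : ℝ} (ht : 0 < t) (hx : x ≠ 0) :
    dxx F t x = Fxx t x := by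
  rw [dxx, (h.deriv_eventuallyEq ht hx).deriv_eq, (h.xx t x ht hx).deriv]

lemma dt_eq (h : HasDerivs F Fx Fxx Ft) {t x : ℝ} (ht : 0 < t) (hx : x ≠ 0) :
    dt F t x = Ft t x := (h.t t x ht hx).deriv

lemma isClassical (h : HasDerivs F Fx Fxx Ft)
    (hc : ContinuousOn (fun p : ℝ × ℝ => F p.1 p.2) {p | 0 ≤ p.1})
    (hb : ∀ T : ℝ, ∃ M : ℝ, ∀ t, 0 ≤ t → t ≤ T → ∀ x, |F t x| ≤ M)
    (hr : ∀ t, 0 < t → DifferentiableWithinAt ℝ (F t) (Ici 0) 0)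
    (hl : ∀ t, 0 < t → DifferentiableWithinAt ℝ (F t) (Iic 0) 0) : IsClassical F where
  continuousOn := hc
  bounded := hb
  differentiableAt_t t x ht hx := (h.t t x ht hx).differentiableAt
  differentiableAt_x t x ht hx := (h.x t x ht hx).differentiableAt
  differentiableAt_xx t x ht hx :=
    (h.xx t x ht hx).differentiableAt.congr_of_eventuallyEq (h.deriv_eventuallyEq ht hx)
  continuousOn_dt := h.ct.congr fun _ hp => h.dt_eq hp.1 hp.2
  continuousOn_dx := h.cx.congr fun _ hp => h.dx_eq hp.1 hp.2
  continuousOn_dxx := h.cxx.congr fun _ hp => h.dxx_eq hp.1 hp.2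
  right_deriv := hr
  left_deriv := hl

end HasDerivs

lemma hasDerivs_hom (hγ : 0 ≤ γ) {f : ℝ → ℝ} {c : ℝ} (hf : Continuous f) (hc : ∀ x, |f x| ≤ c)
    {n : ℕ} (hn : n ≤ 1) {s v : ℝ → ℝ} (hs : ∀ t, HasDerivAt s (v t) t) (hv : Continuous v) :
    HasDerivs (fun t x => hom γ n f t (x + s t)) (fun t x => hom γ (n + 1) f t (x + s t))
      (fun t x => hom γ (n + 2) f t (x + s t))
      (fun t x => hom γ (n + 2) f t (x + s t) + v t * hom γ (n + 1) f t (x + s t)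
        - γ * hom γ n f t (x + s t)) := by
  have hsc : Continuous s := continuous_iff_continuousAt.2 fun t => (hs t).continuousAt
  have hx : ∀ n ≤ 2, ∀ t x, 0 < t →
      HasDerivAt (fun x => hom γ n f t (x + s t)) (hom γ (n + 1) f t (x + s t)) x := by
    intro n hn t x ht
    have := hasDerivAt_hom_comp hγ hf hc hn (ρ := fun _ => t) (Y := fun x => x + s t)
      (ρ' := fun _ => 0) (Y' := fun _ => 1) (θ := x) (fun θ => hasDerivAt_const _ _)
      (fun θ => (hasDerivAt_id θ).add_const _) continuous_const continuous_const ht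
    simpa using this
  have hcont : ∀ n, ContinuousOn (fun p : ℝ × ℝ => hom γ n f p.1 (p.2 + s p.1)) offInterface := by
    intro n p hp
    refine ContinuousAt.continuousWithinAt ?_
    exact ContinuousAt.comp (f := fun p : ℝ × ℝ => (p.1, p.2 + s p.1))
      (continuousAt_hom hγ hf hc n (p := (p.1, p.2 + s p.1)) hp.1) (by fun_prop)
  have hv' : ContinuousOn (fun p : ℝ × ℝ => v p.1) offInterface := by fun_prop
  refine ⟨fun t x ht _ => hx n (by omega) t x ht, fun t x ht _ => hx (n + 1) (by omega) t x ht,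
    fun t x ht _ => ?_, hcont _, hcont _,
    ((hcont _).add (hv'.mul (hcont _))).sub ((hcont _).const_mul _)⟩
  have := hasDerivAt_hom_comp hγ hf hc (show n ≤ 2 by omega) (ρ := fun t => t)
      (Y := fun t => x + s t)
      (ρ' := fun _ => 1) (Y' := v) (θ := t) (fun θ => hasDerivAt_id θ)
      (fun θ => (hs θ).const_add x) continuous_const hv ht
  refine this.congr_deriv ?_
  ring

/-! ### Layer potentials -/

/-- The layer potential with kernel `ker γ n` and density `m` on the moving interface `s`, in the
frame attached to the interface. -/
noncomputable def layer (γ : ℝ) (n : ℕ) (s m : ℝ → ℝ) (t x : ℝ) : ℝ :=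
  ∫ τ in (0 : ℝ)..t, ker γ n (t - τ) (x + (s t - s τ)) * m τ

/-! ### Smoothness of layer potentials off the interface -/

section interior

variable {s v m : ℝ → ℝ}

lemma continuousAt_layer_integrand (hs : Continuous s) (hm : Continuous m) (n : ℕ)
    {q : (ℝ × ℝ) × ℝ} (hx : q.1.1 ≠ q.2 ∨ q.1.2 ≠ 0) :
    ContinuousAt (fun q : (ℝ × ℝ) × ℝ =>
      ker γ n (q.1.1 - q.2) (q.1.2 + (s q.1.1 - s q.2)) * m q.2) q := by
  have h : q.1.1 - q.2 ≠ 0 ∨ q.1.2 + (s q.1.1 - s q.2) ≠ 0 := by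
    by_cases he : q.1.1 = q.2
    · right; simpa [he] using (by tauto : q.1.2 ≠ 0)
    · left; exact sub_ne_zero.2 he
  have := continuousAt_ker (γ := γ) n
    (p := (q.1.1 - q.2, q.1.2 + (s q.1.1 - s q.2))) h
  refine ContinuousAt.mul ?_ (by fun_prop)
  exact ContinuousAt.comp (f := fun q : (ℝ × ℝ) × ℝ =>
    (q.1.1 - q.2, q.1.2 + (s q.1.1 - s q.2))) this (by fun_prop)

lemma exists_layer_integrand_bound (hs : Continuous s) (hm : Continuous m) (n : ℕ) (T : ℝ)
    {p₀ : ℝ × ℝ} (hx : p₀.2 ≠ 0) : ∃ C : ℝ, 0 ≤ C ∧ ∀ᶠ p : ℝ × ℝ in 𝓝 p₀, ∀ τ ∈ Icc 0 T,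
      |ker γ n (p.1 - τ) (p.2 + (s p.1 - s τ)) * m τ| ≤ C := by
  have hpos : 0 < |p₀.2| / 2 := by positivity
  have hcont : ContinuousOn (fun q : (ℝ × ℝ) × ℝ =>
      ker γ n (q.1.1 - q.2) (q.1.2 + (s q.1.1 - s q.2)) * m q.2)
      (Metric.closedBall p₀ (|p₀.2| / 2) ×ˢ Icc 0 T) := by
    rintro q ⟨hq, -⟩
    refine (continuousAt_layer_integrand hs hm n (Or.inr ?_)).continuousWithinAt
    intro h0
    have h1 : dist q.1.2 p₀.2 ≤ |p₀.2| / 2 := (le_max_right _ _).trans hq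
    rw [h0, Real.dist_eq, zero_sub, abs_neg] at h1
    linarith
  obtain ⟨C, hC⟩ := ((isCompact_closedBall _ _).prod isCompact_Icc).exists_bound_of_continuousOn
    hcont
  refine ⟨max C 0, le_max_right _ _, ?_⟩
  filter_upwards [Metric.closedBall_mem_nhds p₀ hpos] with p hp τ hτ
  exact (hC (p, τ) ⟨hp, hτ⟩).trans (le_max_left _ _)

lemma intervalIntegrable_layer (hs : Continuous s) (hm : Continuous m) (n : ℕ) (t a b : ℝ)
    {x : ℝ} (hx : x ≠ 0) :
    IntervalIntegrable (fun τ => ker γ n (t - τ) (x + (s t - s τ)) * m τ) volume a b := by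
  apply Continuous.intervalIntegrable
  rw [continuous_iff_continuousAt]
  intro τ
  exact ContinuousAt.comp (f := fun τ => ((t, x), τ))
    (continuousAt_layer_integrand hs hm n (q := ((t, x), τ)) (Or.inr hx)) (by fun_prop)

/-- Because the kernel vanishes for nonpositive times, the upper limit `t` may be frozen at a later
`T`. Differentiation in time then produces no boundary term. -/
lemma layer_eq_of_le (hs : Continuous s) (hm : Continuous m) (n : ℕ) {t T : ℝ} (htT : t ≤ T)
    {x : ℝ} (hx : x ≠ 0) :
    layer γ n s m t x = ∫ τ in (0 : ℝ)..T, ker γ n (t - τ) (x + (s t - s τ)) * m τ := by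
  rw [layer, ← intervalIntegral.integral_add_adjacent_intervals (b := t)
    (intervalIntegrable_layer hs hm n t 0 t hx) (intervalIntegrable_layer hs hm n t t T hx)]
  have : ∫ τ in t..T, ker γ n (t - τ) (x + (s t - s τ)) * m τ = 0 := by
    rw [intervalIntegral.integral_congr (g := fun _ => 0)]
    · simp
    · intro τ hτ
      rw [uIcc_of_le htT] at hτ
      simp only
      rw [ker_of_nonpos n (by linarith [hτ.1]), zero_mul]
  rw [this, add_zero]

lemma continuousAt_layer_off (hs : Continuous s) (hm : Continuous m) (n : ℕ)
    {p : ℝ × ℝ} (hp : p ∈ offInterface) :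
    ContinuousAt (fun p : ℝ × ℝ => layer γ n s m p.1 p.2) p := by
  obtain ⟨hp1, hp2⟩ := hp
  have hev : (fun p : ℝ × ℝ => layer γ n s m p.1 p.2) =ᶠ[𝓝 p] fun q =>
      ∫ τ in (0 : ℝ)..(p.1 + 1), ker γ n (q.1 - τ) (q.2 + (s q.1 - s τ)) * m τ := by
    filter_upwards [continuousAt_fst.eventually (gt_mem_nhds (lt_add_one p.1)),
      continuousAt_snd.eventually (isOpen_ne.mem_nhds hp2)] with q h1 h2
    exact layer_eq_of_le hs hm n (le_of_lt h1) h2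
  refine ContinuousAt.congr ?_ hev.symm
  obtain ⟨C, -, hC⟩ := exists_layer_integrand_bound (γ := γ) hs hm n (p.1 + 1) hp2
  refine intervalIntegral.continuousAt_of_dominated_interval (bound := fun _ => C) ?_ ?_
    intervalIntegrable_const (ae_of_all _ fun τ _ => ?_)
  · filter_upwards [continuousAt_snd.eventually (isOpen_ne.mem_nhds hp2)] with q h2
    exact (intervalIntegrable_layer hs hm n q.1 0 (p.1 + 1) h2).def'.aestronglyMeasurable
  · filter_upwards [hC] with q hq
    refine ae_of_all _ fun τ hτ => hq τ ?_
    rw [uIoc_of_le (by linarith)] at hτ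
    exact Ioc_subset_Icc_self hτ
  · exact ContinuousAt.comp (f := fun q : ℝ × ℝ => (q, τ))
      (continuousAt_layer_integrand hs hm n (q := (p, τ)) (Or.inr hp2)) (by fun_prop)

/-- Away from `x = 0` the integrand never meets the singular point of the kernel, even at `τ = t`,
so the integral can be differentiated termwise. The term with `v` is the drift due to the moving
frame. -/
lemma hasDerivAt_layer_comp (hs : ∀ t, HasDerivAt s (v t) t) (hv : Continuous v)
    (hm : Continuous m) {n : ℕ} (hn : n ≤ 2) {ρ X : ℝ → ℝ} {ρ' X' θ : ℝ}
    (hρ : ∀ θ, HasDerivAt ρ ρ' θ) (hX : ∀ θ, HasDerivAt X X' θ) (hpos : 0 < ρ θ)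
    (hne : X θ ≠ 0) :
    HasDerivAt (fun θ => layer γ n s m (ρ θ) (X θ))
      (ρ' * (layer γ (n + 2) s m (ρ θ) (X θ) - γ * layer γ n s m (ρ θ) (X θ))
        + (X' + v (ρ θ) * ρ') * layer γ (n + 1) s m (ρ θ) (X θ)) θ := by
  have hsc : Continuous s := continuous_iff_continuousAt.2 fun t => (hs t).continuousAt
  have hρc : Continuous ρ := continuous_iff_continuousAt.2 fun t => (hρ t).continuousAt
  have hXc : Continuous X := continuous_iff_continuousAt.2 fun t => (hX t).continuousAt
  set T := ρ θ + 1 with hT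
  set k : ℕ → ℝ → ℝ → ℝ := fun n η τ => ker γ n (ρ η - τ) (X η + (s (ρ η) - s τ)) * m τ with hk
  have hlay : ∀ n, layer γ n s m (ρ θ) (X θ) = ∫ τ in (0 : ℝ)..T, k n θ τ := fun n =>
    layer_eq_of_le hsc hm n (by linarith) hne
  have hev : (fun θ => layer γ n s m (ρ θ) (X θ)) =ᶠ[𝓝 θ] fun η => ∫ τ in (0 : ℝ)..T, k n η τ := by
    filter_upwards [(hρ θ).continuousAt.eventually (gt_mem_nhds (lt_add_one (ρ θ))),
      (hX θ).continuousAt.eventually (isOpen_ne.mem_nhds hne)] with q h1 h2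
    exact layer_eq_of_le hsc hm n (le_of_lt h1) h2
  refine HasDerivAt.congr_of_eventuallyEq ?_ hev
  have hpath : ContinuousAt (fun η => (ρ η, X η)) θ := by fun_prop
  have hbd : ∀ n, ∃ C : ℝ, 0 ≤ C ∧ ∀ᶠ η in 𝓝 θ, ∀ τ ∈ Icc 0 T, |k n η τ| ≤ C := by
    intro n
    obtain ⟨C, h0, hC⟩ := exists_layer_integrand_bound (γ := γ) hsc hm n T (p₀ := (ρ θ, X θ)) hne
    exact ⟨C, h0, hpath.eventually hC⟩
  obtain ⟨C₀, hC₀, hb₀⟩ := hbd n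
  obtain ⟨C₁, hC₁, hb₁⟩ := hbd (n + 1)
  obtain ⟨C₂, hC₂, hb₂⟩ := hbd (n + 2)
  set Q := |v (ρ θ)| + 1 with hQ
  have hvb : ∀ᶠ η in 𝓝 θ, |v (ρ η)| < Q :=
    (hv.comp hρc).continuousAt.abs.eventually (gt_mem_nhds (lt_add_one _))
  set F' : ℝ → ℝ → ℝ := fun η τ => ρ' * (k (n + 2) η τ - γ * k n η τ)
    + (X' + v (ρ η) * ρ') * k (n + 1) η τ with hF'
  have hint : ∀ n, IntervalIntegrable (k n θ) volume 0 T := fun n =>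
    intervalIntegrable_layer hsc hm n _ _ _ hne
  have main := intervalIntegral.hasDerivAt_integral_of_dominated_loc_of_deriv_le (μ := volume)
    (a := 0) (b := T) (x₀ := θ) (F := k n) (F' := F')
    (bound := fun _ => |ρ'| * (C₂ + |γ| * C₀) + (|X'| + Q * |ρ'|) * C₁)
    (s := {η | X η ≠ 0 ∧ |v (ρ η)| < Q ∧ (∀ τ ∈ Icc 0 T, |k n η τ| ≤ C₀) ∧
      (∀ τ ∈ Icc 0 T, |k (n + 1) η τ| ≤ C₁) ∧ ∀ τ ∈ Icc 0 T, |k (n + 2) η τ| ≤ C₂})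
    ?_ ?_ (hint n) ?_ (ae_of_all _ fun τ hτ η hη => ?_) intervalIntegrable_const
    (ae_of_all _ fun τ hτ η hη => ?_)
  · refine main.2.congr_deriv ?_
    rw [hlay, hlay, hlay, ← intervalIntegral.integral_const_mul,
      ← intervalIntegral.integral_sub (hint _) ((hint n).const_mul _),
      ← intervalIntegral.integral_const_mul, ← intervalIntegral.integral_const_mul,
      ← intervalIntegral.integral_add (((hint _).sub ((hint n).const_mul _)).const_mul _)
        ((hint _).const_mul _)]
  · filter_upwards [(hX θ).continuousAt.eventually (isOpen_ne.mem_nhds hne), hvb, hb₀, hb₁, hb₂]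
      with η h1 h2 h3 h4 h5 using ⟨h1, h2, h3, h4, h5⟩
  · filter_upwards [(hX θ).continuousAt.eventually (isOpen_ne.mem_nhds hne)] with η h1
    exact (intervalIntegrable_layer hsc hm n _ _ _ h1).def'.aestronglyMeasurable
  · exact ((((hint _).sub ((hint n).const_mul _)).const_mul _).add
      ((hint _).const_mul _)).def'.aestronglyMeasurable
  · obtain ⟨h1, h2, h3, h4, h5⟩ := hη
    rw [uIoc_of_le (by linarith)] at hτ
    have hτ' := Ioc_subset_Icc_self hτ
    rw [hF', Real.norm_eq_abs]
    refine (abs_add_le _ _).trans ?_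
    rw [abs_mul ρ', abs_mul _ (k _ _ _)]
    gcongr
    · refine (abs_sub _ _).trans ?_
      rw [abs_mul γ]
      gcongr
      · exact h5 τ hτ'
      · exact h3 τ hτ'
    · refine (abs_add_le _ _).trans ?_
      rw [abs_mul]
      gcongr
    · exact h4 τ hτ'
  · obtain ⟨h1, -⟩ := hη
    have hd : HasDerivAt (fun η => X η + (s (ρ η) - s τ)) (X' + v (ρ η) * ρ') η :=
      (hX η).add (((hs (ρ η)).comp η (hρ η)).sub_const _)
    have := (hasDerivAt_ker_comp (γ := γ) hn ((hρ η).sub_const τ) hd ?_).mul_const (m τ)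
    · refine this.congr_deriv ?_
      simp only [hF', hk]; ring
    · by_cases he : ρ η = τ
      · right; simpa [he] using h1
      · left; exact sub_ne_zero.2 he

lemma hasDerivs_layer (hs : ∀ t, HasDerivAt s (v t) t) (hv : Continuous v)
    (hm : Continuous m) {n : ℕ} (hn : n ≤ 1) :
    HasDerivs (layer γ n s m) (layer γ (n + 1) s m) (layer γ (n + 2) s m)
      (fun t x => layer γ (n + 2) s m t x + v t * layer γ (n + 1) s m t x
        - γ * layer γ n s m t x) := by
  have hsc : Continuous s := continuous_iff_continuousAt.2 fun t => (hs t).continuousAt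
  have hx : ∀ n ≤ 2, ∀ t x, 0 < t → x ≠ 0 →
      HasDerivAt (layer γ n s m t) (layer γ (n + 1) s m t x) x := by
    intro n hn t x ht hx
    have := hasDerivAt_layer_comp (γ := γ) hs hv hm hn (ρ := fun _ => t) (X := fun x => x)
      (ρ' := 0) (X' := 1) (θ := x) (fun θ => hasDerivAt_const _ _)
      (fun θ => hasDerivAt_id θ) ht hx
    simpa using this
  have hcont : ∀ n, ContinuousOn (fun p : ℝ × ℝ => layer γ n s m p.1 p.2) offInterface :=
    fun n p hp => (continuousAt_layer_off hsc hm n hp).continuousWithinAt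
  have hv' : ContinuousOn (fun p : ℝ × ℝ => v p.1) offInterface := by fun_prop
  refine ⟨hx n (by omega), hx (n + 1) (by omega), fun t x ht hx => ?_, hcont _, hcont _,
    ((hcont _).add (hv'.mul (hcont _))).sub ((hcont _).const_mul _)⟩
  have := hasDerivAt_layer_comp (γ := γ) hs hv hm (show n ≤ 2 by omega) (ρ := fun t => t)
      (X := fun _ => x) (ρ' := 1) (X' := 0) (θ := t) (fun θ => hasDerivAt_id θ)
      (fun θ => hasDerivAt_const _ _) ht hx
  refine this.congr_deriv ?_
  ring

end interior

/-! ### Continuity of the layer potentials up to the interface -/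

/-- The difference of double layer potentials with kernel `ker γ n` and density
`(σ(t) - σ(τ)) m(τ)`. -/
noncomputable def dlayer (γ : ℝ) (n : ℕ) (s σ m : ℝ → ℝ) (t x : ℝ) : ℝ :=
  ∫ τ in (0 : ℝ)..t, ker γ n (t - τ) (x + (s t - s τ)) * ((σ t - σ τ) * m τ)

lemma intervalIntegrable_inv_sqrt (a b : ℝ) :
    IntervalIntegrable (fun r : ℝ => (√r)⁻¹) volume a b := by
  refine (intervalIntegral.intervalIntegrable_rpow' (a := a) (b := b)
    (r := -(1 / 2)) (by norm_num)).mono_fun (by fun_prop) (ae_of_all _ fun r => ?_)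
  rcases le_or_gt r 0 with h | h
  · simp [Real.sqrt_eq_zero_of_nonpos h]
  · show ‖(√r)⁻¹‖ ≤ ‖r ^ (-(1 / 2) : ℝ)‖
    rw [Real.sqrt_eq_rpow, Real.rpow_neg h.le]

lemma intervalIntegrable_inv_sqrt_sub (t a b : ℝ) :
    IntervalIntegrable (fun τ : ℝ => (√(t - τ))⁻¹) volume a b := by
  simpa using (intervalIntegrable_inv_sqrt (t - a) (t - b)).comp_sub_left t

lemma intervalIntegrable_of_abs_le {f : ℝ → ℝ} {t C : ℝ} (ht : 0 ≤ t) (hf : Measurable f)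
    (h : ∀ τ ∈ Ioo 0 t, |f τ| ≤ C * (√(t - τ))⁻¹) : IntervalIntegrable f volume 0 t := by
  rw [intervalIntegrable_iff_integrableOn_Ioo_of_le ht]
  have h1 : IntegrableOn (fun τ => C * (√(t - τ))⁻¹) (Ioo 0 t) := by
    rw [← intervalIntegrable_iff_integrableOn_Ioo_of_le ht]
    exact (intervalIntegrable_inv_sqrt_sub t 0 t).const_mul C
  exact h1.mono' hf.aestronglyMeasurable
    ((ae_restrict_iff' measurableSet_Ioo).2 (ae_of_all _ fun τ hτ => h τ hτ))

/-- Tailored to integrals written in the elapsed time `r = t - τ`: the singularity stays at `r = 0`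
when `t` varies, so `C/√r` dominates locally uniformly. -/
lemma continuousAt_primitive_of_singular {F : ℝ × ℝ → ℝ → ℝ} (hm : ∀ p, Measurable (F p))
    (hb : ∀ T : ℝ, ∃ C : ℝ, ∀ p : ℝ × ℝ, |p.1| ≤ T → ∀ r, |r| ≤ T → |F p r| ≤ C * (√r)⁻¹)
    (hc : ∀ r, r ≠ 0 → Continuous fun p => F p r) {p : ℝ × ℝ} (hp : 0 ≤ p.1) :
    ContinuousAt (fun p : ℝ × ℝ => ∫ r in (0 : ℝ)..p.1, F p r) p := by
  obtain ⟨C, hC⟩ := hb (p.1 + 1)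
  have := intervalIntegral.continuousAt_parametric_primitive_of_dominated (μ := volume)
    (F := F) (fun r => C * (√r)⁻¹) (-1) (p.1 + 1) (a₀ := 0) (b₀ := p.1) (x₀ := p)
    (fun q => (hm q).aestronglyMeasurable) ?_ ((intervalIntegrable_inv_sqrt _ _).const_mul C) ?_
    (by constructor <;> linarith) (by constructor <;> linarith) (by simp)
  · exact ContinuousAt.comp (f := fun q : ℝ × ℝ => (q, q.1)) this (by fun_prop)
  · filter_upwards [continuousAt_fst.eventually
      (Ioo_mem_nhds (show -(p.1 + 1) < p.1 by linarith) (lt_add_one p.1))] with q hq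
    refine (ae_restrict_iff' measurableSet_uIoc).2 (ae_of_all _ fun r hr => ?_)
    rw [uIoc_of_le (by linarith)] at hr
    exact hC q (abs_le.2 ⟨hq.1.le, hq.2.le⟩) r (abs_le.2 ⟨by linarith [hr.1], hr.2⟩)
  · have h0 : ∀ᵐ r : ℝ ∂volume, r ≠ 0 := by simp [ae_iff]
    exact ae_restrict_of_ae (h0.mono fun r hr => (hc r hr).continuousAt)

lemma abs_ker_le' (hγ : 0 ≤ γ) (n : ℕ) (r X : ℝ) : |ker γ n r X| ≤ 300 * (√r)⁻¹ ^ (n + 1) := by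
  rcases le_or_gt r 0 with h | h
  · rw [ker_of_nonpos n h, abs_zero]; positivity
  · refine (abs_ker_le n h X).trans ?_
    have h1 : Real.exp (-γ * r) ≤ 1 := Real.exp_le_one_iff.2 (by nlinarith)
    have h2 : Real.exp (-X ^ 2 / (8 * r)) ≤ 1 := by
      apply Real.exp_le_one_iff.2
      rw [neg_div]
      have : 0 ≤ X ^ 2 / (8 * r) := by positivity
      linarith
    calc _ ≤ 300 * (√r)⁻¹ ^ (n + 1) * 1 * 1 := by gcongr
      _ = _ := by ring

lemma continuous_ker_comp (n : ℕ) {r : ℝ} (hr : r ≠ 0) {X : ℝ × ℝ → ℝ} (hX : Continuous X) :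
    Continuous fun p => ker γ n r (X p) := by
  rw [continuous_iff_continuousAt]
  intro p
  exact ContinuousAt.comp (f := fun p => (r, X p))
    (continuousAt_ker (γ := γ) n (p := (r, X p)) (Or.inl hr)) (by fun_prop)

lemma layer_eq_reflect (n : ℕ) (s m : ℝ → ℝ) (t x : ℝ) :
    layer γ n s m t x = ∫ r in (0 : ℝ)..t, ker γ n r (x + (s t - s (t - r))) * m (t - r) := by
  have := intervalIntegral.integral_comp_sub_left (a := 0) (b := t)
    (fun τ => ker γ n (t - τ) (x + (s t - s τ)) * m τ) t
  simp only [sub_sub_cancel, sub_self, sub_zero] at this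
  exact this.symm

lemma dlayer_eq_reflect (n : ℕ) (s σ m : ℝ → ℝ) (t x : ℝ) :
    dlayer γ n s σ m t x = ∫ r in (0 : ℝ)..t, ker γ n r (x + (s t - s (t - r))) *
      ((σ t - σ (t - r)) * m (t - r)) := by
  have := intervalIntegral.integral_comp_sub_left (a := 0) (b := t)
    (fun τ => ker γ n (t - τ) (x + (s t - s τ)) * ((σ t - σ τ) * m τ)) t
  simp only [sub_sub_cancel, sub_self, sub_zero] at this
  exact this.symm

lemma exists_abs_le_of_continuous {m : ℝ → ℝ} (hm : Continuous m) (T : ℝ) :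
    ∃ C : ℝ, 0 ≤ C ∧ ∀ t, |t| ≤ T → |m t| ≤ C := by
  obtain ⟨C, hC⟩ := (isCompact_Icc (a := -T) (b := T)).exists_bound_of_continuousOn hm.continuousOn
  exact ⟨max C 0, le_max_right _ _, fun t ht => (hC t (abs_le.1 ht)).trans (le_max_left _ _)⟩

lemma exists_lipschitz_of_hasDerivAt {σ q : ℝ → ℝ} (hσ : ∀ t, HasDerivAt σ (q t) t)
    (hq : Continuous q) (T : ℝ) :
    ∃ L : ℝ, 0 ≤ L ∧ ∀ a b, |a| ≤ T → |b| ≤ T → |σ a - σ b| ≤ L * |a - b| := by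
  obtain ⟨L, hL0, hL⟩ := exists_abs_le_of_continuous hq T
  refine ⟨L, hL0, fun a b ha hb => ?_⟩
  have := Convex.norm_image_sub_le_of_norm_hasDerivWithin_le (s := Icc (-T) T)
    (fun t _ => (hσ t).hasDerivWithinAt) (fun t ht => hL t (abs_le.2 ht)) (convex_Icc _ _)
    (abs_le.1 hb) (abs_le.1 ha)
  simpa using this

lemma inv_sqrt_sq_mul {r : ℝ} (hr : 0 < r) : (√r)⁻¹ ^ 2 * r = 1 := by
  rw [inv_pow, Real.sq_sqrt hr.le, inv_mul_cancel₀ hr.ne']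

section continuity

variable {s m σ q : ℝ → ℝ}

lemma continuousAt_layer (hγ : 0 ≤ γ) (hs : Continuous s) (hm : Continuous m) {p : ℝ × ℝ}
    (hp : 0 ≤ p.1) : ContinuousAt (fun p : ℝ × ℝ => layer γ 0 s m p.1 p.2) p := by
  simp_rw [layer_eq_reflect]
  refine continuousAt_primitive_of_singular (F := fun p r =>
    ker γ 0 r (p.2 + (s p.1 - s (p.1 - r))) * m (p.1 - r)) (fun p => ?_) (fun T => ?_)
    (fun r hr => ?_) hp
  · exact ((measurable_ker 0).comp (by fun_prop :
      Measurable fun r => (r, p.2 + (s p.1 - s (p.1 - r))))).mul (by fun_prop)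
  · obtain ⟨C, hC0, hC⟩ := exists_abs_le_of_continuous hm (2 * T)
    refine ⟨300 * C, fun p hp r hr => ?_⟩
    rw [abs_mul]
    calc _ ≤ 300 * (√r)⁻¹ ^ (0 + 1) * C := by
          gcongr
          · exact abs_ker_le' hγ 0 r _
          · exact hC _ ((abs_sub _ _).trans (by linarith))
      _ = _ := by ring
  · exact (continuous_ker_comp 0 hr (by fun_prop)).mul (by fun_prop)

/-- The Lipschitz factor `σ(t) - σ(τ) = O(t-τ)` cancels the `(t-τ)^{-1}` of `ker γ 1`. The integrand
is bounded up to the interface, so this double layer has no jump. -/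
lemma continuousAt_dlayer (hγ : 0 ≤ γ) (hs : Continuous s) (hm : Continuous m)
    (hσ : ∀ t, HasDerivAt σ (q t) t) (hq : Continuous q) {p : ℝ × ℝ}
    (hp : 0 ≤ p.1) : ContinuousAt (fun p : ℝ × ℝ => dlayer γ 1 s σ m p.1 p.2) p := by
  have hσc : Continuous σ := continuous_iff_continuousAt.2 fun t => (hσ t).continuousAt
  simp_rw [dlayer_eq_reflect]
  refine continuousAt_primitive_of_singular (F := fun p r =>
    ker γ 1 r (p.2 + (s p.1 - s (p.1 - r))) * ((σ p.1 - σ (p.1 - r)) * m (p.1 - r)))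
    (fun p => ?_) (fun T => ?_) (fun r hr => ?_) hp
  · exact ((measurable_ker 1).comp (by fun_prop :
      Measurable fun r => (r, p.2 + (s p.1 - s (p.1 - r))))).mul (by fun_prop)
  · obtain ⟨C, hC0, hC⟩ := exists_abs_le_of_continuous hm (2 * T)
    obtain ⟨L, hL0, hL⟩ := exists_lipschitz_of_hasDerivAt hσ hq (2 * T)
    refine ⟨300 * L * C * √T, fun p hp r hr => ?_⟩
    rcases le_or_gt r 0 with h | h
    · rw [ker_of_nonpos 1 h, zero_mul, abs_zero]; positivity
    have hrT : r ≤ T := (le_abs_self r).trans hr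
    have h1 : |σ p.1 - σ (p.1 - r)| ≤ L * r := by
      have := hL p.1 (p.1 - r) (by linarith [abs_nonneg r]) ((abs_sub _ _).trans (by linarith))
      rwa [sub_sub_cancel, abs_of_pos h] at this
    rw [abs_mul, abs_mul]
    calc _ ≤ 300 * (√r)⁻¹ ^ (1 + 1) * (L * r * C) := by
          gcongr
          · exact abs_ker_le' hγ 1 r _
          · exact hC _ ((abs_sub _ _).trans (by linarith))
      _ = 300 * L * C * ((√r)⁻¹ ^ 2 * r) := by ring
      _ = 300 * L * C * (√r * (√r)⁻¹) := by
          rw [inv_sqrt_sq_mul h, mul_inv_cancel₀ (Real.sqrt_pos.2 h).ne']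
      _ ≤ 300 * L * C * (√T * (√r)⁻¹) := by gcongr
      _ = _ := by ring
  · exact (continuous_ker_comp 1 hr (by fun_prop)).mul (by fun_prop)

lemma measurable_ker_layer (hs : Continuous s) (n : ℕ) (t x : ℝ) :
    Measurable fun τ => ker γ n (t - τ) (x + (s t - s τ)) :=
  (measurable_ker n).comp (by fun_prop : Measurable fun τ => (t - τ, x + (s t - s τ)))

lemma abs_dlayer_integrand_le (hγ : 0 ≤ γ) {t L C : ℝ} (n : ℕ) (x : ℝ)
    (hL : ∀ τ ∈ Ioo 0 t, |σ t - σ τ| ≤ L * (t - τ)) (hC : ∀ τ ∈ Ioo 0 t, |m τ| ≤ C) {τ : ℝ}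
    (hτ : τ ∈ Ioo 0 t) :
    |ker γ (n + 1) (t - τ) x * ((σ t - σ τ) * m τ)| ≤ 300 * L * C * (√(t - τ))⁻¹ ^ n := by
  have h : 0 < t - τ := by linarith [hτ.2]
  have hL0 : 0 ≤ L * (t - τ) := (abs_nonneg _).trans (hL τ hτ)
  rw [abs_mul, abs_mul]
  calc _ ≤ 300 * (√(t - τ))⁻¹ ^ (n + 1 + 1) * (L * (t - τ) * C) := by
        gcongr
        · exact abs_ker_le' hγ _ _ _
        · exact hL τ hτ
        · exact hC τ hτ
    _ = 300 * L * C * (√(t - τ))⁻¹ ^ n * ((√(t - τ))⁻¹ ^ 2 * (t - τ)) := by ring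
    _ = _ := by rw [inv_sqrt_sq_mul h, mul_one]

/-- Even after one more derivative, `(t-τ)^{-3/2} (t-τ)` is integrable uniformly in `x`. So this
potential is differentiable at `x = 0` as well and does not contribute to the jump of the gradient.
-/
lemma hasDerivAt_dlayer (hγ : 0 ≤ γ) (hs : Continuous s) (hm : Continuous m)
    (hσ : ∀ t, HasDerivAt σ (q t) t) (hq : Continuous q) {t : ℝ} (ht : 0 < t) (x : ℝ) :
    HasDerivAt (dlayer γ 1 s σ m t) (dlayer γ 2 s σ m t x) x := by
  have hσc : Continuous σ := continuous_iff_continuousAt.2 fun t => (hσ t).continuousAt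
  obtain ⟨C, hC0, hC⟩ := exists_abs_le_of_continuous hm t
  obtain ⟨L, hL0, hL⟩ := exists_lipschitz_of_hasDerivAt hσ hq t
  have hC' : ∀ τ ∈ Ioo 0 t, |m τ| ≤ C := fun τ hτ => hC τ (by rw [abs_of_pos hτ.1]; exact hτ.2.le)
  have hL' : ∀ τ ∈ Ioo 0 t, |σ t - σ τ| ≤ L * (t - τ) := fun τ hτ => by
    have := hL t τ (by rw [abs_of_pos ht]) (by rw [abs_of_pos hτ.1]; exact hτ.2.le)
    rwa [abs_of_pos (show 0 < t - τ by linarith [hτ.2])] at this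
  have hmeas : ∀ n x, Measurable fun τ => ker γ n (t - τ) (x + (s t - s τ)) *
      ((σ t - σ τ) * m τ) := fun n x => (measurable_ker_layer hs n t x).mul (by fun_prop)
  have hae : ∀ᵐ τ : ℝ ∂volume, τ ≠ t := by simp [ae_iff]
  have hmem : ∀ τ, τ ≠ t → τ ∈ uIoc 0 t → τ ∈ Ioo 0 t := fun τ h1 h2 => by
    rw [uIoc_of_le ht.le] at h2
    exact ⟨h2.1, lt_of_le_of_ne h2.2 h1⟩
  refine (intervalIntegral.hasDerivAt_integral_of_dominated_loc_of_deriv_le (μ := volume)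
    (a := 0) (b := t) (x₀ := x) (s := univ)
    (F := fun x τ => ker γ 1 (t - τ) (x + (s t - s τ)) * ((σ t - σ τ) * m τ))
    (F' := fun x τ => ker γ 2 (t - τ) (x + (s t - s τ)) * ((σ t - σ τ) * m τ))
    (bound := fun τ => 300 * L * C * (√(t - τ))⁻¹) univ_mem
    (Eventually.of_forall fun x => (hmeas 1 x).aestronglyMeasurable) ?_
    (hmeas 2 x).aestronglyMeasurable ?_ ((intervalIntegrable_inv_sqrt_sub t 0 t).const_mul _)
    ?_).2
  · refine intervalIntegrable_of_abs_le (C := 300 * L * C * √t) ht.le (hmeas 1 x) fun τ hτ => ?_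
    refine (abs_dlayer_integrand_le hγ 0 _ hL' hC' hτ).trans ?_
    have h0 : 0 < t - τ := by linarith [hτ.2]
    have h1 : 1 = √(t - τ) * (√(t - τ))⁻¹ := (mul_inv_cancel₀ (Real.sqrt_pos.2 h0).ne').symm
    calc _ = 300 * L * C * (√(t - τ) * (√(t - τ))⁻¹) := by rw [← h1, pow_zero]
      _ ≤ 300 * L * C * (√t * (√(t - τ))⁻¹) := by gcongr; linarith [hτ.1]
      _ = _ := by ring
  · filter_upwards [hae] with τ h1 h2 y _
    simpa using abs_dlayer_integrand_le hγ 1 (y + (s t - s τ)) hL' hC' (hmem τ h1 h2)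
  · filter_upwards [hae] with τ h1 h2 y _
    have h3 := hmem τ h1 h2
    have := hasDerivAt_ker_comp (γ := γ) (show 1 ≤ 2 by simp) (hasDerivAt_const y (t - τ))
      ((hasDerivAt_id y).add_const (s t - s τ)) (Or.inl (by simp; linarith [h3.2]))
    simpa using this.mul_const ((σ t - σ τ) * m τ)

end continuity

/-! ### The jump relation -/

/-- Substituting `y = ρ^{-1/2}` turns this into half a Gaussian integral. The value at `b = 1/4`
normalizes the jump relation; `b = 1/8` serves as a dominating function. -/
lemma integral_exp_neg_div {b : ℝ} (hb : 0 < b) :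
    IntegrableOn (fun ρ : ℝ => ρ⁻¹ * (√ρ)⁻¹ * Real.exp (-(b / ρ))) (Ioi 0) ∧
      ∫ ρ in Ioi (0 : ℝ), ρ⁻¹ * (√ρ)⁻¹ * Real.exp (-(b / ρ)) = √(Real.pi / b) := by
  have e : ∀ ρ ∈ Ioi (0 : ℝ), ρ ^ ((-(1 / 2) : ℝ) - 1) • Real.exp (-b * (ρ ^ (-(1 / 2) : ℝ)) ^ 2) =
      ρ⁻¹ * (√ρ)⁻¹ * Real.exp (-(b / ρ)) := by
    intro ρ hρ
    have hρ' : 0 < ρ := hρ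
    have h1 : ρ ^ (-(1 / 2) : ℝ) = (√ρ)⁻¹ := by rw [Real.sqrt_eq_rpow, Real.rpow_neg hρ'.le]
    rw [Real.rpow_sub_one hρ'.ne', h1, inv_pow, Real.sq_sqrt hρ'.le, smul_eq_mul]
    congr 1
    · rw [div_eq_inv_mul]
    · congr 1; field_simp
  constructor
  · have := (integrableOn_Ioi_comp_rpow_iff' (fun y => Real.exp (-b * y ^ 2))
      (p := -(1 / 2)) (by norm_num)).2 (integrable_exp_neg_mul_sq hb).integrableOn
    exact this.congr_fun e measurableSet_Ioi
  · have := integral_comp_rpow_Ioi (fun y => Real.exp (-b * y ^ 2))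
      (p := -(1 / 2)) (by norm_num)
    rw [integral_gaussian_Ioi] at this
    have h2 : ∫ ρ in Ioi (0 : ℝ), (|(-(1 / 2) : ℝ)| * ρ ^ ((-(1 / 2) : ℝ) - 1)) •
        Real.exp (-b * (ρ ^ (-(1 / 2) : ℝ)) ^ 2) =
        1 / 2 * ∫ ρ in Ioi (0 : ℝ), ρ⁻¹ * (√ρ)⁻¹ * Real.exp (-(b / ρ)) := by
      rw [← integral_const_mul]
      refine setIntegral_congr_fun measurableSet_Ioi fun ρ hρ => ?_
      rw [← e ρ hρ, abs_neg, abs_of_pos (by norm_num : (0 : ℝ) < 1 / 2)]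
      simp only [smul_eq_mul]; ring
    rw [h2] at this
    linarith

section jump

variable {s v m : ℝ → ℝ} {V : ℝ}

lemma abs_sub_le_of_hasDerivAt (hs : ∀ t, HasDerivAt s (v t) t) (hV : ∀ t, |v t| ≤ V) (a b : ℝ) :
    |s a - s b| ≤ V * |a - b| := by
  have := Convex.norm_image_sub_le_of_norm_hasDerivWithin_le (s := univ)
    (fun t _ => (hs t).hasDerivWithinAt) (fun t _ => hV t) convex_univ (mem_univ b) (mem_univ a)
  simpa using this

/-- The singular part of the derivative of the single layer potential. -/
noncomputable def layerKernel (γ : ℝ) (s m : ℝ → ℝ) (t x ρ : ℝ) : ℝ :=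
  (Iic t).indicator (fun r => x / (2 * r) * ker γ 0 r (x + (s t - s (t - r))) * m (t - r))
    (x ^ 2 * ρ) * x ^ 2

/-- The parabolic scaling `r = x²ρ` removes the singular dependence on `x`: what remains of it tends
to a limit as `x → 0`, for fixed `ρ`. -/
lemma layerKernel_eq {t x ρ : ℝ} (hx : 0 < x) (hρ : 0 < ρ) (h : x ^ 2 * ρ ≤ t) :
    layerKernel γ s m t x ρ = (√(4 * Real.pi))⁻¹ / 2 * (ρ⁻¹ * (√ρ)⁻¹) *
      (Real.exp (-γ * (x ^ 2 * ρ)) *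
        Real.exp (-((1 + (s t - s (t - x ^ 2 * ρ)) / x) ^ 2 / (4 * ρ)))) * m (t - x ^ 2 * ρ) := by
  have hs : 0 < √ρ := Real.sqrt_pos.2 hρ
  rw [layerKernel, indicator_of_mem (mem_Iic.2 h)]
  have e1 : √(x ^ 2 * ρ) = x * √ρ := by
    rw [Real.sqrt_mul (by positivity), Real.sqrt_sq hx.le]
  have e2 : -(x + (s t - s (t - x ^ 2 * ρ))) ^ 2 / (4 * (x ^ 2 * ρ)) =
      -((1 + (s t - s (t - x ^ 2 * ρ)) / x) ^ 2 / (4 * ρ)) := by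
    field_simp
  simp only [ker, gaussPow, e1, e2]
  field_simp

lemma abs_shift_le (hs : ∀ t, HasDerivAt s (v t) t) (hV : ∀ t, |v t| ≤ V) {t x ρ : ℝ}
    (hx : 0 < x) (hρ : 0 < ρ) : |(s t - s (t - x ^ 2 * ρ)) / x| ≤ V * (x * ρ) := by
  have h := abs_sub_le_of_hasDerivAt hs hV t (t - x ^ 2 * ρ)
  rw [sub_sub_cancel, abs_of_pos (show 0 < x ^ 2 * ρ by positivity)] at h
  rw [abs_div, abs_of_pos hx, div_le_iff₀ hx]
  exact h.trans (le_of_eq (by ring))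

/-- After scaling, the interface displacement divided by `x` is at most `V x ρ` and disappears in
the limit. Dominated convergence leaves `m(t)` times a fixed integral equal to `1/2`. -/
lemma tendsto_integral_layerKernel (hγ : 0 ≤ γ) (hs : ∀ t, HasDerivAt s (v t) t)
    (hV : ∀ t, |v t| ≤ V) (hm : Continuous m) {t : ℝ} (ht : 0 < t) :
    Tendsto (fun x => ∫ ρ in Ioi (0 : ℝ), layerKernel γ s m t x ρ) (𝓝[>] 0) (𝓝 (m t / 2)) := by
  have hsc : Continuous s := continuous_iff_continuousAt.2 fun t => (hs t).continuousAt
  have hV0 : 0 ≤ V := (abs_nonneg _).trans (hV 0)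
  obtain ⟨C, hC0, hC⟩ := exists_abs_le_of_continuous hm t
  set c : ℝ := (√(4 * Real.pi))⁻¹ / 2 with hc
  have hc0 : 0 < c := by positivity
  have hval : m t / 2 = ∫ ρ in Ioi (0 : ℝ), c * (ρ⁻¹ * (√ρ)⁻¹ * Real.exp (-((1 / 4) / ρ))) * m t := by
    rw [integral_mul_const, integral_const_mul, (integral_exp_neg_div (by norm_num)).2, hc]
    have e : Real.pi / (1 / 4) = 4 * Real.pi := by ring
    have : √(4 * Real.pi) ≠ 0 := by positivity
    rw [e]; field_simp
  rw [hval]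
  refine tendsto_integral_filter_of_dominated_convergence
    (fun ρ => c * Real.exp (V ^ 2 * t / 4) * C * (ρ⁻¹ * (√ρ)⁻¹ * Real.exp (-((1 / 8) / ρ)))) ?_ ?_
    ((integral_exp_neg_div (by norm_num)).1.const_mul _) ?_
  · refine Eventually.of_forall fun x => ?_
    have h1 : Measurable fun r => x / (2 * r) * ker γ 0 r (x + (s t - s (t - r))) * m (t - r) := by
      have h2 : Measurable fun r => ker γ 0 r (x + (s t - s (t - r))) :=
        (measurable_ker 0).comp (by fun_prop : Measurable fun r => (r, x + (s t - s (t - r))))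
      exact (Measurable.mul (by fun_prop) h2).mul (by fun_prop)
    exact (((h1.indicator measurableSet_Iic).comp (by fun_prop :
      Measurable fun ρ : ℝ => x ^ 2 * ρ)).mul_const _).aestronglyMeasurable
  · filter_upwards [self_mem_nhdsWithin] with x hx
    have hx : 0 < x := hx
    refine (ae_restrict_iff' measurableSet_Ioi).2 (ae_of_all _ fun ρ hρ => ?_)
    have hρ : 0 < ρ := hρ
    have hxρ : 0 < x ^ 2 * ρ := by positivity
    by_cases h : x ^ 2 * ρ ≤ t
    · rw [layerKernel_eq hx hρ h, Real.norm_eq_abs, abs_mul, abs_of_nonneg (by positivity)]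
      set η := (s t - s (t - x ^ 2 * ρ)) / x
      have hη := abs_shift_le hs hV (t := t) hx hρ
      have h1 : Real.exp (-γ * (x ^ 2 * ρ)) ≤ 1 := Real.exp_le_one_iff.2 (by nlinarith)
      -- By `(1+η)² ≥ 1/2 - η²` and `η² ≤ V²x²ρ²`; since `x²ρ ≤ t`, the loss is the constant factor
      -- `e^{V²t/4}`.
      have h2 : Real.exp (-((1 + η) ^ 2 / (4 * ρ))) ≤
          Real.exp (V ^ 2 * t / 4) * Real.exp (-((1 / 8) / ρ)) := by
        rw [← Real.exp_add]
        apply Real.exp_le_exp.2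
        have h3 : η ^ 2 ≤ V ^ 2 * (x ^ 2 * ρ ^ 2) := by
          rw [← sq_abs]
          calc |η| ^ 2 ≤ (V * (x * ρ)) ^ 2 := by gcongr
            _ = _ := by ring
        have h4 : V ^ 2 * (x ^ 2 * ρ) ≤ V ^ 2 * t := by gcongr
        have h5 : 1 / 2 - η ^ 2 ≤ (1 + η) ^ 2 := by nlinarith [sq_nonneg (1 + 2 * η)]
        have h6 : (1 / 2 - V ^ 2 * (x ^ 2 * ρ ^ 2)) / (4 * ρ) ≤ (1 + η) ^ 2 / (4 * ρ) := by
          gcongr; linarith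
        have h7 : (1 / 2 - V ^ 2 * (x ^ 2 * ρ ^ 2)) / (4 * ρ) =
            1 / 8 / ρ - V ^ 2 * (x ^ 2 * ρ) / 4 := by field_simp; ring
        linarith
      have h3 : |m (t - x ^ 2 * ρ)| ≤ C := hC _ (by rw [abs_of_nonneg (by linarith)]; linarith)
      calc _ ≤ c * (ρ⁻¹ * (√ρ)⁻¹) *
            (1 * (Real.exp (V ^ 2 * t / 4) * Real.exp (-((1 / 8) / ρ)))) * C := by gcongr
        _ = _ := by ring
    · rw [layerKernel, indicator_of_notMem (by simpa using h), zero_mul, norm_zero]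
      positivity
  · refine (ae_restrict_iff' measurableSet_Ioi).2 (ae_of_all _ fun ρ hρ => ?_)
    have hρ : 0 < ρ := hρ
    have hlim : Tendsto (fun x : ℝ => x ^ 2 * ρ) (𝓝[>] 0) (𝓝 0) := by
      have : Continuous fun x : ℝ => x ^ 2 * ρ := by fun_prop
      simpa using this.tendsto 0 |>.mono_left nhdsWithin_le_nhds
    have hlim1 : Tendsto (fun x : ℝ => V * (x * ρ)) (𝓝[>] 0) (𝓝 0) := by
      have : Continuous fun x : ℝ => V * (x * ρ) := by fun_prop
      simpa using this.tendsto 0 |>.mono_left nhdsWithin_le_nhds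
    have hη : Tendsto (fun x : ℝ => (s t - s (t - x ^ 2 * ρ)) / x) (𝓝[>] 0) (𝓝 0) := by
      refine squeeze_zero_norm' ?_ hlim1
      filter_upwards [self_mem_nhdsWithin] with x hx
      exact abs_shift_le hs hV hx hρ
    have hmain : Tendsto (fun x => c * (ρ⁻¹ * (√ρ)⁻¹) * (Real.exp (-γ * (x ^ 2 * ρ)) *
        Real.exp (-((1 + (s t - s (t - x ^ 2 * ρ)) / x) ^ 2 / (4 * ρ)))) * m (t - x ^ 2 * ρ))
        (𝓝[>] 0) (𝓝 (c * (ρ⁻¹ * (√ρ)⁻¹) * (Real.exp (-γ * 0) *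
        Real.exp (-((1 + 0) ^ 2 / (4 * ρ)))) * m (t - 0))) := by
      refine Tendsto.mul (Tendsto.const_mul _ (Tendsto.mul ?_ ?_)) ?_
      · exact (Real.continuous_exp.tendsto _).comp (hlim.const_mul _)
      · exact (Real.continuous_exp.tendsto _).comp
          ((((hη.const_add 1).pow 2).div_const _).neg)
      · exact (hm.tendsto _).comp (hlim.const_sub t)
    have hfin : c * (ρ⁻¹ * (√ρ)⁻¹ * Real.exp (-((1 / 4) / ρ))) * m t =
        c * (ρ⁻¹ * (√ρ)⁻¹) * (Real.exp (-γ * 0) *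
        Real.exp (-((1 + 0) ^ 2 / (4 * ρ)))) * m (t - 0) := by
      have e : -((1 + 0) ^ 2 / (4 * ρ)) = -((1 / 4) / ρ) := by field_simp; ring
      rw [e]; simp only [mul_zero, Real.exp_zero, sub_zero, one_mul]; ring
    rw [hfin]
    refine hmain.congr' ?_
    filter_upwards [self_mem_nhdsWithin, hlim.eventually (gt_mem_nhds ht)] with x hx h
    rw [layerKernel_eq hx hρ (le_of_lt h)]

/-- Uses `ker₁ = -(X/2r) ker₀` with `X = x + (s(t) - s(t-r))`. The displacement part is weakly
singular and continuous in `x`; the part with `x/2r` acts as an approximate identity and carries the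
whole jump. -/
lemma layer_one_eq (hγ : 0 ≤ γ) (hs : ∀ t, HasDerivAt s (v t) t)
    (hV : ∀ t, |v t| ≤ V) (hm : Continuous m) {t x : ℝ} (ht : 0 < t) (hx : 0 < x) :
    layer γ 1 s m t x =
      (∫ r in (0 : ℝ)..t, -((s t - s (t - r)) / (2 * r)) * ker γ 0 r (x + (s t - s (t - r)))
        * m (t - r)) - ∫ ρ in Ioi (0 : ℝ), layerKernel γ s m t x ρ := by
  have hsc : Continuous s := continuous_iff_continuousAt.2 fun t => (hs t).continuousAt
  obtain ⟨C, hC0, hC⟩ := exists_abs_le_of_continuous hm t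
  have hmk : Measurable fun r => ker γ 0 r (x + (s t - s (t - r))) :=
    (measurable_ker 0).comp (by fun_prop : Measurable fun r => (r, x + (s t - s (t - r))))
  set F : ℝ → ℝ := fun r => x / (2 * r) * ker γ 0 r (x + (s t - s (t - r))) * m (t - r) with hF
  have h1 : ∫ ρ in Ioi (0 : ℝ), layerKernel γ s m t x ρ = ∫ r in (0 : ℝ)..t, F r := by
    have := integral_comp_mul_left_Ioi ((Iic t).indicator F) 0 (show 0 < x ^ 2 by positivity)
    simp only [layerKernel]
    rw [integral_mul_const, this, mul_zero, smul_eq_mul, mul_comm, ← mul_assoc,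
      mul_inv_cancel₀ (by positivity), one_mul, intervalIntegral.integral_of_le ht.le,
      setIntegral_indicator measurableSet_Iic, Ioi_inter_Iic]
  have hi1 : IntervalIntegrable (fun r => -((s t - s (t - r)) / (2 * r)) *
      ker γ 0 r (x + (s t - s (t - r))) * m (t - r)) volume 0 t := by
    refine ((intervalIntegrable_inv_sqrt 0 t).const_mul (V / 2 * 300 * C)).mono_fun'
      ((Measurable.mul (by fun_prop) hmk).mul (by fun_prop)).aestronglyMeasurable ?_
    rw [uIoc_of_le ht.le]
    refine (ae_restrict_iff' measurableSet_Ioc).2 (ae_of_all _ fun r hr => ?_)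
    have hr0 : 0 < r := hr.1
    have hsr := abs_sub_le_of_hasDerivAt hs hV t (t - r)
    rw [sub_sub_cancel, abs_of_pos hr0] at hsr
    have h2 : |-((s t - s (t - r)) / (2 * r))| ≤ V / 2 := by
      rw [abs_neg, abs_div, abs_of_pos (show 0 < 2 * r by positivity), div_le_iff₀ (by positivity)]
      linarith
    show ‖_‖ ≤ _
    rw [Real.norm_eq_abs, abs_mul, abs_mul]
    have hV0 : 0 ≤ V := (abs_nonneg _).trans (hV 0)
    calc _ ≤ V / 2 * (300 * (√r)⁻¹ ^ (0 + 1)) * C := by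
          gcongr
          · exact abs_ker_le' hγ 0 r _
          · exact hC _ (by rw [abs_of_nonneg (by linarith [hr.2])]; linarith)
      _ = _ := by ring
  have hlay : IntervalIntegrable (fun r => ker γ 1 r (x + (s t - s (t - r))) * m (t - r))
      volume 0 t := by
    simpa using (intervalIntegrable_layer (γ := γ) hsc hm 1 t t 0 hx.ne').comp_sub_left t
  have hsplit : ∀ r ∈ uIoc 0 t, ker γ 1 r (x + (s t - s (t - r))) * m (t - r) =
      -((s t - s (t - r)) / (2 * r)) * ker γ 0 r (x + (s t - s (t - r))) * m (t - r) - F r := by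
    intro r hr
    rw [uIoc_of_le ht.le] at hr
    have hr0 : 0 < r := hr.1
    rw [ker_one_eq hr0, hF]
    field_simp
    ring
  have hi2 : IntervalIntegrable F volume 0 t := by
    refine (hi1.sub hlay).congr fun r hr => ?_
    have := hsplit r hr
    linarith
  rw [h1, layer_eq_reflect, ← intervalIntegral.integral_sub hi1 hi2]
  refine intervalIntegral.integral_congr_ae (ae_of_all _ hsplit)

lemma tendsto_layer_one (hγ : 0 ≤ γ) (hs : ∀ t, HasDerivAt s (v t) t)
    (hV : ∀ t, |v t| ≤ V) (hm : Continuous m) {t : ℝ} (ht : 0 < t) :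
    Tendsto (layer γ 1 s m t) (𝓝[>] 0) (𝓝 (layer γ 1 s m t 0 - m t / 2)) := by
  have hsc : Continuous s := continuous_iff_continuousAt.2 fun t => (hs t).continuousAt
  obtain ⟨C, hC0, hC⟩ := exists_abs_le_of_continuous hm t
  have hV0 : 0 ≤ V := (abs_nonneg _).trans (hV 0)
  have hmk : ∀ x, Measurable fun r => ker γ 0 r (x + (s t - s (t - r))) := fun x =>
    (measurable_ker 0).comp (by fun_prop : Measurable fun r => (r, x + (s t - s (t - r))))
  set G : ℝ → ℝ := fun x => ∫ r in (0 : ℝ)..t,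
    -((s t - s (t - r)) / (2 * r)) * ker γ 0 r (x + (s t - s (t - r))) * m (t - r) with hG
  have hG0 : layer γ 1 s m t 0 = G 0 := by
    rw [layer_eq_reflect]
    refine intervalIntegral.integral_congr_ae (ae_of_all _ fun r hr => ?_)
    rw [uIoc_of_le ht.le] at hr
    rw [ker_one_eq hr.1, zero_add]
  have hGc : Tendsto G (𝓝 0) (𝓝 (G 0)) := by
    refine (intervalIntegral.continuousAt_of_dominated_interval
      (bound := fun r => V / 2 * 300 * C * (√r)⁻¹) (Eventually.of_forall fun x =>
        ((Measurable.mul (by fun_prop) (hmk x)).mul (by fun_prop)).aestronglyMeasurable)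
      (Eventually.of_forall fun x => ae_of_all _ fun r hr => ?_)
      ((intervalIntegrable_inv_sqrt 0 t).const_mul _) (ae_of_all _ fun r hr => ?_))
    · rw [uIoc_of_le ht.le] at hr
      have hr0 : 0 < r := hr.1
      have hsr := abs_sub_le_of_hasDerivAt hs hV t (t - r)
      rw [sub_sub_cancel, abs_of_pos hr0] at hsr
      have h2 : |-((s t - s (t - r)) / (2 * r))| ≤ V / 2 := by
        rw [abs_neg, abs_div, abs_of_pos (show 0 < 2 * r by positivity),
          div_le_iff₀ (by positivity)]
        linarith
      rw [Real.norm_eq_abs, abs_mul, abs_mul]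
      calc _ ≤ V / 2 * (300 * (√r)⁻¹ ^ (0 + 1)) * C := by
            gcongr
            · exact abs_ker_le' hγ 0 r _
            · exact hC _ (by rw [abs_of_nonneg (by linarith [hr.2])]; linarith)
        _ = _ := by ring
    · rw [uIoc_of_le ht.le] at hr
      have := (continuous_ker_right (γ := γ) 0 hr.1)
      fun_prop
  rw [hG0]
  refine ((hGc.mono_left nhdsWithin_le_nhds).sub
    (tendsto_integral_layerKernel hγ hs hV hm ht)).congr' ?_
  filter_upwards [self_mem_nhdsWithin] with x hx
  rw [layer_one_eq hγ hs hV hm ht hx]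

/-- The jump relation, from the right. -/
lemma hasDerivWithinAt_layer_right (hγ : 0 ≤ γ) (hs : ∀ t, HasDerivAt s (v t) t)
    (hv : Continuous v) (hV : ∀ t, |v t| ≤ V) (hm : Continuous m) {t : ℝ} (ht : 0 < t) :
    HasDerivWithinAt (layer γ 0 s m t) (layer γ 1 s m t 0 - m t / 2) (Ici 0) 0 := by
  have hsc : Continuous s := continuous_iff_continuousAt.2 fun t => (hs t).continuousAt
  have hd : ∀ x, x ≠ 0 → HasDerivAt (layer γ 0 s m t) (layer γ 1 s m t x) x := fun x hx =>
    (hasDerivs_layer (γ := γ) hs hv hm (n := 0) (by simp)).x t x ht hx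
  have hc : Continuous (layer γ 0 s m t) := by
    rw [continuous_iff_continuousAt]
    intro x
    exact ContinuousAt.comp (f := fun x => (t, x))
      (continuousAt_layer hγ hsc hm (p := (t, x)) ht.le) (by fun_prop)
  -- A continuous function whose derivative has a one-sided limit has that limit as its one-sided
  -- derivative.
  refine hasDerivWithinAt_Ici_of_tendsto_deriv (s := Ioi 0)
    (fun x hx => (hd x (ne_of_gt hx)).differentiableAt.differentiableWithinAt)
    hc.continuousWithinAt self_mem_nhdsWithin ?_
  refine (tendsto_layer_one hγ hs hV hm ht).congr' ?_
  filter_upwards [self_mem_nhdsWithin] with x hx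
  exact (hd x (ne_of_gt hx)).deriv.symm

/-- The jump relation, from the left. -/
lemma hasDerivWithinAt_layer_left (hγ : 0 ≤ γ) (hs : ∀ t, HasDerivAt s (v t) t)
    (hv : Continuous v) (hV : ∀ t, |v t| ≤ V) (hm : Continuous m) {t : ℝ} (ht : 0 < t) :
    HasDerivWithinAt (layer γ 0 s m t) (layer γ 1 s m t 0 + m t / 2) (Iic 0) 0 := by
  -- Reflection `x ↦ -x`, `s ↦ -s` preserves the even kernel `ker γ 0` and changes the sign of `ker
  -- γ 1`.
  have h := hasDerivWithinAt_layer_right (γ := γ) (s := fun t => -s t) (v := fun t => -v t) hγ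
    (fun t => (hs t).neg) hv.neg (V := V) (by simpa using hV) hm ht
  have h0 : ∀ x, layer γ 0 s m t x = layer γ 0 (fun t => -s t) m t (-x) := by
    intro x
    refine intervalIntegral.integral_congr fun τ _ => ?_
    simp only
    rw [← ker_zero_neg]; congr 2; ring
  have h1 : layer γ 1 (fun t => -s t) m t 0 = -layer γ 1 s m t 0 := by
    rw [layer, layer, ← intervalIntegral.integral_neg]
    refine intervalIntegral.integral_congr fun τ _ => ?_
    rw [← neg_mul, ← ker_one_neg]; congr 2; ring
  rw [h1] at h
  have h2 : HasDerivWithinAt (fun x : ℝ => -x) (-1) (Iic 0) 0 := (hasDerivWithinAt_id 0 _).neg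
  have h3 := HasDerivWithinAt.comp (x := (0 : ℝ)) (h := fun x : ℝ => -x) (s := Iic 0) (s' := Ici 0)
    (h₂ := layer γ 0 (fun t => -s t) m t) (h₂' := -layer γ 1 s m t 0 - m t / 2) (h' := -1)
    (by simpa using h) h2 (fun x hx => by simpa using hx)
  refine (h3.congr (fun x _ => h0 x) (h0 0)).congr_deriv ?_
  ring

end jump

/-! ### Bounds for the layer potentials -/

lemma integral_inv_sqrt_mul_exp {κ : ℝ} (hκ : 0 < κ) :
    IntegrableOn (fun r : ℝ => (√r)⁻¹ * Real.exp (-κ * r)) (Ioi 0) ∧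
      ∫ r in Ioi (0 : ℝ), (√r)⁻¹ * Real.exp (-κ * r) = √(Real.pi / κ) := by
  have e : ∀ r ∈ Ioi (0 : ℝ), r ^ ((1 / 2 : ℝ) - 1) * Real.exp (-(κ * r)) =
      (√r)⁻¹ * Real.exp (-κ * r) := by
    intro r hr
    rw [Real.sqrt_eq_rpow, ← Real.rpow_neg (le_of_lt hr), neg_mul]
    norm_num
  have h := Real.integral_rpow_mul_exp_neg_mul_Ioi (a := 1 / 2) (by norm_num) hκ
  rw [setIntegral_congr_fun measurableSet_Ioi e] at h
  have h2 : (1 / κ) ^ (1 / 2 : ℝ) * Real.Gamma (1 / 2) = √(Real.pi / κ) := by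
    rw [Real.Gamma_one_half_eq, ← Real.sqrt_eq_rpow, ← Real.sqrt_mul (by positivity)]
    congr 1; field_simp
  rw [h2] at h
  refine ⟨?_, h⟩
  -- A nonintegrable function has integral zero by convention, so the positive value already found
  -- proves integrability.
  by_contra hcon
  rw [integral_undef hcon] at h
  have : 0 < √(Real.pi / κ) := by positivity
  linarith

lemma Bd.intervalIntegral {k : ℝ → ℝ → ℝ} {t K κ : ℝ} (ht : 0 ≤ t) (hκ : 0 < κ) (hK : 0 ≤ K)
    (hk : Measurable (Function.uncurry k))
    (hb : ∀ τ ∈ Ioo 0 t, Bd (k τ) (K * ((√(t - τ))⁻¹ * Real.exp (-κ * (t - τ))))) :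
    Bd (fun x => ∫ τ in (0 : ℝ)..t, k τ x) (K * √(Real.pi / κ)) := by
  obtain ⟨hi, hI⟩ := integral_inv_sqrt_mul_exp hκ
  have hii : IntervalIntegrable (fun τ => (√(t - τ))⁻¹ * Real.exp (-κ * (t - τ))) volume 0 t := by
    have : IntervalIntegrable (fun r => (√r)⁻¹ * Real.exp (-κ * r)) volume 0 t := by
      rw [intervalIntegrable_iff_integrableOn_Ioc_of_le ht]
      exact hi.mono_set Ioc_subset_Ioi_self
    simpa using (this.comp_sub_left t).symm
  have hle : ∫ τ in (0 : ℝ)..t, (√(t - τ))⁻¹ * Real.exp (-κ * (t - τ)) ≤ √(Real.pi / κ) := by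
    rw [intervalIntegral.integral_comp_sub_left (fun r => (√r)⁻¹ * Real.exp (-κ * r)) t, sub_self,
      sub_zero, intervalIntegral.integral_of_le ht, ← hI]
    exact setIntegral_mono_set hi (ae_of_all _ fun r => by positivity)
      (Ioc_subset_Ioi_self.eventuallyLE)
  have h1 : ∀ x, ∫ τ in (0 : ℝ)..t, k τ x = ∫ τ in Ioo 0 t, k τ x := fun x => by
    rw [intervalIntegral.integral_of_le ht, integral_Ioc_eq_integral_Ioo]
  simp_rw [h1]
  have h2 := Bd.integral (μ := volume.restrict (Ioo 0 t)) hk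
    (((intervalIntegrable_iff_integrableOn_Ioo_of_le ht).1 hii).const_mul K)
    ((ae_restrict_iff' measurableSet_Ioo).2 (ae_of_all _ hb))
  refine h2.mono ?_
  rw [integral_const_mul, ← integral_Ioc_eq_integral_Ioo, ← intervalIntegral.integral_of_le ht]
  gcongr

lemma measurable_layer_integrand {s : ℝ → ℝ} (hs : Continuous s) {M : ℝ → ℝ} (hM : Measurable M)
    (n : ℕ) (t : ℝ) : Measurable (Function.uncurry fun τ x =>
      ker γ n (t - τ) (x + (s t - s τ)) * M τ) := by
  refine Measurable.mul ?_ (hM.comp measurable_fst)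
  exact (measurable_ker n).comp (by fun_prop :
    Measurable fun p : ℝ × ℝ => (t - p.1, p.2 + (s t - s p.1)))

lemma exp_mul_exp_le {a b c : ℝ} (h : a + b ≤ c) : Real.exp a * Real.exp b ≤ Real.exp c := by
  rw [← Real.exp_add]; exact Real.exp_le_exp.2 h

section layerBounds

variable {V A : ℝ} {s m : ℝ → ℝ} {t : ℝ}

/-- Relative to `e^{λt}` a density bounded by `Q e^{λτ}` is integrated against `(t-τ)^{-1/2}
e^{-λ(t-τ)}`, which gives `√(π/λ)`. This decay in `λ` drives all the Volterra arguments. -/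
lemma KernelBounds.bd_layer (hA : KernelBounds γ V A) (hγ : 0 < γ) (hs : Continuous s)
    (hm : Measurable m) (ht : 0 ≤ t) {lam Q : ℝ} (hl : 0 < lam)
    (hQ : ∀ τ ∈ Ioo 0 t, |m τ| ≤ Q * Real.exp (lam * τ)) (hQ0 : 0 ≤ Q) :
    Bd (layer γ 0 s m t) (A * Q * Real.exp (lam * t) * √(Real.pi / lam)) := by
  have hA0 := hA.pos
  refine Bd.intervalIntegral ht hl (by positivity) (measurable_layer_integrand hs hm 0 t)
    fun τ hτ => ?_
  have hr : 0 < t - τ := by linarith [hτ.2]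
  have h := (hA.bd 0 (t - τ) (s t - s τ) hr).const_mul (m τ)
  simp only [mul_comm (m τ)] at h
  refine h.mono ?_
  rw [zero_add, pow_one]
  have e : Real.exp (-(γ / 2) * (t - τ)) * Real.exp (lam * τ) ≤
      Real.exp (lam * t) * Real.exp (-lam * (t - τ)) := by
    rw [← Real.exp_add _ (-lam * (t - τ))]
    exact exp_mul_exp_le (by nlinarith)
  calc |m τ| * (A * (√(t - τ))⁻¹ * Real.exp (-(γ / 2) * (t - τ)))
      ≤ Q * Real.exp (lam * τ) * (A * (√(t - τ))⁻¹ * Real.exp (-(γ / 2) * (t - τ))) := by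
        gcongr; exact hQ τ hτ
    _ = A * Q * (√(t - τ))⁻¹ * (Real.exp (-(γ / 2) * (t - τ)) * Real.exp (lam * τ)) := by ring
    _ ≤ A * Q * (√(t - τ))⁻¹ * (Real.exp (lam * t) * Real.exp (-lam * (t - τ))) := by gcongr
    _ = _ := by ring

lemma KernelBounds.bd_layer_of_bounded (hA : KernelBounds γ V A) (hγ : 0 < γ) (hs : Continuous s)
    (hm : Measurable m) (ht : 0 ≤ t) {Q : ℝ} (hQ : ∀ τ ∈ Ioo 0 t, |m τ| ≤ Q) (hQ0 : 0 ≤ Q) :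
    Bd (layer γ 0 s m t) (A * Q * √(Real.pi / (γ / 2))) := by
  have hA0 := hA.pos
  refine Bd.intervalIntegral ht (half_pos hγ) (by positivity) (measurable_layer_integrand hs hm 0 t)
    fun τ hτ => ?_
  have hr : 0 < t - τ := by linarith [hτ.2]
  have h := (hA.bd 0 (t - τ) (s t - s τ) hr).const_mul (m τ)
  simp only [mul_comm (m τ)] at h
  refine h.mono ?_
  rw [zero_add, pow_one]
  calc |m τ| * (A * (√(t - τ))⁻¹ * Real.exp (-(γ / 2) * (t - τ)))
      ≤ Q * (A * (√(t - τ))⁻¹ * Real.exp (-(γ / 2) * (t - τ))) := by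
        gcongr; exact hQ τ hτ
    _ = _ := by ring

/-- A double layer whose density vanishes like a square root at the final time. -/
lemma KernelBounds.bd_layer_one (hA : KernelBounds γ V A) (hγ : 0 < γ) (hs : Continuous s)
    (hm : Measurable m) (ht : 0 ≤ t) {Q : ℝ} (hQ : ∀ τ ∈ Ioo 0 t, |m τ| ≤ Q * √(t - τ))
    (hQ0 : 0 ≤ Q) :
    Bd (layer γ 1 s m t) (A * Q * √(Real.pi / (γ / 2))) := by
  have hA0 := hA.pos
  refine Bd.intervalIntegral ht (half_pos hγ) (by positivity) (measurable_layer_integrand hs hm 1 t)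
    fun τ hτ => ?_
  have hr : 0 < t - τ := by linarith [hτ.2]
  have hr' : (√(t - τ))⁻¹ * √(t - τ) = 1 := inv_mul_cancel₀ (Real.sqrt_pos.2 hr).ne'
  have h := (hA.bd 1 (t - τ) (s t - s τ) hr).const_mul (m τ)
  simp only [mul_comm (m τ)] at h
  refine h.mono ?_
  calc |m τ| * (A * (√(t - τ))⁻¹ ^ (1 + 1) * Real.exp (-(γ / 2) * (t - τ)))
      ≤ Q * √(t - τ) * (A * (√(t - τ))⁻¹ ^ (1 + 1) * Real.exp (-(γ / 2) * (t - τ))) := by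
        gcongr; exact hQ τ hτ
    _ = A * Q * (√(t - τ))⁻¹ * ((√(t - τ))⁻¹ * √(t - τ)) * Real.exp (-(γ / 2) * (t - τ)) := by ring
    _ = _ := by rw [hr']; ring

end layerBounds

/-! ### Primitives -/

/-- The primitive vanishing at `0`. -/
noncomputable def prim (v : ℝ → ℝ) (t : ℝ) : ℝ := ∫ τ in (0 : ℝ)..t, v τ

lemma hasDerivAt_prim {v : ℝ → ℝ} (hv : Continuous v) (t : ℝ) : HasDerivAt (prim v) (v t) t :=
  intervalIntegral.integral_hasDerivAt_right (hv.intervalIntegrable _ _)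
    (hv.stronglyMeasurableAtFilter _ _) hv.continuousAt

lemma continuous_prim {v : ℝ → ℝ} (hv : Continuous v) : Continuous (prim v) :=
  continuous_iff_continuousAt.2 fun t => (hasDerivAt_prim hv t).continuousAt

@[simp] lemma prim_zero (v : ℝ → ℝ) : prim v 0 = 0 := by simp [prim]

lemma prim_sub_prim {v : ℝ → ℝ} (hv : Continuous v) (a b : ℝ) :
    prim v b - prim v a = ∫ τ in a..b, v τ :=
  intervalIntegral.integral_interval_sub_left (hv.intervalIntegrable _ _)
    (hv.intervalIntegrable _ _)

lemma prim_sub {v w : ℝ → ℝ} (hv : Continuous v) (hw : Continuous w) (t : ℝ) :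
    prim (fun τ => v τ - w τ) t = prim v t - prim w t :=
  intervalIntegral.integral_sub (hv.intervalIntegrable _ _) (hw.intervalIntegrable _ _)

/-- Interpolates through `1 - e^{-y} ≤ √y` with `y = λ(t-τ)`: the factor `√(t-τ)` tames the more
singular kernels, while `1/√λ` is kept for smallness. -/
lemma abs_prim_sub_le {q : ℝ → ℝ} (hq : Continuous q) {t lam Q : ℝ} (hl : 0 < lam) (hQ0 : 0 ≤ Q)
    (hQ : ∀ τ ∈ Icc 0 t, |q τ| ≤ Q * Real.exp (lam * τ)) {τ : ℝ} (hτ : τ ∈ Icc 0 t) :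
    |prim q t - prim q τ| ≤ Q * Real.exp (lam * t) / √lam * √(t - τ) := by
  rw [prim_sub_prim hq]
  have h1 : |∫ a in τ..t, q a| ≤ ∫ a in τ..t, Q * Real.exp (lam * a) := by
    rw [← Real.norm_eq_abs]
    refine intervalIntegral.norm_integral_le_of_norm_le hτ.2 (ae_of_all _ fun a ha => ?_)
      (Continuous.intervalIntegrable (by fun_prop) _ _)
    exact hQ a ⟨hτ.1.trans ha.1.le, ha.2⟩
  have h2 : ∫ a in τ..t, Q * Real.exp (lam * a) =
      Q * ((Real.exp (lam * t) - Real.exp (lam * τ)) / lam) := by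
    rw [intervalIntegral.integral_const_mul, intervalIntegral.integral_comp_mul_left _ hl.ne',
      integral_exp, smul_eq_mul]
    ring
  rw [h2] at h1
  refine h1.trans ?_
  set y := lam * (t - τ) with hy
  have hy0 : 0 ≤ y := mul_nonneg hl.le (by linarith [hτ.2])
  have h3 : 1 - Real.exp (-y) ≤ √y := by
    rcases le_total y 1 with h | h
    · have h4 := Real.add_one_le_exp (-y)
      have h5 : y ≤ √y := Real.le_sqrt_of_sq_le (by nlinarith)
      linarith
    · have h4 := Real.exp_pos (-y)
      have h5 : 1 ≤ √y := Real.one_le_sqrt.2 h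
      linarith
  have h4 : Real.exp (lam * τ) = Real.exp (lam * t) * Real.exp (-y) := by
    rw [← Real.exp_add]; congr 1; rw [hy]; ring
  have hsl : 0 < √lam := Real.sqrt_pos.2 hl
  have h5 : √y / lam = √(t - τ) / √lam := by
    rw [hy, Real.sqrt_mul hl.le]
    nth_rw 2 [← Real.sq_sqrt hl.le]
    field_simp
  calc Q * ((Real.exp (lam * t) - Real.exp (lam * τ)) / lam)
      = Q * Real.exp (lam * t) * ((1 - Real.exp (-y)) / lam) := by rw [h4]; ring
    _ ≤ Q * Real.exp (lam * t) * (√y / lam) := by gcongr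
    _ = _ := by rw [h5]; ring

lemma KernelBounds.bd_flow {V A : ℝ} (hA : KernelBounds γ V A) {f : ℝ → ℝ} {c : ℝ} (hf : Bd f c)
    (hfc : Continuous f) {t : ℝ} (ht : 0 ≤ t) (y : ℝ) :
    Bd (fun x => flow γ f t (x + y)) ((A + 1) * c) := by
  have hA0 := hA.pos
  rcases ht.eq_or_lt with rfl | ht
  · simp_rw [flow_zero]
    exact (hf.comp_add y).mono (by nlinarith [hf.nonneg])
  · simp_rw [flow_eq_hom f ht]
    refine (hA.bd_hom hf hfc 0 ht y).mono ?_
    nlinarith [hf.nonneg]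

/-! ### Solution formulas -/

/-- Data which are continuous, bounded and square integrable. -/
def Admissible (f : ℝ → ℝ) : Prop := Continuous f ∧ ∃ c, Bd f c

/-- The solution with interface velocity `v` and initial data `f` of the linear problem with
prescribed jump `v` of the space derivative. -/
noncomputable def rep (γ : ℝ) (f v : ℝ → ℝ) (t x : ℝ) : ℝ :=
  flow γ f t (x + prim v t) - layer γ 0 (prim v) v t x

/-- The solution of the linearized problem with initial data `z₀` and jump `q` of the space
derivative, about the solution `rep γ f v`. -/
noncomputable def linRep (γ : ℝ) (f v z₀ q : ℝ → ℝ) (t x : ℝ) : ℝ :=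
  flow γ z₀ t (x + prim v t) + prim q t * hom γ 1 f t (x + prim v t)
    - layer γ 0 (prim v) q t x - dlayer γ 1 (prim v) (prim q) v t x

lemma jump_of_hasDerivWithinAt {f : ℝ → ℝ} {r l : ℝ} (hr : HasDerivWithinAt f r (Ici 0) 0)
    (hl : HasDerivWithinAt f l (Iic 0) 0) : jump f = r - l := by
  rw [jump, hr.derivWithin (uniqueDiffOn_Ici 0 0 self_mem_Ici),
    hl.derivWithin (uniqueDiffOn_Iic 0 0 self_mem_Iic)]

section formulas

variable {f v z₀ q : ℝ → ℝ} {V A : ℝ}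

lemma hasDerivAt_hom (hγ : 0 ≤ γ) (hf : Admissible f) {n : ℕ} (hn : n ≤ 2) {t : ℝ} (ht : 0 < t)
    (c x : ℝ) : HasDerivAt (fun x => hom γ n f t (x + c)) (hom γ (n + 1) f t (x + c)) x := by
  obtain ⟨hfc, B, hB⟩ := hf
  have := hasDerivAt_hom_comp hγ hfc hB.sup hn (ρ := fun _ => t) (Y := fun x => x + c)
      (ρ' := fun _ => 0) (Y' := fun _ => 1) (θ := x) (fun θ => hasDerivAt_const _ _)
      (fun θ => (hasDerivAt_id θ).add_const _) continuous_const continuous_const ht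
  simpa using this

lemma hasDerivAt_flow (hγ : 0 ≤ γ) (hf : Admissible f) {t : ℝ} (ht : 0 < t)
    (c x : ℝ) : HasDerivAt (fun x => flow γ f t (x + c)) (hom γ 1 f t (x + c)) x := by
  simp_rw [flow_eq_hom f ht]
  exact hasDerivAt_hom hγ hf (by simp) ht c x

lemma rep_zero (f v : ℝ → ℝ) (x : ℝ) : rep γ f v 0 x = f x := by
  simp [rep, flow_zero, layer]

lemma linRep_zero (f v z₀ q : ℝ → ℝ) (x : ℝ) : linRep γ f v z₀ q 0 x = z₀ x := by
  simp [linRep, flow_zero, layer, dlayer]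

lemma continuous_flow_comp (hf : Admissible f) (hv : Continuous v) :
    Continuous fun p : ℝ × ℝ => flow γ f p.1 (p.2 + prim v p.1) := by
  obtain ⟨hfc, B, hB⟩ := hf
  have := continuous_prim hv
  exact (continuous_flow hfc hB.sup).comp (f := fun p : ℝ × ℝ => (p.1, p.2 + prim v p.1))
    (by fun_prop)

/-- The gradient of `rep` off the interface. -/
noncomputable def repGrad (γ : ℝ) (f v : ℝ → ℝ) (t x : ℝ) : ℝ :=
  hom γ 1 f t (x + prim v t) - layer γ 1 (prim v) v t x

lemma hasDerivs_rep (hγ : 0 ≤ γ) (hf : Admissible f) (hv : Continuous v) :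
    ∃ Fxx : ℝ → ℝ → ℝ, HasDerivs (rep γ f v) (repGrad γ f v) Fxx
      (fun t x => Fxx t x + v t * repGrad γ f v t x - γ * rep γ f v t x) := by
  obtain ⟨hfc, B, hB⟩ := id hf
  have h1 := hasDerivs_hom hγ hfc hB.sup (show 0 ≤ 1 by simp) (hasDerivAt_prim hv) hv
  have h2 := hasDerivs_layer (γ := γ) (hasDerivAt_prim hv) hv hv (show 0 ≤ 1 by simp)
  have h3 := (h1.sub h2).congr (H := rep γ f v) fun t x ht _ => by rw [rep, flow_eq_hom f ht]
  refine ⟨_, ⟨h3.x, h3.xx, fun t x ht hx => (h3.t t x ht hx).congr_deriv ?_, h3.cx, h3.cxx,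
    h3.ct.congr fun p hp => ?_⟩⟩
  · rw [rep, repGrad, flow_eq_hom f ht]; ring
  · simp only [rep, repGrad, flow_eq_hom f hp.1]; ring

lemma hasDerivs_repGrad (hγ : 0 ≤ γ) (hf : Admissible f) (hv : Continuous v) :
    ∃ Fx Fxx : ℝ → ℝ → ℝ, HasDerivs (repGrad γ f v) Fx Fxx
      (fun t x => Fxx t x + v t * Fx t x - γ * repGrad γ f v t x) := by
  obtain ⟨hfc, B, hB⟩ := id hf
  have h1 := hasDerivs_hom hγ hfc hB.sup (le_refl 1) (hasDerivAt_prim hv) hv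
  have h2 := hasDerivs_layer (γ := γ) (hasDerivAt_prim hv) hv hv (le_refl 1)
  have h3 := h1.sub h2
  refine ⟨_, _, ⟨h3.x, h3.xx, fun t x ht hx => (h3.t t x ht hx).congr_deriv ?_, h3.cx, h3.cxx,
    h3.ct.congr fun p hp => ?_⟩⟩
  · rw [repGrad]; ring
  · simp only [repGrad]; ring

lemma rep_right_left (hγ : 0 ≤ γ) (hf : Admissible f) (hv : Continuous v) (hV : ∀ t, |v t| ≤ V)
    {t : ℝ} (ht : 0 < t) : ∃ r l : ℝ, HasDerivWithinAt (rep γ f v t) r (Ici 0) 0 ∧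
      HasDerivWithinAt (rep γ f v t) l (Iic 0) 0 ∧ r - l = v t := by
  have h1 := hasDerivAt_flow hγ hf ht (prim v t) 0
  have h2 := hasDerivWithinAt_layer_right hγ (hasDerivAt_prim hv) hv hV hv ht
  have h3 := hasDerivWithinAt_layer_left hγ (hasDerivAt_prim hv) hv hV hv ht
  exact ⟨_, _, h1.hasDerivWithinAt.sub h2, h1.hasDerivWithinAt.sub h3, by ring⟩

/-- The two pieces are separately singular at the interface, so the splitting is legitimate only for
`x ≠ 0`; only their difference stays regular there. -/
lemma dlayer_eq (hv : Continuous v) (hq : Continuous q) (t : ℝ) {x : ℝ} (hx : x ≠ 0) :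
    dlayer γ 1 (prim v) (prim q) v t x = prim q t * layer γ 1 (prim v) v t x
      - layer γ 1 (prim v) (fun τ => prim q τ * v τ) t x := by
  have hqc := continuous_prim hq
  have hvc := continuous_prim hv
  rw [dlayer, layer, layer, ← intervalIntegral.integral_const_mul,
    ← intervalIntegral.integral_sub ((intervalIntegrable_layer hvc hv 1 t 0 t hx).const_mul _)
      (intervalIntegrable_layer (m := fun τ => prim q τ * v τ) hvc (by fun_prop) 1 t 0 t hx)]
  congr 1; ext τ; ring

lemma linRep_eq (f z₀ : ℝ → ℝ) (hv : Continuous v) (hq : Continuous q) {t x : ℝ} (ht : 0 < t)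
    (hx : x ≠ 0) : linRep γ f v z₀ q t x = hom γ 0 z₀ t (x + prim v t) +
      prim q t * repGrad γ f v t x - layer γ 0 (prim v) q t x
        + layer γ 1 (prim v) (fun τ => prim q τ * v τ) t x := by
  rw [linRep, dlayer_eq hv hq t hx, flow_eq_hom z₀ ht, repGrad]; ring

/-- Off the interface the formula is `(∫₀ᵗ q) U_x`, with `U` given by `rep`, plus solutions of the
homogeneous equation. Since `U_x` solves that equation too, the only source is `q U_x`, from
differentiating the factor in time. -/
lemma hasDerivs_linRep (hγ : 0 ≤ γ) (hf : Admissible f) (hz : Admissible z₀) (hv : Continuous v)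
    (hq : Continuous q) :
    ∃ Fx Fxx : ℝ → ℝ → ℝ, HasDerivs (linRep γ f v z₀ q) Fx Fxx
      (fun t x => Fxx t x + v t * Fx t x + q t * repGrad γ f v t x
        - γ * linRep γ f v z₀ q t x) := by
  obtain ⟨hzc, B, hB⟩ := id hz
  have hqc := continuous_prim hq
  obtain ⟨Gxx, hG⟩ := hasDerivs_rep hγ hf hv
  obtain ⟨Gx', Gxx', hG'⟩ := hasDerivs_repGrad hγ hf hv
  have h1 := hasDerivs_hom hγ hzc hB.sup (show 0 ≤ 1 by simp) (hasDerivAt_prim hv) hv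
  have h2 := hG'.time_mul (hasDerivAt_prim hq) hq hG.cx
  have h3 := hasDerivs_layer (γ := γ) (hasDerivAt_prim hv) hv hq (show 0 ≤ 1 by simp)
  have h4 := hasDerivs_layer (γ := γ) (hasDerivAt_prim hv) hv (hqc.mul hv) (le_refl 1)
  have h5 := (((h1.add h2).sub h3).add h4).congr (H := linRep γ f v z₀ q)
    fun t x ht hx => linRep_eq f z₀ hv hq ht hx
  refine ⟨_, _, ⟨h5.x, h5.xx, fun t x ht hx => (h5.t t x ht hx).congr_deriv ?_, h5.cx, h5.cxx,
    h5.ct.congr fun p hp => ?_⟩⟩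
  · rw [linRep_eq f z₀ hv hq ht hx]
    simp only [show prim q * v = fun τ => prim q τ * v τ from rfl]
    ring
  · simp only [linRep_eq f z₀ hv hq hp.1 hp.2]
    simp only [show prim q * v = fun τ => prim q τ * v τ from rfl]
    ring

/-- Only the single layer with density `q` has a kink: the heat flow terms are smooth for `t > 0`,
and the regularized double layer is differentiable across the interface. -/
lemma linRep_right_left (hγ : 0 ≤ γ) (hf : Admissible f) (hz : Admissible z₀) (hv : Continuous v)
    (hV : ∀ t, |v t| ≤ V) (hq : Continuous q) {t : ℝ} (ht : 0 < t) :
    ∃ r l : ℝ, HasDerivWithinAt (linRep γ f v z₀ q t) r (Ici 0) 0 ∧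
      HasDerivWithinAt (linRep γ f v z₀ q t) l (Iic 0) 0 ∧ r - l = q t := by
  have h0 := hasDerivAt_flow hγ hz ht (prim v t) 0
  have h1 := (hasDerivAt_hom hγ hf (show 1 ≤ 2 by simp) ht (prim v t) 0).const_mul (prim q t)
  have h2 := hasDerivWithinAt_layer_right hγ (hasDerivAt_prim hv) hv hV hq ht
  have h3 := hasDerivWithinAt_layer_left hγ (hasDerivAt_prim hv) hv hV hq ht
  have h4 := hasDerivAt_dlayer hγ (continuous_prim hv) hv (hasDerivAt_prim hq) hq ht 0
  exact ⟨_, _, ((h0.hasDerivWithinAt.add h1.hasDerivWithinAt).sub h2).sub h4.hasDerivWithinAt,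
    ((h0.hasDerivWithinAt.add h1.hasDerivWithinAt).sub h3).sub h4.hasDerivWithinAt, by ring⟩

/-- A uniform bound for `rep`. -/
lemma KernelBounds.bd_rep (hA : KernelBounds γ V A) (hγ : 0 < γ) {R : ℝ} (hf : Bd f R)
    (hfc : Continuous f) (hv : Continuous v) (hV : ∀ t, |v t| ≤ V) {t : ℝ} (ht : 0 ≤ t) :
    Bd (rep γ f v t) ((A + 1) * R + A * V * √(Real.pi / (γ / 2))) :=
  (hA.bd_flow hf hfc ht _).sub (hA.bd_layer_of_bounded hγ (continuous_prim hv) hv.measurable ht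
    (fun τ _ => hV τ) ((abs_nonneg _).trans (hV 0)))

lemma inv_sqrt_mul_sqrt {t : ℝ} (ht : 0 < t) : (√t)⁻¹ * √t = 1 :=
  inv_mul_cancel₀ (Real.sqrt_pos.2 ht).ne'

lemma KernelBounds.bd_prim_mul_hom (hA : KernelBounds γ V A) {R : ℝ} (hf : Bd f R)
    (hfc : Continuous f) (hq : Continuous q) {t lam Q : ℝ} (ht : 0 < t) (hl : 0 < lam)
    (hQ0 : 0 ≤ Q) (hQ : ∀ τ ∈ Icc 0 t, |q τ| ≤ Q * Real.exp (lam * τ)) (y : ℝ) :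
    Bd (fun x => prim q t * hom γ 1 f t (x + y)) (A * R * (Q * Real.exp (lam * t) / √lam)) := by
  have hA0 := hA.pos
  have hR := hf.nonneg
  have h2 := (hA.bd_hom hf hfc 1 ht y).const_mul (prim q t)
  have h3 := abs_prim_sub_le hq hl hQ0 hQ (τ := 0) ⟨le_rfl, ht.le⟩
  rw [prim_zero, sub_zero, sub_zero] at h3
  refine h2.mono ?_
  rw [pow_one]
  calc |prim q t| * (A * (√t)⁻¹ * R) ≤
      (Q * Real.exp (lam * t) / √lam * √t) * (A * (√t)⁻¹ * R) := by gcongr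
    _ = A * R * (Q * Real.exp (lam * t) / √lam) * ((√t)⁻¹ * √t) := by ring
    _ = _ := by rw [inv_sqrt_mul_sqrt ht, mul_one]

/-- Every term containing `q` gains `1/√λ`. For the flow term the bound `t^{-1/2}` of `hom γ 1 f` is
compensated by `√t` from the primitive of `q`, and the double layer is handled in the same way. -/
lemma KernelBounds.bd_linRep (hA : KernelBounds γ V A) (hγ : 0 < γ) {R δ : ℝ} (hf : Bd f R)
    (hfc : Continuous f) (hz : Bd z₀ δ) (hzc : Continuous z₀) (hv : Continuous v)
    (hV : ∀ t, |v t| ≤ V) (hq : Continuous q) {t lam Q : ℝ} (ht : 0 ≤ t) (hl : 0 < lam)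
    (hQ0 : 0 ≤ Q) (hQ : ∀ τ ∈ Icc 0 t, |q τ| ≤ Q * Real.exp (lam * τ)) :
    Bd (linRep γ f v z₀ q t) ((A + 1) * δ + (A * R + A * √Real.pi + A * V * √(Real.pi / (γ / 2)))
      * (Q * Real.exp (lam * t) / √lam)) := by
  have hA0 := hA.pos
  have hR := hf.nonneg
  have hV0 : 0 ≤ V := (abs_nonneg _).trans (hV 0)
  rcases ht.eq_or_lt with rfl | ht'
  · have : linRep γ f v z₀ q 0 = z₀ := funext fun x => linRep_zero f v z₀ q x
    rw [this]
    refine hz.mono ?_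
    have : 0 ≤ (A * R + A * √Real.pi + A * V * √(Real.pi / (γ / 2)))
      * (Q * Real.exp (lam * 0) / √lam) := by positivity
    nlinarith [hz.nonneg]
  have h1 := hA.bd_flow hz hzc ht (prim v t)
  have h2 := hA.bd_prim_mul_hom hf hfc hq ht' hl hQ0 hQ (prim v t)
  have h3 := hA.bd_layer hγ (continuous_prim hv) hq.measurable ht hl
    (fun τ hτ => hQ τ (Ioo_subset_Icc_self hτ)) hQ0
  have hqc := continuous_prim hq
  have h4 := hA.bd_layer_one hγ (continuous_prim hv) (m := fun τ => (prim q t - prim q τ) * v τ)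
    (by fun_prop) ht (Q := Q * Real.exp (lam * t) / √lam * V) (fun τ hτ => by
      rw [abs_mul, mul_right_comm]
      gcongr
      · exact abs_prim_sub_le hq hl hQ0 hQ (Ioo_subset_Icc_self hτ)
      · exact hV τ) (by positivity)
  refine ((((h1.add h2).sub h3).sub h4).mono ?_)
  rw [Real.sqrt_div Real.pi_pos.le lam]
  exact le_of_eq (by ring)

lemma isClassical_rep (hA : KernelBounds γ V A) (hγ : 0 < γ) (hf : Admissible f)
    (hv : Continuous v) (hV : ∀ t, |v t| ≤ V) : IsClassical (rep γ f v) := by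
  obtain ⟨Fxx, h⟩ := hasDerivs_rep hγ.le hf hv
  obtain ⟨hfc, R, hR⟩ := id hf
  refine h.isClassical ?_ (fun T => ⟨_, fun t ht _ x => (hA.bd_rep hγ hR hfc hv hV ht).sup x⟩)
    (fun t ht => ?_) (fun t ht => ?_)
  · intro p hp
    exact ((continuous_flow_comp hf hv).continuousAt.sub (continuousAt_layer hγ.le
      (continuous_prim hv) hv hp)).continuousWithinAt
  · obtain ⟨r, l, hr, hl, -⟩ := rep_right_left hγ.le hf hv hV ht
    exact hr.differentiableWithinAt
  · obtain ⟨r, l, hr, hl, -⟩ := rep_right_left hγ.le hf hv hV ht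
    exact hl.differentiableWithinAt

lemma jump_rep (hγ : 0 ≤ γ) (hf : Admissible f) (hv : Continuous v) (hV : ∀ t, |v t| ≤ V)
    {t : ℝ} (ht : 0 < t) : jump (rep γ f v t) = v t := by
  obtain ⟨r, l, hr, hl, h⟩ := rep_right_left hγ hf hv hV ht
  rw [jump_of_hasDerivWithinAt hr hl, h]

lemma rep_equation (hγ : 0 ≤ γ) (hf : Admissible f) (hv : Continuous v) {t x : ℝ} (ht : 0 < t)
    (hx : x ≠ 0) : dt (rep γ f v) t x = dxx (rep γ f v) t x + v t * dx (rep γ f v) t x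
      - γ * rep γ f v t x := by
  obtain ⟨Fxx, h⟩ := hasDerivs_rep hγ hf hv
  rw [h.dt_eq ht hx, h.dx_eq ht hx, h.dxx_eq ht hx]

lemma dx_rep (hγ : 0 ≤ γ) (hf : Admissible f) (hv : Continuous v) {t x : ℝ} (ht : 0 < t)
    (hx : x ≠ 0) : dx (rep γ f v) t x = repGrad γ f v t x := by
  obtain ⟨Fxx, h⟩ := hasDerivs_rep hγ hf hv
  exact h.dx_eq ht hx

/-- As `t → 0` the gradient of the heat flow of merely bounded data may blow up like `t^{-1/2}`, but
`∫₀ᵗ q = O(t)`, so the product tends to zero. -/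
lemma continuousAt_prim_mul_hom (hA : KernelBounds γ V A) (hγ : 0 < γ) (hf : Admissible f)
    (hv : Continuous v) (hq : Continuous q) {p : ℝ × ℝ} (hp : 0 ≤ p.1) :
    ContinuousWithinAt (fun p : ℝ × ℝ => prim q p.1 * hom γ 1 f p.1 (p.2 + prim v p.1))
      {p | 0 ≤ p.1} p := by
  obtain ⟨hfc, R, hR⟩ := id hf
  have hvc := continuous_prim hv
  have hqc := continuous_prim hq
  rcases hp.eq_or_lt with h0 | h0
  · have hA0 := hA.pos
    have hR0 := hR.nonneg
    obtain ⟨L, hL0, hL⟩ := exists_lipschitz_of_hasDerivAt (hasDerivAt_prim hq) hq 1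
    have hval : prim q p.1 * hom γ 1 f p.1 (p.2 + prim v p.1) = 0 := by
      rw [← h0, prim_zero, zero_mul]
    show Tendsto _ _ (𝓝 (prim q p.1 * hom γ 1 f p.1 (p.2 + prim v p.1)))
    rw [hval]
    have hlim : Tendsto (fun p : ℝ × ℝ => L * A * R * √p.1) (𝓝[{p | 0 ≤ p.1}] p) (𝓝 0) := by
      have : Continuous fun p : ℝ × ℝ => L * A * R * √p.1 := by fun_prop
      have := this.tendsto p
      rw [← h0, Real.sqrt_zero, mul_zero] at this
      exact this.mono_left nhdsWithin_le_nhds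
    refine squeeze_zero_norm' ?_ hlim
    have h1 : ∀ᶠ a : ℝ × ℝ in 𝓝[{p | 0 ≤ p.1}] p, a.1 < 1 :=
      (continuousAt_fst.eventually (gt_mem_nhds (by rw [← h0]; exact one_pos))).filter_mono
        nhdsWithin_le_nhds
    filter_upwards [h1, self_mem_nhdsWithin] with a ha1 (ha0 : 0 ≤ a.1)
    rcases ha0.eq_or_lt with hz | hz
    · simp [← hz]
    have h2 := (hA.bd_hom hR hfc 1 hz (prim v a.1)).sup a.2
    have h3 := hL a.1 0 (by rw [abs_of_pos hz]; exact ha1.le) (by simp)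
    rw [prim_zero, sub_zero, sub_zero, abs_of_pos hz] at h3
    rw [Real.norm_eq_abs, abs_mul]
    calc _ ≤ L * a.1 * (A * (√a.1)⁻¹ ^ 1 * R) := by gcongr
      _ = L * A * R * √a.1 * ((√a.1)⁻¹ * √a.1) := by
        nth_rw 1 [← Real.mul_self_sqrt hz.le]; ring
      _ = _ := by rw [inv_sqrt_mul_sqrt hz, mul_one]
  · refine ContinuousAt.continuousWithinAt (ContinuousAt.mul (by fun_prop) ?_)
    exact ContinuousAt.comp (f := fun p : ℝ × ℝ => (p.1, p.2 + prim v p.1))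
      (continuousAt_hom hγ.le hfc hR.sup 1 (p := (p.1, p.2 + prim v p.1)) h0) (by fun_prop)

lemma continuousOn_linRep (hA : KernelBounds γ V A) (hγ : 0 < γ) (hf : Admissible f)
    (hz : Admissible z₀) (hv : Continuous v) (hq : Continuous q) :
    ContinuousOn (fun p : ℝ × ℝ => linRep γ f v z₀ q p.1 p.2) {p | 0 ≤ p.1} := by
  intro p hp
  exact (((continuous_flow_comp hz hv).continuousWithinAt.add
    (continuousAt_prim_mul_hom hA hγ hf hv hq hp)).sub
      (continuousAt_layer hγ.le (continuous_prim hv) hq hp).continuousWithinAt).sub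
        (continuousAt_dlayer hγ.le (continuous_prim hv) hv (hasDerivAt_prim hq) hq
          hp).continuousWithinAt

lemma isClassical_linRep (hA : KernelBounds γ V A) (hγ : 0 < γ) (hf : Admissible f)
    (hz : Admissible z₀) (hv : Continuous v) (hV : ∀ t, |v t| ≤ V) (hq : Continuous q) :
    IsClassical (linRep γ f v z₀ q) := by
  obtain ⟨Fx, Fxx, h⟩ := hasDerivs_linRep hγ.le hf hz hv hq
  obtain ⟨hfc, R, hR⟩ := id hf
  obtain ⟨hzc, δ, hδ⟩ := id hz
  refine h.isClassical (continuousOn_linRep hA hγ hf hz hv hq) (fun T => ?_)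
    (fun t ht => ?_) (fun t ht => ?_)
  · obtain ⟨Q, hQ0, hQ⟩ := exists_abs_le_of_continuous hq T
    have hA0 := hA.pos
    have hR0 := hR.nonneg
    have hV0 : 0 ≤ V := (abs_nonneg _).trans (hV 0)
    refine ⟨(A + 1) * δ + (A * R + A * √Real.pi + A * V * √(Real.pi / (γ / 2))) *
      (Q * Real.exp (1 * T) / √1), fun t ht hT x => ?_⟩
    have hb := hA.bd_linRep hγ hR hfc hδ hzc hv hV hq ht one_pos hQ0 fun τ hτ =>
      (hQ τ (by rw [abs_of_nonneg hτ.1]; exact hτ.2.trans hT)).trans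
        (le_mul_of_one_le_right hQ0 (Real.one_le_exp (by linarith [hτ.1])))
    refine (hb.sup x).trans ?_
    gcongr
  · obtain ⟨r, l, hr, hl, -⟩ := linRep_right_left hγ.le hf hz hv hV hq ht
    exact hr.differentiableWithinAt
  · obtain ⟨r, l, hr, hl, -⟩ := linRep_right_left hγ.le hf hz hv hV hq ht
    exact hl.differentiableWithinAt

lemma jump_linRep (hγ : 0 ≤ γ) (hf : Admissible f) (hz : Admissible z₀) (hv : Continuous v)
    (hV : ∀ t, |v t| ≤ V) (hq : Continuous q) {t : ℝ} (ht : 0 < t) :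
    jump (linRep γ f v z₀ q t) = q t := by
  obtain ⟨r, l, hr, hl, h⟩ := linRep_right_left hγ hf hz hv hV hq ht
  rw [jump_of_hasDerivWithinAt hr hl, h]

lemma linRep_equation (hγ : 0 ≤ γ) (hf : Admissible f) (hz : Admissible z₀) (hv : Continuous v)
    (hq : Continuous q) {t x : ℝ} (ht : 0 < t) (hx : x ≠ 0) :
    dt (linRep γ f v z₀ q) t x = dxx (linRep γ f v z₀ q) t x + v t * dx (linRep γ f v z₀ q) t x
      + q t * repGrad γ f v t x - γ * linRep γ f v z₀ q t x := by
  obtain ⟨Fx, Fxx, h⟩ := hasDerivs_linRep hγ hf hz hv hq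
  rw [h.dt_eq ht hx, h.dx_eq ht hx, h.dxx_eq ht hx]

end formulas

/-! ### The kinetics -/

namespace IsKinetics

variable {g : ℝ → ℝ}

lemma hasDerivWithinAt (hg : IsKinetics g) {u : ℝ} (hu : 0 ≤ u) :
    HasDerivWithinAt g (derivWithin g (Ici 0) u) (Ici 0) u :=
  (hg.contDiffOn.differentiableOn (by norm_num) u hu).hasDerivWithinAt

/-- The chain rule for `g⁻¹ ∘ g = id` on `[0,∞)`. It turns the condition `z = (g⁻¹)' [z_x]` into the
Volterra form `[z_x] = g' z`. -/
lemma kineticsInvDeriv_mul (hg : IsKinetics g) {u : ℝ} (hu : 0 ≤ u) :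
    kineticsInvDeriv g (g u) * derivWithin g (Ici 0) u = 1 := by
  have h1 := (hg.contDiffOn_inv.differentiableOn (by norm_num) (g u)
    (mem_image_of_mem g hu)).hasDerivWithinAt
  have h2 := HasDerivWithinAt.comp u h1 (hg.hasDerivWithinAt hu) (mapsTo_image g (Ici 0))
  have h3 : HasDerivWithinAt (kineticsInv g ∘ g) 1 (Ici 0) u := by
    refine (hasDerivWithinAt_id u (Ici 0)).congr (fun w hw => ?_) ?_
    · exact hg.strictAnti.injOn.leftInvOn_invFunOn hw
    · exact hg.strictAnti.injOn.leftInvOn_invFunOn hu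
  exact (uniqueDiffOn_Ici 0 u hu).eq_deriv _ h2 h3

lemma continuousOn_derivWithin (hg : IsKinetics g) :
    ContinuousOn (derivWithin g (Ici 0)) (Ici 0) :=
  hg.contDiffOn.continuousOn_derivWithin (uniqueDiffOn_Ici 0) (by norm_num)

/-- One `V` bounds velocities and also differences of velocities, since `g` has range in an interval
shorter than `V⁰`. Hence relative displacements of two interfaces are admissible steps in the kernel
Taylor bounds. -/
lemma exists_bound (hg : IsKinetics g) : ∃ V : ℝ, 0 < V ∧ (∀ u, 0 ≤ u → |g u| ≤ V) ∧
    ∀ u w, 0 ≤ u → 0 ≤ w → |g u - g w| ≤ V := by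
  obtain ⟨V, v, hV, hv, h⟩ := hg.bounds
  refine ⟨V, hV, fun u hu => ?_, fun u w hu hw => ?_⟩
  · have := h u hu
    rw [abs_le]; constructor <;> linarith
  · have := h u hu
    have := h w hw
    rw [abs_le]; constructor <;> linarith

lemma exists_lipschitz (hg : IsKinetics g) : ∃ L : ℝ, 0 ≤ L ∧
    (∀ u, 0 ≤ u → |derivWithin g (Ici 0) u| ≤ L) ∧
    ∀ u w, 0 ≤ u → 0 ≤ w → |g u - g w| ≤ L * |u - w| := by
  obtain ⟨L, hL⟩ := hg.deriv_bounded
  refine ⟨L, (abs_nonneg _).trans (hL 0 le_rfl), hL, fun u w hu hw => ?_⟩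
  have := Convex.norm_image_sub_le_of_norm_hasDerivWithin_le (s := Ici (0 : ℝ))
    (fun t ht => hg.hasDerivWithinAt ht) (fun t ht => hL t ht) (convex_Ici _) hw hu
  simpa using this

/-- The second derivative of `g` need not be bounded on `[0,∞)`, so the Taylor constant is taken on
`[0, M]`; an a priori bound on the traces makes this sufficient. -/
lemma exists_quadratic (hg : IsKinetics g) (M : ℝ) : ∃ N : ℝ, 0 ≤ N ∧
    ∀ u w, 0 ≤ u → u ≤ M → 0 ≤ w → w ≤ M →
      |g u - g w - derivWithin g (Ici 0) u * (u - w)| ≤ N * (u - w) ^ 2 := by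
  set g' := derivWithin g (Ici 0) with hg'
  have hcd : ContDiffOn ℝ 1 g' (Ici 0) :=
    hg.contDiffOn.derivWithin (uniqueDiffOn_Ici 0) (by norm_num)
  have hc2 : ContinuousOn (derivWithin g' (Ici 0)) (Ici 0) :=
    hcd.continuousOn_derivWithin (uniqueDiffOn_Ici 0) (by norm_num)
  obtain ⟨N, hN⟩ := (isCompact_Icc (a := 0) (b := M)).exists_bound_of_continuousOn
    (hc2.mono Icc_subset_Ici_self)
  refine ⟨max N 0, le_max_right _ _, fun u w hu huM hw hwM => ?_⟩
  have hlip : ∀ a ∈ Icc 0 M, ∀ b ∈ Icc 0 M, |g' a - g' b| ≤ max N 0 * |a - b| := by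
    intro a ha b hb
    have := Convex.norm_image_sub_le_of_norm_hasDerivWithin_le (s := Icc 0 M) (f := g')
      (C := max N 0)
      (fun t ht => ((hcd.differentiableOn (by norm_num) t ht.1).hasDerivWithinAt).mono
        Icc_subset_Ici_self) (fun t ht => (hN t ht).trans (le_max_left _ _)) (convex_Icc _ _) hb ha
    simpa using this
  have hsub : uIcc w u ⊆ Icc 0 M := by
    intro x hx
    rw [mem_uIcc] at hx
    constructor <;> rcases hx with hx | hx <;> linarith [hx.1, hx.2]
  have := Convex.norm_image_sub_le_of_norm_hasDerivWithin_le (s := uIcc w u)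
    (f := fun x => g x - g' u * x) (f' := fun x => g' x - g' u * 1) (C := max N 0 * |u - w|)
    (fun x hx => ((hg.hasDerivWithinAt (hsub hx).1).mono
      (hsub.trans Icc_subset_Ici_self)).sub ((hasDerivWithinAt_id x _).const_mul _))
    (fun x hx => ?_) (convex_uIcc _ _) left_mem_uIcc right_mem_uIcc
  · rw [Real.norm_eq_abs, Real.norm_eq_abs] at this
    rw [show g u - g w - g' u * (u - w) = g u - g' u * u - (g w - g' u * w) by ring]
    refine this.trans (le_of_eq ?_)
    rw [mul_assoc, ← sq, sq_abs]
  · rw [mul_one]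
    refine (hlip x (hsub hx) u ⟨hu, huM⟩).trans ?_
    have : |x - u| ≤ |u - w| := by
      rw [abs_sub_comm x u]
      exact (abs_sub_right_of_mem_uIcc hx)
    gcongr

end IsKinetics

/-! ### A Volterra argument -/

/-- If bounds `m e^{λτ}` at the interface up to time `t` improve to `(a + m/2) e^{λt}`, then the
function is bounded by `2 a e^{λt}`. -/
lemma bd_of_volterra {F : ℝ → ℝ → ℝ} {a lam : ℝ}
    (hF : ContinuousOn (fun t => F t 0) (Ici 0))
    (h : ∀ t m, 0 ≤ t → 0 ≤ m → (∀ τ ∈ Icc 0 t, |F τ 0| ≤ m * Real.exp (lam * τ)) →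
      Bd (F t) ((a + m / 2) * Real.exp (lam * t))) {t : ℝ} (ht : 0 ≤ t) :
    Bd (F t) (2 * a * Real.exp (lam * t)) := by
  have hc : ContinuousOn (fun τ => |F τ 0| * Real.exp (-(lam * τ))) (Icc 0 t) :=
    (hF.mono Icc_subset_Ici_self).abs.mul (by fun_prop)
  -- The weighted maximum over a compact time interval is finite, so the hypothesis at the
  -- maximizing time `t₀` gives `m ≤ a + m/2`, that is `m ≤ 2a`.
  obtain ⟨t₀, ht₀, hmax⟩ := isCompact_Icc.exists_isMaxOn (nonempty_Icc.2 ht) hc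
  set m := |F t₀ 0| * Real.exp (-(lam * t₀)) with hm
  have hm0 : 0 ≤ m := by positivity
  have hle : ∀ τ ∈ Icc 0 t, |F τ 0| ≤ m * Real.exp (lam * τ) := fun τ hτ => by
    have h1 : |F τ 0| * Real.exp (-(lam * τ)) ≤ m := hmax hτ
    calc |F τ 0| = |F τ 0| * Real.exp (-(lam * τ)) * Real.exp (lam * τ) := by
          rw [mul_assoc, ← Real.exp_add]; simp
      _ ≤ _ := by gcongr
  have h1 := (h t₀ m ht₀.1 hm0 fun τ hτ => hle τ ⟨hτ.1, hτ.2.trans ht₀.2⟩).sup 0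
  have h2 : m ≤ a + m / 2 := by
    calc m ≤ (a + m / 2) * Real.exp (lam * t₀) * Real.exp (-(lam * t₀)) := by
          rw [hm]; gcongr
      _ = a + m / 2 := by rw [mul_assoc, ← Real.exp_add]; simp
  refine (h t m ht hm0 hle).mono ?_
  gcongr
  linarith

lemma exists_small (C : ℝ) : ∃ lam : ℝ, 1 ≤ lam ∧ ∀ κ, lam ≤ κ → C / √κ ≤ 1 / 2 := by
  refine ⟨(2 * |C| + 1) ^ 2, by nlinarith [abs_nonneg C], fun κ hκ => ?_⟩
  have h1 : 2 * |C| + 1 ≤ √κ := Real.le_sqrt_of_sq_le hκ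
  have h2 : 0 < √κ := by linarith [abs_nonneg C]
  rw [div_le_iff₀ h2]
  linarith [le_abs_self C]

/-! ### Linearity of the solution formula -/

lemma intervalIntegrable_layer_zero (hγ : 0 ≤ γ) {s m : ℝ → ℝ} (hs : Continuous s)
    (hm : Continuous m) {t : ℝ} (ht : 0 ≤ t) (x : ℝ) :
    IntervalIntegrable (fun τ => ker γ 0 (t - τ) (x + (s t - s τ)) * m τ) volume 0 t := by
  obtain ⟨C, hC0, hC⟩ := exists_abs_le_of_continuous hm t
  refine intervalIntegrable_of_abs_le (C := 300 * C) ht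
    ((measurable_ker_layer hs 0 t x).mul hm.measurable) fun τ hτ => ?_
  rw [abs_mul]
  calc _ ≤ 300 * (√(t - τ))⁻¹ ^ (0 + 1) * C := by
        gcongr
        · exact abs_ker_le' hγ 0 _ _
        · exact hC _ (by rw [abs_of_pos hτ.1]; exact hτ.2.le)
    _ = _ := by ring

lemma intervalIntegrable_dlayer (hγ : 0 ≤ γ) {s q m : ℝ → ℝ} (hs : Continuous s)
    (hm : Continuous m) (hq : Continuous q) {t : ℝ} (ht : 0 ≤ t) (x : ℝ) :
    IntervalIntegrable (fun τ => ker γ 1 (t - τ) (x + (s t - s τ)) *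
      ((prim q t - prim q τ) * m τ)) volume 0 t := by
  obtain ⟨C, hC0, hC⟩ := exists_abs_le_of_continuous hm t
  obtain ⟨L, hL0, hL⟩ := exists_lipschitz_of_hasDerivAt (hasDerivAt_prim hq) hq t
  have hqc := continuous_prim hq
  refine intervalIntegrable_of_abs_le (C := 300 * L * C * √t) ht
    ((measurable_ker_layer hs 1 t x).mul (by fun_prop)) fun τ hτ => ?_
  have h0 : 0 < t - τ := by linarith [hτ.2]
  refine (abs_dlayer_integrand_le (σ := prim q) (L := L) hγ 0 _ (fun τ hτ => ?_)
    (fun τ hτ => hC τ (by rw [abs_of_pos hτ.1]; exact hτ.2.le)) hτ).trans ?_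
  · have := hL t τ (by rw [abs_of_nonneg ht]) (by rw [abs_of_pos hτ.1]; exact hτ.2.le)
    rwa [abs_of_pos (show 0 < t - τ by linarith [hτ.2])] at this
  · have h1 : 1 = √(t - τ) * (√(t - τ))⁻¹ := (mul_inv_cancel₀ (Real.sqrt_pos.2 h0).ne').symm
    calc _ = 300 * L * C * (√(t - τ) * (√(t - τ))⁻¹) := by rw [← h1, pow_zero]
      _ ≤ 300 * L * C * (√t * (√(t - τ))⁻¹) := by gcongr; linarith [hτ.1]
      _ = _ := by ring

lemma Admissible.sub {f h : ℝ → ℝ} (hf : Admissible f) (hh : Admissible h) :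
    Admissible (fun x => f x - h x) := by
  obtain ⟨hfc, B, hB⟩ := hf
  obtain ⟨hhc, C, hC⟩ := hh
  exact ⟨hfc.sub hhc, _, hB.sub hC⟩

lemma flow_sub {f h : ℝ → ℝ} (hf : Admissible f) (hh : Admissible h) (t y : ℝ) :
    flow γ (fun x => f x - h x) t y = flow γ f t y - flow γ h t y := by
  have hi : ∀ {f : ℝ → ℝ}, Admissible f →
      Integrable fun ζ => ker 0 0 1 ζ * f (y - √t * ζ) := fun {f} hf => by
    obtain ⟨hfc, B, hB⟩ := hf
    refine (integral_ker_zero_one.1.mul_const B).mono'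
      ((measurable_ker_right 0 1).mul (hfc.measurable.comp (by fun_prop))).aestronglyMeasurable
      (ae_of_all _ fun ζ => ?_)
    rw [Real.norm_eq_abs, abs_mul, abs_of_nonneg (ker_zero_nonneg _ _)]
    exact mul_le_mul_of_nonneg_left (hB.sup _) (ker_zero_nonneg _ _)
  rw [flow, flow, flow, ← mul_sub, ← integral_sub (hi hf) (hi hh)]
  congr 2; ext ζ; ring

lemma hom_sub (hγ : 0 ≤ γ) {f h : ℝ → ℝ} (hf : Admissible f) (hh : Admissible h) (n : ℕ) {t : ℝ}
    (ht : 0 < t) (y : ℝ) : hom γ n (fun x => f x - h x) t y = hom γ n f t y - hom γ n h t y := by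
  obtain ⟨hfc, B, hB⟩ := hf
  obtain ⟨hhc, C, hC⟩ := hh
  rw [hom, hom, hom, ← integral_sub (integrable_hom hγ hfc hB.sup n ht y)
    (integrable_hom hγ hhc hC.sup n ht y)]
  congr 1; ext ζ; ring

lemma linRep_sub (hγ : 0 ≤ γ) (f : ℝ → ℝ) {v z₀ z₁ q₀ q₁ : ℝ → ℝ} (hv : Continuous v)
    (hz₀ : Admissible z₀) (hz₁ : Admissible z₁) (hq₀ : Continuous q₀) (hq₁ : Continuous q₁)
    {t : ℝ} (ht : 0 ≤ t) (x : ℝ) :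
    linRep γ f v (fun x => z₀ x - z₁ x) (fun τ => q₀ τ - q₁ τ) t x =
      linRep γ f v z₀ q₀ t x - linRep γ f v z₁ q₁ t x := by
  have hvc := continuous_prim hv
  have h1 : layer γ 0 (prim v) (fun τ => q₀ τ - q₁ τ) t x =
      layer γ 0 (prim v) q₀ t x - layer γ 0 (prim v) q₁ t x := by
    rw [layer, layer, layer, ← intervalIntegral.integral_sub
      (intervalIntegrable_layer_zero hγ hvc hq₀ ht x)
      (intervalIntegrable_layer_zero hγ hvc hq₁ ht x)]
    congr 1; ext τ; ring
  have h2 : dlayer γ 1 (prim v) (prim fun τ => q₀ τ - q₁ τ) v t x =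
      dlayer γ 1 (prim v) (prim q₀) v t x - dlayer γ 1 (prim v) (prim q₁) v t x := by
    rw [dlayer, dlayer, dlayer, ← intervalIntegral.integral_sub
      (intervalIntegrable_dlayer hγ hvc hv hq₀ ht x)
      (intervalIntegrable_dlayer hγ hvc hv hq₁ ht x)]
    simp only [prim_sub hq₀ hq₁]
    congr 1; ext τ; ring
  rw [linRep, linRep, linRep, h1, h2, flow_sub hz₀ hz₁, prim_sub hq₀ hq₁]
  ring

/-! ### Solvability of the equation for the jump -/

section volterra

variable {f v z₀ z₁ q q₀ q₁ b : ℝ → ℝ} {V A L R δ lam : ℝ}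

lemma Admissible.of_bd (hfc : Continuous f) (hf : Bd f R) : Admissible f := ⟨hfc, R, hf⟩

lemma continuous_trace {u : ℝ → ℝ → ℝ}
    (hu : ContinuousOn (fun p : ℝ × ℝ => u p.1 p.2) {p | 0 ≤ p.1}) :
    Continuous fun t => u (max t 0) 0 :=
  hu.comp_continuous (f := fun t : ℝ => (max t 0, (0 : ℝ))) (by fun_prop) fun t => le_max_right t 0

lemma continuousOn_trace {u : ℝ → ℝ → ℝ}
    (hu : ContinuousOn (fun p : ℝ × ℝ => u p.1 p.2) {p | 0 ≤ p.1}) :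
    ContinuousOn (fun t => u t 0) (Ici 0) :=
  hu.comp (f := fun t : ℝ => (t, (0 : ℝ))) (by fun_prop) fun _ ht => ht

/-- The factor with which the jump of the derivative enters the solution of the linearized
problem. -/
noncomputable def layerConst (γ A V R : ℝ) : ℝ :=
  A * R + A * √Real.pi + A * V * √(Real.pi / (γ / 2))

/-- The feedback `q = b z(·,0)` turns a bound `m e^{λτ}` of the trace into a bound `L m e^{λτ}` of
`q`, which returns as at most `m/2`. -/
lemma bd_linRep_of_kinetic (hA : KernelBounds γ V A) (hγ : 0 < γ) (hf : Bd f R)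
    (hfc : Continuous f) (hz : Bd z₀ δ) (hzc : Continuous z₀) (hv : Continuous v)
    (hV : ∀ t, |v t| ≤ V) (hL : ∀ t, |b t| ≤ L) (hq : Continuous q)
    (hqb : ∀ t, 0 ≤ t → q t = b t * linRep γ f v z₀ q t 0) (hlam : 0 < lam)
    (hsmall : layerConst γ A V R * L / √lam ≤ 1 / 2) {t : ℝ} (ht : 0 ≤ t) :
    Bd (linRep γ f v z₀ q t) (2 * ((A + 1) * δ) * Real.exp (lam * t)) := by
  have hL0 : 0 ≤ L := (abs_nonneg _).trans (hL 0)
  have hA0 := hA.pos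
  refine bd_of_volterra (continuousOn_trace (continuousOn_linRep hA hγ (.of_bd hfc hf)
    (.of_bd hzc hz) hv hq)) (fun t m ht hm h => ?_) ht
  have h1 := hA.bd_linRep hγ hf hfc hz hzc hv hV hq ht hlam (Q := L * m) (by positivity)
    fun τ hτ => by
      rw [hqb τ hτ.1, abs_mul, mul_assoc]
      exact mul_le_mul (hL τ) (h τ hτ) (abs_nonneg _) hL0
  refine h1.mono ?_
  have h2 : 1 ≤ Real.exp (lam * t) := Real.one_le_exp (by positivity)
  have h3 : (A + 1) * δ ≤ (A + 1) * δ * Real.exp (lam * t) :=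
    le_mul_of_one_le_right (mul_nonneg (by positivity) hz.nonneg) h2
  have h4 : layerConst γ A V R * (L * m * Real.exp (lam * t) / √lam) =
      layerConst γ A V R * L / √lam * (m * Real.exp (lam * t)) := by ring
  have h5 : layerConst γ A V R * L / √lam * (m * Real.exp (lam * t)) ≤
      1 / 2 * (m * Real.exp (lam * t)) := by gcongr
  rw [← layerConst, h4]
  linarith

/-- By linearity the difference solves the same Volterra equation with zero data, and the linear
bound with `δ = 0` annihilates it. -/
lemma linRep_unique (hA : KernelBounds γ V A) (hγ : 0 < γ) (hf : Bd f R)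
    (hfc : Continuous f) (hz : Bd z₀ δ) (hzc : Continuous z₀) (hv : Continuous v)
    (hV : ∀ t, |v t| ≤ V) (hL : ∀ t, |b t| ≤ L) (hq₀ : Continuous q₀) (hq₁ : Continuous q₁)
    (hqb₀ : ∀ t, 0 ≤ t → q₀ t = b t * linRep γ f v z₀ q₀ t 0)
    (hqb₁ : ∀ t, 0 ≤ t → q₁ t = b t * linRep γ f v z₀ q₁ t 0) {t : ℝ} (ht : 0 ≤ t) (x : ℝ) :
    linRep γ f v z₀ q₀ t x = linRep γ f v z₀ q₁ t x := by
  obtain ⟨lam, h1, hlam⟩ := exists_small (layerConst γ A V R * L)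
  have hz' : Admissible z₀ := ⟨hzc, δ, hz⟩
  have h0 : Bd (fun x => z₀ x - z₀ x) 0 := by simpa using Bd.zero
  have hd : ∀ {t : ℝ}, 0 ≤ t → ∀ x, linRep γ f v (fun x => z₀ x - z₀ x) (fun τ => q₀ τ - q₁ τ) t x =
      linRep γ f v z₀ q₀ t x - linRep γ f v z₀ q₁ t x := fun ht x =>
    linRep_sub hγ.le f hv hz' hz' hq₀ hq₁ ht x
  have := (bd_linRep_of_kinetic hA hγ hf hfc h0 (by fun_prop) hv hV hL (hq₀.sub hq₁)
    (fun t ht => by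
      show q₀ t - q₁ t = b t * linRep γ f v (fun x => z₀ x - z₀ x) (fun τ => q₀ τ - q₁ τ) t 0
      rw [hd ht, mul_sub, ← hqb₀ t ht, ← hqb₁ t ht]) (by linarith : 0 < lam)
      (hlam lam le_rfl) ht).sup x
  have h2 : |linRep γ f v z₀ q₀ t x - linRep γ f v z₀ q₁ t x| ≤ 0 := by
    rw [← hd ht x]
    exact this.trans_eq (by ring)
  exact sub_eq_zero.1 (abs_nonpos_iff.1 h2)

/-- A contraction for the weighted trace `y(t) = e^{-λt} z(t,0)` in the bounded continuous
functions. The weight makes the whole half line accessible in one step. -/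
lemma exists_kinetic_density (hA : KernelBounds γ V A) (hγ : 0 < γ) (hf : Bd f R)
    (hfc : Continuous f) (hz : Bd z₀ δ) (hzc : Continuous z₀) (hv : Continuous v)
    (hV : ∀ t, |v t| ≤ V) (hb : Continuous b) (hL : ∀ t, |b t| ≤ L) :
    ∃ q : ℝ → ℝ, Continuous q ∧ ∀ t, 0 ≤ t → q t = b t * linRep γ f v z₀ q t 0 := by
  obtain ⟨lam, h1, hlam⟩ := exists_small (layerConst γ A V R * L)
  have hlam0 : 0 < lam := by linarith
  have hsmall := hlam lam le_rfl
  have hL0 : 0 ≤ L := (abs_nonneg _).trans (hL 0)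
  have hz' : Admissible z₀ := ⟨hzc, δ, hz⟩
  have hf' : Admissible f := ⟨hfc, R, hf⟩
  -- The density `q` belonging to the weighted trace `y`. Replacing `t` by `max t 0` below extends
  -- the map to negative times, whose values play no role.
  set Q : BoundedContinuousFunction ℝ ℝ → ℝ → ℝ := fun y t => b t * (Real.exp (lam * t) * y t) with hQ
  have hQc : ∀ y, Continuous (Q y) := fun y => by
    have := y.continuous
    fun_prop
  set Φ₀ : BoundedContinuousFunction ℝ ℝ → ℝ → ℝ := fun y t =>
    Real.exp (-(lam * max t 0)) * linRep γ f v z₀ (Q y) (max t 0) 0 with hΦ₀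
  have hc : ∀ y, Continuous (Φ₀ y) := fun y =>
    Continuous.mul (by fun_prop) (continuous_trace (continuousOn_linRep hA hγ hf' hz' hv (hQc y)))
  have hexp : ∀ t, Real.exp (-(lam * max t 0)) * Real.exp (lam * max t 0) = 1 := fun t => by
    rw [← Real.exp_add]; simp
  have hbd : ∀ y t, ‖Φ₀ y t‖ ≤ (A + 1) * δ + layerConst γ A V R * (L * ‖y‖ / √lam) := fun y t => by
    have h := (hA.bd_linRep hγ hf hfc hz hzc hv hV (hQc y) (le_max_right t 0) hlam0
      (Q := L * ‖y‖) (by positivity) fun τ hτ => by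
        rw [hQ]
        simp only [abs_mul, abs_of_pos (Real.exp_pos _)]
        calc |b τ| * (Real.exp (lam * τ) * |y τ|) ≤ L * (Real.exp (lam * τ) * ‖y‖) := by
              gcongr
              · exact hL τ
              · exact y.norm_coe_le_norm τ
          _ = _ := by ring).sup 0
    have hle : Real.exp (-(lam * max t 0)) ≤ 1 := by
      refine Real.exp_le_one_iff.2 (by have := le_max_right t 0; nlinarith)
    rw [hΦ₀, Real.norm_eq_abs]
    simp only [abs_mul, abs_of_pos (Real.exp_pos _)]
    calc _ ≤ Real.exp (-(lam * max t 0)) * _ :=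
          mul_le_mul_of_nonneg_left h (Real.exp_pos _).le
      _ = Real.exp (-(lam * max t 0)) * ((A + 1) * δ) + layerConst γ A V R * (L * ‖y‖ / √lam)
          * (Real.exp (-(lam * max t 0)) * Real.exp (lam * max t 0)) := by
        rw [layerConst]; ring
      _ ≤ _ := by
        rw [hexp, mul_one]
        have := mul_nonneg (by linarith [hA.pos] : 0 ≤ A + 1) hz.nonneg
        exact add_le_add_left (mul_le_of_le_one_left this hle) _
  set Φ : BoundedContinuousFunction ℝ ℝ → BoundedContinuousFunction ℝ ℝ := fun y =>
    BoundedContinuousFunction.ofNormedAddCommGroup (Φ₀ y) (hc y) _ (hbd y) with hΦ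
  have hΦc : ContractingWith (1 / 2) Φ := by
    refine ⟨by rw [← NNReal.coe_lt_coe]; norm_num, LipschitzWith.of_dist_le_mul fun y y' => ?_⟩
    rw [BoundedContinuousFunction.dist_le (by positivity)]
    intro t
    have h0 : Bd (fun x => z₀ x - z₀ x) 0 := by simpa using Bd.zero
    have h := (hA.bd_linRep hγ hf hfc h0 (by fun_prop) hv hV ((hQc y).sub (hQc y'))
      (le_max_right t 0) hlam0 (Q := L * dist y y') (by positivity) fun τ hτ => by
        show |Q y τ - Q y' τ| ≤ _
        have e : Q y τ - Q y' τ = b τ * (Real.exp (lam * τ) * (y τ - y' τ)) := by rw [hQ]; ring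
        rw [e, abs_mul, abs_mul, abs_of_pos (Real.exp_pos _)]
        calc |b τ| * (Real.exp (lam * τ) * |y τ - y' τ|) ≤
            L * (Real.exp (lam * τ) * dist y y') := by
              gcongr
              · exact hL τ
              · rw [← Real.dist_eq]; exact BoundedContinuousFunction.dist_coe_le_dist τ
          _ = _ := by ring).sup 0
    -- The iteration map is affine, so its Lipschitz constant is the bound of the linear part, that
    -- is of the formula with zero initial data.
    have e := linRep_sub hγ.le f hv hz' hz' (hQc y) (hQc y') (le_max_right t 0) 0
    show dist (Φ₀ y t) (Φ₀ y' t) ≤ _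
    rw [Real.dist_eq, hΦ₀]
    simp only []
    rw [← mul_sub, ← e, abs_mul, abs_of_pos (Real.exp_pos _)]
    calc _ ≤ Real.exp (-(lam * max t 0)) * _ :=
          mul_le_mul_of_nonneg_left h (Real.exp_pos _).le
      _ = layerConst γ A V R * L / √lam * dist y y'
          * (Real.exp (-(lam * max t 0)) * Real.exp (lam * max t 0)) := by
        rw [layerConst]; ring
      _ ≤ 1 / 2 * dist y y' := by rw [hexp, mul_one]; gcongr
      _ = _ := by norm_num
  set y := ContractingWith.fixedPoint Φ hΦc
  have hy : Φ y = y := hΦc.fixedPoint_isFixedPt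
  refine ⟨Q y, hQc y, fun t ht => ?_⟩
  have h2 : y t = Φ₀ y t := by
    conv_lhs => rw [← hy]
    rfl
  have h3 := hexp t
  rw [max_eq_left ht] at h3
  have h4 : Q y t = b t * (Real.exp (lam * t) * y t) := rfl
  rw [h4, h2, hΦ₀]
  simp only [max_eq_left ht]
  rw [← mul_assoc (Real.exp (lam * t)), mul_comm (Real.exp (lam * t)), h3, one_mul]

end volterra

/-! ### Orbits and solutions of the linearized problem -/

section orbit

variable {g U₀ z₀ z₁ : ℝ → ℝ} {U z : ℝ → ℝ → ℝ} {V A L R δ : ℝ}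

/-- The velocity of the interface along an orbit, extended to negative times. -/
noncomputable def velocity (g : ℝ → ℝ) (U : ℝ → ℝ → ℝ) (t : ℝ) : ℝ := g (U (max t 0) 0)

/-- The derivative of the kinetics along an orbit, extended to negative times. -/
noncomputable def slope (g : ℝ → ℝ) (U : ℝ → ℝ → ℝ) (t : ℝ) : ℝ :=
  derivWithin g (Ici 0) (U (max t 0) 0)

/-! ### Orbits and linearized solutions as values of the solution formulas -/

namespace IsOrbit

lemma trace_nonneg (hU : IsOrbit γ g U₀ U) (t : ℝ) : 0 ≤ U (max t 0) 0 :=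
  hU.nonneg _ _ (le_max_right _ _)

lemma continuous_velocity (hU : IsOrbit γ g U₀ U) (hg : IsKinetics g) :
    Continuous (velocity g U) :=
  hg.contDiffOn.continuousOn.comp_continuous (continuous_trace hU.classical.continuousOn)
    hU.trace_nonneg

lemma continuous_slope (hU : IsOrbit γ g U₀ U) (hg : IsKinetics g) : Continuous (slope g U) :=
  hg.continuousOn_derivWithin.comp_continuous (continuous_trace hU.classical.continuousOn)
    hU.trace_nonneg

lemma jump_eq (hU : IsOrbit γ g U₀ U) {t : ℝ} (ht : 0 < t) : jump (U t) = velocity g U t := by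
  rw [← hU.kinetic t ht, velocity, max_eq_left ht.le]

lemma abs_velocity_le (hU : IsOrbit γ g U₀ U) (hV : ∀ u, 0 ≤ u → |g u| ≤ V) (t : ℝ) :
    |velocity g U t| ≤ V := hV _ (hU.trace_nonneg t)

lemma abs_slope_le (hU : IsOrbit γ g U₀ U)
    (hL : ∀ u, 0 ≤ u → |derivWithin g (Ici 0) u| ≤ L) (t : ℝ) :
    |slope g U t| ≤ L := hL _ (hU.trace_nonneg t)

lemma kineticsInvDeriv_mul_slope (hU : IsOrbit γ g U₀ U) (hg : IsKinetics g) {t : ℝ} (ht : 0 < t) :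
    kineticsInvDeriv g (jump (U t)) * slope g U t = 1 := by
  rw [hU.jump_eq ht]
  exact hg.kineticsInvDeriv_mul (hU.trace_nonneg t)

/-- Orbits are given by the solution formula. -/
lemma eq_rep (hU : IsOrbit γ g U₀ U) (hg : IsKinetics g) (hγ : 0 < γ) (hA : KernelBounds γ V A)
    (hV : ∀ u, 0 ≤ u → |g u| ≤ V) (hf : Admissible U₀) {t : ℝ} (ht : 0 ≤ t) :
    U t = rep γ U₀ (velocity g U) t := by
  have hv := hU.continuous_velocity hg
  have hvV := hU.abs_velocity_le hV
  ext x
  refine hU.classical.eq_of_jump_eq (isClassical_rep hA hγ hf hv hvV) hγ.le hvV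
    (F := fun _ _ => 0) (fun t x ht hx => ?_) (fun t x ht hx => ?_) (fun t ht => ?_) (fun x => ?_)
    t x ht
  · rw [hU.equation t x ht hx, hU.jump_eq ht, add_zero]
  · rw [rep_equation hγ.le hf hv ht hx, add_zero]
  · rw [jump_rep hγ.le hf hv hvV ht, hU.jump_eq ht]
  · rw [hU.initial, rep_zero]

lemma dx_eq (hU : IsOrbit γ g U₀ U) (hg : IsKinetics g) (hγ : 0 < γ) (hA : KernelBounds γ V A)
    (hV : ∀ u, 0 ≤ u → |g u| ≤ V) (hf : Admissible U₀) {t x : ℝ} (ht : 0 < t) (hx : x ≠ 0) :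
    dx U t x = repGrad γ U₀ (velocity g U) t x := by
  rw [← dx_rep hγ.le hf (hU.continuous_velocity hg) ht hx, dx, dx,
    hU.eq_rep hg hγ hA hV hf ht.le]

/-- Solutions of the linearized problem are given by the solution formula. -/
lemma eq_linRep (hU : IsOrbit γ g U₀ U) (hg : IsKinetics g) (hγ : 0 < γ) (hA : KernelBounds γ V A)
    (hV : ∀ u, 0 ≤ u → |g u| ≤ V) (hf : Admissible U₀) (hz₀ : Admissible z₀)
    (hz : IsLinearizedSolution γ g U z₀ z) :
    ∃ q, Continuous q ∧ (∀ t, 0 ≤ t → q t = slope g U t * z t 0) ∧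
      ∀ t, 0 ≤ t → z t = linRep γ U₀ (velocity g U) z₀ q t := by
  have hv := hU.continuous_velocity hg
  have hvV := hU.abs_velocity_le hV
  have hq : Continuous fun t => slope g U t * z (max t 0) 0 :=
    (hU.continuous_slope hg).mul (continuous_trace hz.classical.continuousOn)
  refine ⟨_, hq, fun t ht => by simp only [max_eq_left ht], fun t ht => funext fun x => ?_⟩
  -- The kinetic condition inverted: the jump equals `g'(U(t,0))` times the trace, which is
  -- continuous and so can serve as density in `linRep`.
  have hj : ∀ t, 0 < t → jump (z t) = slope g U t * z (max t 0) 0 := fun t ht => by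
    rw [max_eq_left ht.le, hz.kinetic t ht, ← mul_assoc, mul_comm (slope g U t),
      hU.kineticsInvDeriv_mul_slope hg ht, one_mul]
  refine hz.classical.eq_of_jump_eq (isClassical_linRep hA hγ hf hz₀ hv hvV hq) hγ.le hvV
    (F := fun t x => slope g U t * z (max t 0) 0 * repGrad γ U₀ (velocity g U) t x)
    (fun t x ht hx => ?_) (fun t x ht hx => linRep_equation hγ.le hf hz₀ hv hq ht hx)
    (fun t ht => ?_) (fun x => ?_) t x ht
  · rw [hz.equation t x ht hx, hU.jump_eq ht, hj t ht, hU.dx_eq hg hγ hA hV hf ht hx]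
  · rw [jump_linRep hγ.le hf hz₀ hv hvV hq ht, hj t ht]
  · rw [hz.initial, linRep_zero]

lemma isLinearizedSolution_linRep (hU : IsOrbit γ g U₀ U) (hg : IsKinetics g) (hγ : 0 < γ)
    (hA : KernelBounds γ V A) (hV : ∀ u, 0 ≤ u → |g u| ≤ V) (hf : Admissible U₀)
    (hz₀ : Admissible z₀) {q : ℝ → ℝ} (hq : Continuous q)
    (hqb : ∀ t, 0 ≤ t → q t = slope g U t * linRep γ U₀ (velocity g U) z₀ q t 0) :
    IsLinearizedSolution γ g U z₀ (linRep γ U₀ (velocity g U) z₀ q) := by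
  have hv := hU.continuous_velocity hg
  have hvV := hU.abs_velocity_le hV
  refine ⟨isClassical_linRep hA hγ hf hz₀ hv hvV hq, linRep_zero _ _ _ _, fun t x ht hx => ?_,
    fun t ht => ?_⟩
  · rw [linRep_equation hγ.le hf hz₀ hv hq ht hx, jump_linRep hγ.le hf hz₀ hv hvV hq ht,
      hU.jump_eq ht, hU.dx_eq hg hγ hA hV hf ht hx]
  · rw [jump_linRep hγ.le hf hz₀ hv hvV hq ht, hqb t ht.le, ← mul_assoc,
      hU.kineticsInvDeriv_mul_slope hg ht, one_mul]

lemma exists_linearizedSolution (hU : IsOrbit γ g U₀ U) (hg : IsKinetics g) (hγ : 0 < γ)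
    (hf : Admissible U₀) (hz₀ : Admissible z₀) : ∃ z, IsLinearizedSolution γ g U z₀ z := by
  obtain ⟨V, hV0, hV, -⟩ := hg.exists_bound
  obtain ⟨L, hL0, hL, -⟩ := hg.exists_lipschitz
  obtain ⟨A, hA⟩ := exists_kernelBounds hγ hV0.le
  obtain ⟨hfc, R, hR⟩ := id hf
  obtain ⟨hzc, δ, hδ⟩ := id hz₀
  obtain ⟨q, hq, hqb⟩ := exists_kinetic_density hA hγ hR hfc hδ hzc (hU.continuous_velocity hg)
    (hU.abs_velocity_le hV) (hU.continuous_slope hg) (hU.abs_slope_le hL)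
  exact ⟨_, hU.isLinearizedSolution_linRep hg hγ hA hV hf hz₀ hq hqb⟩

lemma linearizedSolution_unique (hU : IsOrbit γ g U₀ U) (hg : IsKinetics g) (hγ : 0 < γ)
    (hf : Admissible U₀) (hz₀ : Admissible z₀) {y : ℝ → ℝ → ℝ}
    (hz : IsLinearizedSolution γ g U z₀ z) (hy : IsLinearizedSolution γ g U z₀ y) {t : ℝ}
    (ht : 0 ≤ t) : z t = y t := by
  obtain ⟨V, hV0, hV, -⟩ := hg.exists_bound
  obtain ⟨L, hL0, hL, -⟩ := hg.exists_lipschitz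
  obtain ⟨A, hA⟩ := exists_kernelBounds hγ hV0.le
  obtain ⟨hfc, R, hR⟩ := id hf
  obtain ⟨hzc, δ, hδ⟩ := id hz₀
  obtain ⟨q, hq, hqb, hzq⟩ := hU.eq_linRep hg hγ hA hV hf hz₀ hz
  obtain ⟨p, hp, hpb, hyp⟩ := hU.eq_linRep hg hγ hA hV hf hz₀ hy
  rw [hzq t ht, hyp t ht]
  exact funext fun x => linRep_unique hA hγ hR hfc hδ hzc (hU.continuous_velocity hg)
    (hU.abs_velocity_le hV) (hU.abs_slope_le hL) hq hp
    (fun t ht => by rw [hqb t ht, hzq t ht]) (fun t ht => by rw [hpb t ht, hyp t ht]) ht x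

end IsOrbit

lemma IsLinearizedSolution.comb {y : ℝ → ℝ → ℝ} (hz : IsLinearizedSolution γ g U z₀ z)
    (hy : IsLinearizedSolution γ g U z₁ y) (a b : ℝ) :
    IsLinearizedSolution γ g U (a • z₀ + b • z₁) (fun t x => a * z t x + b * y t x) where
  classical := hz.classical.comb hy.classical a b
  initial x := by simp [hz.initial, hy.initial]
  equation t x ht hx := by
    rw [hz.classical.dt_comb hy.classical a b ht hx, hz.classical.dxx_comb hy.classical a b ht hx,
      hz.classical.dx_comb hy.classical a b ht hx, hz.classical.jump_comb hy.classical a b ht,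
      hz.equation t x ht hx, hy.equation t x ht hx]
    ring
  kinetic t ht := by
    rw [hz.classical.jump_comb hy.classical a b ht, hz.kinetic t ht, hy.kinetic t ht]
    ring

lemma Admissible.comb {f h : ℝ → ℝ} (hf : Admissible f) (hh : Admissible h) (a b : ℝ) :
    Admissible (a • f + b • h) := by
  obtain ⟨hfc, B, hB⟩ := hf
  obtain ⟨hhc, C, hC⟩ := hh
  exact ⟨(hfc.const_smul a).add (hhc.const_smul b), _, (hB.const_mul a).add (hC.const_mul b)⟩

end orbit

/-! ### Taylor remainders of the potentials -/

section taylor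

variable {V A c E t : ℝ} {f s η m : ℝ → ℝ}

/-- Two bounds on the shift play different roles: `|h| ≤ V t` keeps the kernel under its Gaussian
majorant, and `|h| ≤ E √t` cancels the factor `t^{-1/2}`. -/
lemma KernelBounds.bd_hom_taylor₁ (hA : KernelBounds γ V A) (hf : Bd f c) (hfc : Continuous f)
    (hγ : 0 ≤ γ) (ht : 0 < t) {h : ℝ} (hV : |h| ≤ V * t) (hE : |h| ≤ E * √t) (y : ℝ) :
    Bd (fun x => hom γ 0 f t (x + y) - hom γ 0 f t (x + y - h)) (A * c * E) := by
  have h1 := hf.conv hfc ((measurable_ker_right 0 t).sub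
    ((measurable_ker_right 0 t).comp (measurable_id.sub_const h)))
    (hA.int_taylor₁ t h ht hV).1 (hA.int_taylor₁ t h ht hV).2 y
  have e : (fun x => hom γ 0 f t (x + y) - hom γ 0 f t (x + y - h)) =
      fun x => ∫ w, (ker γ 0 t (x + y - w) - ker γ 0 t (x + y - w - h)) * f w := by
    ext x
    rw [hom, hom, ← integral_sub (integrable_hom hγ hfc hf.sup 0 ht _)
      (integrable_hom hγ hfc hf.sup 0 ht _)]
    congr 1; ext w
    rw [sub_mul, show x + y - h - w = x + y - w - h by ring]
  rw [e]
  refine h1.mono ?_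
  have hA0 := hA.pos
  have hc0 := hf.nonneg
  calc A * (√t)⁻¹ ^ 1 * |h| * c ≤ A * (√t)⁻¹ ^ 1 * (E * √t) * c := by gcongr
    _ = A * c * E * ((√t)⁻¹ * √t) := by ring
    _ = _ := by rw [inv_sqrt_mul_sqrt ht, mul_one]

lemma KernelBounds.bd_hom_taylor₂ (hA : KernelBounds γ V A) (hf : Bd f c) (hfc : Continuous f)
    (hγ : 0 ≤ γ) (ht : 0 < t) {h : ℝ} (hV : |h| ≤ V * t) (hE : |h| ≤ E * √t) (y : ℝ) :
    Bd (fun x => hom γ 0 f t (x + y) - hom γ 0 f t (x + y - h) - h * hom γ 1 f t (x + y))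
      (A * c * E ^ 2) := by
  have h1 := hf.conv hfc (((measurable_ker_right 0 t).sub
    ((measurable_ker_right 0 t).comp (measurable_id.sub_const h))).sub
      ((measurable_ker_right 1 t).const_mul h))
    (hA.int_taylor₂ t h ht hV).1 (hA.int_taylor₂ t h ht hV).2 y
  have e : (fun x => hom γ 0 f t (x + y) - hom γ 0 f t (x + y - h) - h * hom γ 1 f t (x + y)) =
      fun x => ∫ w, (ker γ 0 t (x + y - w) - ker γ 0 t (x + y - w - h)
        - h * ker γ 1 t (x + y - w)) * f w := by
    ext x
    have i : Integrable fun w => ker γ 0 t (x + y - w) * f w - ker γ 0 t (x + y - h - w) * f w :=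
      (integrable_hom hγ hfc hf.sup 0 ht _).sub (integrable_hom hγ hfc hf.sup 0 ht _)
    rw [hom, hom, hom, ← integral_const_mul, ← integral_sub
      (integrable_hom hγ hfc hf.sup 0 ht _) (integrable_hom hγ hfc hf.sup 0 ht _),
      ← integral_sub i ((integrable_hom hγ hfc hf.sup 1 ht _).const_mul h)]
    congr 1; ext w
    rw [show x + y - h - w = x + y - w - h by ring]
    ring
  rw [e]
  refine h1.mono ?_
  have hA0 := hA.pos
  have hc0 := hf.nonneg
  have h2 : h ^ 2 ≤ (E * √t) ^ 2 := by rw [← sq_abs]; gcongr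
  calc A * (√t)⁻¹ ^ 2 * h ^ 2 * c ≤ A * (√t)⁻¹ ^ 2 * (E * √t) ^ 2 * c := by gcongr
    _ = A * c * E ^ 2 * ((√t)⁻¹ * √t) ^ 2 := by ring
    _ = _ := by rw [inv_sqrt_mul_sqrt ht, one_pow, mul_one]

/-- The change of a layer potential under a shift `η` of its source. -/
noncomputable def layerDiff (γ : ℝ) (s η m : ℝ → ℝ) (t x : ℝ) : ℝ :=
  ∫ τ in (0 : ℝ)..t, (ker γ 0 (t - τ) (x + (s t - s τ))
    - ker γ 0 (t - τ) (x + (s t - s τ) - (η t - η τ))) * m τ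

/-- The second order Taylor remainder of a layer potential under a shift `η` of its source. -/
noncomputable def layerTaylor (γ : ℝ) (s η m : ℝ → ℝ) (t x : ℝ) : ℝ :=
  ∫ τ in (0 : ℝ)..t, (ker γ 0 (t - τ) (x + (s t - s τ))
    - ker γ 0 (t - τ) (x + (s t - s τ) - (η t - η τ))
    - (η t - η τ) * ker γ 1 (t - τ) (x + (s t - s τ))) * m τ

lemma measurable_ker_shift (hs : Continuous s) (n : ℕ) (t : ℝ) :
    Measurable fun p : ℝ × ℝ => ker γ n (t - p.1) (p.2 + (s t - s p.1)) :=
  (measurable_ker n).comp (by fun_prop :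
    Measurable fun p : ℝ × ℝ => (t - p.1, p.2 + (s t - s p.1)))

lemma measurable_ker_shift_sub (hs : Continuous s) (hη : Continuous η) (n : ℕ) (t : ℝ) :
    Measurable fun p : ℝ × ℝ => ker γ n (t - p.1) (p.2 + (s t - s p.1) - (η t - η p.1)) :=
  (measurable_ker n).comp (by fun_prop :
    Measurable fun p : ℝ × ℝ => (t - p.1, p.2 + (s t - s p.1) - (η t - η p.1)))

lemma KernelBounds.bd_layerDiff (hA : KernelBounds γ V A) (hγ : 0 < γ) (hs : Continuous s)
    (hη : Continuous η) (hm : Measurable m) (hmV : ∀ τ, |m τ| ≤ V) (ht : 0 ≤ t)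
    (hV : ∀ τ ∈ Ioo 0 t, |η t - η τ| ≤ V * (t - τ)) (hE0 : 0 ≤ E)
    (hE : ∀ τ ∈ Ioo 0 t, |η t - η τ| ≤ E * √(t - τ)) :
    Bd (layerDiff γ s η m t) (A * V * √(Real.pi / (γ / 2)) * E) := by
  have hA0 := hA.pos
  have hV0 : 0 ≤ V := (abs_nonneg _).trans (hmV 0)
  refine (Bd.intervalIntegral (k := fun τ x => (ker γ 0 (t - τ) (x + (s t - s τ))
    - ker γ 0 (t - τ) (x + (s t - s τ) - (η t - η τ))) * m τ) (K := A * V * E) ht (half_pos hγ) (by positivity)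
    (((measurable_ker_shift hs 0 t).sub (measurable_ker_shift_sub hs hη 0 t)).mul
      (hm.comp measurable_fst)) fun τ hτ => ?_).mono (le_of_eq (by ring))
  have hr : 0 < t - τ := by linarith [hτ.2]
  have h := (hA.bd_taylor₁ (t - τ) (s t - s τ) _ hr (hV τ hτ)).const_mul (m τ)
  simp only [mul_comm (m τ)] at h
  refine h.mono ?_
  calc |m τ| * (A * (√(t - τ))⁻¹ ^ 2 * Real.exp (-(γ / 2) * (t - τ)) * |η t - η τ|)
      ≤ V * (A * (√(t - τ))⁻¹ ^ 2 * Real.exp (-(γ / 2) * (t - τ)) * (E * √(t - τ))) := by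
        gcongr
        · exact hmV τ
        · exact hE τ hτ
    _ = A * V * E * ((√(t - τ))⁻¹ * Real.exp (-(γ / 2) * (t - τ)))
        * ((√(t - τ))⁻¹ * √(t - τ)) := by ring
    _ = _ := by rw [inv_sqrt_mul_sqrt hr, mul_one]

/-- The singularity `(t-τ)^{-3/2}` of the second-order remainder meets `(E√(t-τ))²`, leaving an
integrable `(t-τ)^{-1/2}` and the quadratic factor `E²`. -/
lemma KernelBounds.bd_layerTaylor (hA : KernelBounds γ V A) (hγ : 0 < γ) (hs : Continuous s)
    (hη : Continuous η) (hm : Measurable m) (hmV : ∀ τ, |m τ| ≤ V) (ht : 0 ≤ t)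
    (hV : ∀ τ ∈ Ioo 0 t, |η t - η τ| ≤ V * (t - τ))
    (hE : ∀ τ ∈ Ioo 0 t, |η t - η τ| ≤ E * √(t - τ)) :
    Bd (layerTaylor γ s η m t) (A * V * √(Real.pi / (γ / 2)) * E ^ 2) := by
  have hA0 := hA.pos
  have hV0 : 0 ≤ V := (abs_nonneg _).trans (hmV 0)
  refine (Bd.intervalIntegral (k := fun τ x => (ker γ 0 (t - τ) (x + (s t - s τ))
    - ker γ 0 (t - τ) (x + (s t - s τ) - (η t - η τ))
    - (η t - η τ) * ker γ 1 (t - τ) (x + (s t - s τ))) * m τ) (K := A * V * E ^ 2) ht (half_pos hγ) (by positivity)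
    ((((measurable_ker_shift hs 0 t).sub (measurable_ker_shift_sub hs hη 0 t)).sub
      (Measurable.mul (by fun_prop) (measurable_ker_shift hs 1 t))).mul
      (hm.comp measurable_fst)) fun τ hτ => ?_).mono (le_of_eq (by ring))
  have hr : 0 < t - τ := by linarith [hτ.2]
  have h := (hA.bd_taylor₂ (t - τ) (s t - s τ) _ hr (hV τ hτ)).const_mul (m τ)
  simp only [mul_comm (m τ)] at h
  refine h.mono ?_
  have h2 : (η t - η τ) ^ 2 ≤ (E * √(t - τ)) ^ 2 := by
    rw [← sq_abs]; exact pow_le_pow_left₀ (abs_nonneg _) (hE τ hτ) 2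
  calc |m τ| * (A * (√(t - τ))⁻¹ ^ 3 * Real.exp (-(γ / 2) * (t - τ)) * (η t - η τ) ^ 2)
      ≤ V * (A * (√(t - τ))⁻¹ ^ 3 * Real.exp (-(γ / 2) * (t - τ)) * (E * √(t - τ)) ^ 2) := by
        gcongr
        exact hmV τ
    _ = A * V * E ^ 2 * ((√(t - τ))⁻¹ * Real.exp (-(γ / 2) * (t - τ)))
        * ((√(t - τ))⁻¹ * √(t - τ)) ^ 2 := by ring
    _ = _ := by rw [inv_sqrt_mul_sqrt hr, one_pow, mul_one]

end taylor

/-! ### Comparison of two solutions -/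

section comparison

variable {f h v w q : ℝ → ℝ} {V A R δ lam Q t : ℝ}

/-- The density is changed first, with the path of `v` kept; then the path is changed, with the
density `w` kept. -/
lemma layer_sub_layer (hγ : 0 ≤ γ) (hv : Continuous v) (hw : Continuous w) (ht : 0 ≤ t) (x : ℝ) :
    layer γ 0 (prim v) v t x - layer γ 0 (prim w) w t x =
      layer γ 0 (prim v) (fun τ => v τ - w τ) t x
        + layerDiff γ (prim v) (prim fun τ => v τ - w τ) w t x := by
  have hvc := continuous_prim hv
  have hwc := continuous_prim hw
  have i1 := intervalIntegrable_layer_zero hγ hvc hv ht x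
  have i2 := intervalIntegrable_layer_zero hγ hwc hw ht x
  have i3 := intervalIntegrable_layer_zero hγ hvc hw ht x
  have e : layerDiff γ (prim v) (prim fun τ => v τ - w τ) w t x =
      ∫ τ in (0 : ℝ)..t, (ker γ 0 (t - τ) (x + (prim v t - prim v τ)) * w τ
        - ker γ 0 (t - τ) (x + (prim w t - prim w τ)) * w τ) := by
    rw [layerDiff]
    congr 1; ext τ
    rw [prim_sub hv hw, prim_sub hv hw, sub_mul]
    congr 3; ring
  rw [e, intervalIntegral.integral_sub i3 i2]
  have e2 : layer γ 0 (prim v) (fun τ => v τ - w τ) t x = layer γ 0 (prim v) v t x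
      - layer γ 0 (prim v) w t x := by
    rw [layer, layer, layer, ← intervalIntegral.integral_sub i1 i3]
    congr 1; ext τ; ring
  rw [e2, layer, layer, layer]
  ring

lemma layerDiff_eq (hγ : 0 ≤ γ) (hv : Continuous v) (hw : Continuous w) (ht : 0 ≤ t) (x : ℝ) :
    layerDiff γ (prim v) (prim fun τ => v τ - w τ) w t x =
      layerTaylor γ (prim v) (prim fun τ => v τ - w τ) w t x
        + dlayer γ 1 (prim v) (prim fun τ => v τ - w τ) w t x := by
  have hvc := continuous_prim hv
  have hwc := continuous_prim hw
  have i2 := intervalIntegrable_layer_zero hγ hwc hw ht x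
  have i3 := intervalIntegrable_layer_zero hγ hvc hw ht x
  have hp : Continuous fun τ => v τ - w τ := hv.sub hw
  have i4 := intervalIntegrable_dlayer hγ hvc hw hp ht x
  have i5 : IntervalIntegrable (fun τ => (ker γ 0 (t - τ) (x + (prim v t - prim v τ))
      - ker γ 0 (t - τ) (x + (prim v t - prim v τ)
        - (prim (fun τ => v τ - w τ) t - prim (fun τ => v τ - w τ) τ))) * w τ) volume 0 t := by
    refine (i3.sub i2).congr (fun τ _ => ?_)
    simp only [prim_sub hv hw]
    rw [sub_mul]
    congr 3; ring
  have e : layerTaylor γ (prim v) (prim fun τ => v τ - w τ) w t x =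
      layerDiff γ (prim v) (prim fun τ => v τ - w τ) w t x
        - dlayer γ 1 (prim v) (prim fun τ => v τ - w τ) w t x := by
    rw [layerTaylor, layerDiff, dlayer, ← intervalIntegral.integral_sub i5 i4]
    congr 1; ext τ; ring
  rw [e]; ring

lemma rep_sub_rep (hγ : 0 ≤ γ) (hf : Admissible f) (hh : Admissible h) (hv : Continuous v)
    (hw : Continuous w) (ht : 0 < t) (x : ℝ) :
    rep γ f v t x - rep γ h w t x = flow γ (fun x => f x - h x) t (x + prim v t)
      + (hom γ 0 h t (x + prim v t) - hom γ 0 h t (x + prim v t - prim (fun τ => v τ - w τ) t))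
      - layer γ 0 (prim v) (fun τ => v τ - w τ) t x
      - layerDiff γ (prim v) (prim fun τ => v τ - w τ) w t x := by
  have e := layer_sub_layer hγ hv hw ht.le x
  have e2 : x + prim v t - prim (fun τ => v τ - w τ) t = x + prim w t := by
    rw [prim_sub hv hw]; ring
  rw [flow_sub hf hh, e2, rep, rep, flow_eq_hom h ht, flow_eq_hom h ht]
  linarith

/-- Everything is expanded around the path of `v`, while `linRep` carries the data `f` and the
density `v` instead of `h` and `w`. This mismatch produces the terms with `f - h` and `v - w`, each
multiplied by `q` and hence quadratic. The remaining terms are Taylor remainders or linear in `v - w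
- q`. -/
lemma remainder_eq (hγ : 0 ≤ γ) (hf : Admissible f) (hh : Admissible h) (hv : Continuous v)
    (hw : Continuous w) (hq : Continuous q) (ht : 0 < t) (x : ℝ) :
    rep γ f v t x - rep γ h w t x - linRep γ f v (fun x => f x - h x) q t x =
      (hom γ 0 h t (x + prim v t) - hom γ 0 h t (x + prim v t - prim (fun τ => v τ - w τ) t)
        - prim (fun τ => v τ - w τ) t * hom γ 1 h t (x + prim v t))
      + prim (fun τ => v τ - w τ - q τ) t * hom γ 1 h t (x + prim v t)
      - prim q t * hom γ 1 (fun x => f x - h x) t (x + prim v t)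
      - layer γ 0 (prim v) (fun τ => v τ - w τ - q τ) t x
      - layerTaylor γ (prim v) (prim fun τ => v τ - w τ) w t x
      - dlayer γ 1 (prim v) (prim fun τ => v τ - w τ - q τ) w t x
      + dlayer γ 1 (prim v) (prim q) (fun τ => v τ - w τ) t x := by
  have hvc := continuous_prim hv
  have hp : Continuous fun τ => v τ - w τ := hv.sub hw
  have e1 : layer γ 0 (prim v) (fun τ => v τ - w τ - q τ) t x =
      layer γ 0 (prim v) (fun τ => v τ - w τ) t x - layer γ 0 (prim v) q t x := by
    rw [layer, layer, layer, ← intervalIntegral.integral_sub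
      (intervalIntegrable_layer_zero hγ hvc hp ht.le x)
      (intervalIntegrable_layer_zero hγ hvc hq ht.le x)]
    congr 1; ext τ; ring
  have e2 : dlayer γ 1 (prim v) (prim fun τ => v τ - w τ - q τ) w t x =
      dlayer γ 1 (prim v) (prim fun τ => v τ - w τ) w t x - dlayer γ 1 (prim v) (prim q) w t x := by
    rw [dlayer, dlayer, dlayer, ← intervalIntegral.integral_sub
      (intervalIntegrable_dlayer hγ hvc hw hp ht.le x)
      (intervalIntegrable_dlayer hγ hvc hw hq ht.le x)]
    simp only [prim_sub hp hq]
    congr 1; ext τ; ring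
  have e3 : dlayer γ 1 (prim v) (prim q) (fun τ => v τ - w τ) t x =
      dlayer γ 1 (prim v) (prim q) v t x - dlayer γ 1 (prim v) (prim q) w t x := by
    rw [dlayer, dlayer, dlayer, ← intervalIntegral.integral_sub
      (intervalIntegrable_dlayer hγ hvc hv hq ht.le x)
      (intervalIntegrable_dlayer hγ hvc hw hq ht.le x)]
    congr 1; ext τ; ring
  rw [rep_sub_rep hγ hf hh hv hw ht, linRep, e1, e2, e3, layerDiff_eq hγ hv hw ht.le,
    hom_sub hγ hf hh 1 ht, prim_sub hp hq]
  ring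

lemma abs_prim_sub_le_mul (hv : Continuous v) {V : ℝ} (hV : ∀ t, |v t| ≤ V) {τ : ℝ} (hτ : τ ≤ t) :
    |prim v t - prim v τ| ≤ V * (t - τ) := by
  have := abs_sub_le_of_hasDerivAt (hasDerivAt_prim hv) hV t τ
  rwa [abs_of_nonneg (by linarith : 0 ≤ t - τ)] at this

/-- The zeroth-order analogue of the remainder estimate: first differences of the kernels suffice
and give a bound linear in `δ` and `Q`. -/
lemma KernelBounds.bd_rep_sub_rep (hA : KernelBounds γ V A) (hγ : 0 < γ) (hf : Admissible f)
    (hh : Bd h R) (hhc : Continuous h) (hz : Bd (fun x => f x - h x) δ) (hv : Continuous v)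
    (hw : Continuous w) (hwV : ∀ t, |w t| ≤ V) (hvw : ∀ t, |v t - w t| ≤ V) (ht : 0 ≤ t)
    (hl : 0 < lam) (hQ0 : 0 ≤ Q) (hQ : ∀ τ ∈ Icc 0 t, |v τ - w τ| ≤ Q * Real.exp (lam * τ)) :
    Bd (fun x => rep γ f v t x - rep γ h w t x)
      ((A + 1) * δ + layerConst γ A V R * (Q * Real.exp (lam * t) / √lam)) := by
  have hA0 := hA.pos
  have hR := hh.nonneg
  have hV0 : 0 ≤ V := (abs_nonneg _).trans (hwV 0)
  have hp : Continuous fun τ => v τ - w τ := hv.sub hw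
  have hE0 : 0 ≤ Q * Real.exp (lam * t) / √lam := by positivity
  have hE : ∀ τ ∈ Icc 0 t, _ := fun τ hτ => abs_prim_sub_le hp hl hQ0 hQ hτ
  have hE' : ∀ τ ∈ Icc 0 t, _ := fun τ (hτ : τ ∈ Icc 0 t) => abs_prim_sub_le_mul hp hvw hτ.2
  rcases ht.eq_or_lt with rfl | ht'
  · simp only [rep_zero]
    refine hz.mono ?_
    have : 0 ≤ layerConst γ A V R * (Q * Real.exp (lam * 0) / √lam) :=
      mul_nonneg (by unfold layerConst; positivity) hE0
    nlinarith [hz.nonneg]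
  have e := fun x => rep_sub_rep hγ.le hf (.of_bd hhc hh) hv hw ht' x
  simp_rw [e]
  have h0 := hE 0 ⟨le_rfl, ht⟩
  have h0' := hE' 0 ⟨le_rfl, ht⟩
  rw [prim_zero, sub_zero, sub_zero] at h0 h0'
  have h1 := hA.bd_flow hz (hf.1.sub hhc) ht (prim v t)
  have h2 := hA.bd_hom_taylor₁ hh hhc hγ.le ht' h0' h0 (prim v t)
  have h3 := hA.bd_layer hγ (continuous_prim hv) hp.measurable ht hl
    (fun τ hτ => hQ τ (Ioo_subset_Icc_self hτ)) hQ0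
  have h4 := hA.bd_layerDiff hγ (continuous_prim hv) (continuous_prim hp) hw.measurable hwV ht
    (fun τ hτ => hE' τ (Ioo_subset_Icc_self hτ)) hE0 (fun τ hτ => hE τ (Ioo_subset_Icc_self hτ))
  refine (((h1.add h2).sub h3).sub h4).mono ?_
  rw [Real.sqrt_div Real.pi_pos.le lam, layerConst]
  exact le_of_eq (by ring)

/-- The factor of the quadratic terms in the remainder. -/
noncomputable def quadConst (γ A V R : ℝ) : ℝ :=
  A * R + A + A * V * √(Real.pi / (γ / 2)) + A * √(Real.pi / (γ / 2))

lemma KernelBounds.bd_remainder (hA : KernelBounds γ V A) (hγ : 0 < γ) (hf : Admissible f)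
    (hh : Bd h R) (hhc : Continuous h) (hz : Bd (fun x => f x - h x) δ) (hv : Continuous v)
    (hw : Continuous w) (hq : Continuous q) (hwV : ∀ t, |w t| ≤ V) (hvw : ∀ t, |v t - w t| ≤ V)
    (ht : 0 ≤ t) (hl : 1 ≤ lam) {Q₂ : ℝ} (hQ0 : 0 ≤ Q) (hQ₂0 : 0 ≤ Q₂)
    (hQ : ∀ τ ∈ Icc 0 t, |v τ - w τ| ≤ Q * Real.exp (lam * τ))
    (hQ₁ : ∀ τ ∈ Icc 0 t, |q τ| ≤ Q * Real.exp (lam * τ))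
    (hQ₂ : ∀ τ ∈ Icc 0 t, |v τ - w τ - q τ| ≤ Q₂ * Real.exp (2 * lam * τ)) :
    Bd (fun x => rep γ f v t x - rep γ h w t x - linRep γ f v (fun x => f x - h x) q t x)
      (layerConst γ A V R * (Q₂ * Real.exp (2 * lam * t) / √(2 * lam))
        + quadConst γ A V R * (Q ^ 2 + δ * Q) * Real.exp (2 * lam * t)) := by
  have hA0 := hA.pos
  have hR := hh.nonneg
  have hδ := hz.nonneg
  have hV0 : 0 ≤ V := (abs_nonneg _).trans (hwV 0)
  have hl0 : 0 < lam := by linarith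
  have hl2 : 0 < 2 * lam := by linarith
  have hp : Continuous fun τ => v τ - w τ := hv.sub hw
  have hρ : Continuous fun τ => v τ - w τ - q τ := hp.sub hq
  have hvc := continuous_prim hv
  have hpc := continuous_prim hp
  have hqc := continuous_prim hq
  have hρc := continuous_prim hρ
  have hE : ∀ τ ∈ Icc 0 t, _ := fun τ hτ => abs_prim_sub_le hp hl0 hQ0 hQ hτ
  have hE' : ∀ τ ∈ Icc 0 t, _ := fun τ (hτ : τ ∈ Icc 0 t) => abs_prim_sub_le_mul hp hvw hτ.2
  set E := Q * Real.exp (lam * t) / √lam with hEdef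
  have hE0 : 0 ≤ E := by positivity
  -- The quadratic terms may forget `1/√λ`, as `λ ≥ 1`; only the terms linear in `v - w - q` need
  -- it, since they are absorbed.
  have hEQ : E ≤ Q * Real.exp (lam * t) := div_le_self (by positivity) (Real.one_le_sqrt.2 hl)
  have hexp : Real.exp (lam * t) ^ 2 = Real.exp (2 * lam * t) := by
    rw [← Real.exp_nat_mul]; congr 1; push_cast; ring
  have hexp1 : Real.exp (lam * t) ≤ Real.exp (2 * lam * t) := Real.exp_le_exp.2 (by nlinarith)
  set c := √(Real.pi / (γ / 2)) with hc
  rcases ht.eq_or_lt with rfl | ht'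
  · simp only [rep_zero, linRep_zero, sub_self]
    refine Bd.zero.mono ?_
    unfold layerConst quadConst
    positivity
  have e := fun x => remainder_eq hγ.le hf (.of_bd hhc hh) hv hw hq ht' x
  simp_rw [e]
  have h0 := hE 0 ⟨le_rfl, ht⟩
  have h0' := hE' 0 ⟨le_rfl, ht⟩
  rw [prim_zero, sub_zero, sub_zero] at h0 h0'
  have h1 := hA.bd_hom_taylor₂ hh hhc hγ.le ht' h0' h0 (prim v t)
  have h2 := hA.bd_prim_mul_hom hh hhc hρ ht' hl2 hQ₂0 hQ₂ (prim v t)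
  have h3 := hA.bd_prim_mul_hom hz (hf.1.sub hhc) hq ht' hl0 hQ0 hQ₁ (prim v t)
  have h4 := hA.bd_layer hγ hvc hρ.measurable ht hl2
    (fun τ hτ => hQ₂ τ (Ioo_subset_Icc_self hτ)) hQ₂0
  have h5 := hA.bd_layerTaylor hγ hvc hpc hw.measurable hwV ht
    (fun τ hτ => hE' τ (Ioo_subset_Icc_self hτ)) (fun τ hτ => hE τ (Ioo_subset_Icc_self hτ))
  have h6 := hA.bd_layer_one hγ hvc
    (m := fun τ => (prim (fun τ => v τ - w τ - q τ) t - prim (fun τ => v τ - w τ - q τ) τ) * w τ)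
    (by fun_prop) ht (Q := Q₂ * Real.exp (2 * lam * t) / √(2 * lam) * V) (fun τ hτ => by
      rw [abs_mul, mul_right_comm]
      exact mul_le_mul (abs_prim_sub_le hρ hl2 hQ₂0 hQ₂ (Ioo_subset_Icc_self hτ)) (hwV τ)
        (abs_nonneg _) (by positivity)) (by positivity)
  have h7 := hA.bd_layer_one hγ hvc
    (m := fun τ => (prim q t - prim q τ) * (v τ - w τ))
    (by fun_prop) ht (Q := E * (Q * Real.exp (lam * t))) (fun τ hτ => by
      rw [abs_mul, mul_right_comm]
      refine mul_le_mul (abs_prim_sub_le hq hl0 hQ0 hQ₁ (Ioo_subset_Icc_self hτ))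
        ((hQ τ (Ioo_subset_Icc_self hτ)).trans ?_) (abs_nonneg _) (by positivity)
      have := hτ.2.le
      gcongr) (by positivity)
  refine ((((((h1.add h2).sub h3).sub h4).sub h5).sub h6).add h7).mono ?_
  rw [Real.sqrt_div Real.pi_pos.le (2 * lam), ← hEdef, ← hc]
  have b1 : A * R * E ^ 2 ≤ A * R * (Q ^ 2 * Real.exp (2 * lam * t)) := by
    rw [← hexp, ← mul_pow]; gcongr
  have b3 : A * δ * E ≤ A * δ * (Q * Real.exp (2 * lam * t)) := by
    gcongr; exact hEQ.trans (by gcongr)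
  have b5 : A * V * c * E ^ 2 ≤ A * V * c * (Q ^ 2 * Real.exp (2 * lam * t)) := by
    rw [← hexp, ← mul_pow]; gcongr
  have b7 : A * (E * (Q * Real.exp (lam * t))) * c ≤ A * c * (Q ^ 2 * Real.exp (2 * lam * t)) := by
    rw [← hexp]
    calc _ ≤ A * (Q * Real.exp (lam * t) * (Q * Real.exp (lam * t))) * c := by gcongr
      _ = _ := by ring
  have b8 : A * (Q ^ 2 * Real.exp (2 * lam * t)) + (A * R + A * V * c + A * c) *
      (δ * Q * Real.exp (2 * lam * t)) ≥ 0 := by positivity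
  have b9 : quadConst γ A V R * (Q ^ 2 + δ * Q) * Real.exp (2 * lam * t) =
      A * R * (Q ^ 2 * Real.exp (2 * lam * t)) + A * δ * (Q * Real.exp (2 * lam * t))
      + A * V * c * (Q ^ 2 * Real.exp (2 * lam * t)) + A * c * (Q ^ 2 * Real.exp (2 * lam * t))
      + (A * (Q ^ 2 * Real.exp (2 * lam * t)) + (A * R + A * V * c + A * c) *
      (δ * Q * Real.exp (2 * lam * t))) := by
    rw [quadConst]; ring
  have b10 : layerConst γ A V R * (Q₂ * Real.exp (2 * lam * t) / √(2 * lam)) =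
      A * R * (Q₂ * Real.exp (2 * lam * t) / √(2 * lam))
      + A * Q₂ * Real.exp (2 * lam * t) * (√Real.pi / √(2 * lam))
      + A * (Q₂ * Real.exp (2 * lam * t) / √(2 * lam) * V) * c := by
    rw [layerConst]; ring
  rw [b9, b10]
  linarith

end comparison

/-! ### The Sobolev inequality -/

/-- Testing against a function bounded by 2 on an interval of length 2: Cauchy–Schwarz gives `2√2 ≤
4`. -/
lemma enorm_integral_mul_le {f ψ : ℝ → ℝ} {x : ℝ} (hf : AEStronglyMeasurable f volume)
    (hψ : ∀ y, |ψ y| ≤ 2) (hψ0 : ∀ y, y ∉ Icc (x - 1) (x + 1) → ψ y = 0) :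
    ‖∫ y, f y * ψ y‖ₑ ≤ 4 * eLpNorm f 2 volume := by
  have h1 : ∫⁻ y, ‖f y * ψ y‖ₑ ≤ ∫⁻ y, (Icc (x - 1) (x + 1)).indicator (fun y => 2 * ‖f y‖ₑ) y := by
    refine lintegral_mono fun y => ?_
    by_cases hy : y ∈ Icc (x - 1) (x + 1)
    · rw [indicator_of_mem hy, enorm_mul, mul_comm]
      gcongr
      rw [Real.enorm_eq_ofReal_abs]
      exact (ENNReal.ofReal_le_ofReal (hψ y)).trans (by simp)
    · simp [hψ0 y hy]
  have h2 : ∫⁻ y in Icc (x - 1) (x + 1), ‖f y‖ₑ ≤ 2 * eLpNorm f 2 volume := by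
    have h := eLpNorm_le_eLpNorm_mul_rpow_measure_univ (p := 1) (q := 2)
      (μ := volume.restrict (Icc (x - 1) (x + 1))) (by norm_num) hf.restrict
    rw [eLpNorm_one_eq_lintegral_enorm] at h
    refine h.trans ?_
    rw [mul_comm]
    gcongr
    · rw [Measure.restrict_apply_univ, Real.volume_Icc, show x + 1 - (x - 1) = 2 by ring]
      norm_num
      calc (2 : ℝ≥0∞) ^ (1 / 2 : ℝ) ≤ 2 ^ (1 : ℝ) :=
            ENNReal.rpow_le_rpow_of_exponent_le (by norm_num) (by norm_num)
        _ = 2 := by simp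
    · exact Measure.restrict_le_self
  calc ‖∫ y, f y * ψ y‖ₑ ≤ ∫⁻ y, ‖f y * ψ y‖ₑ := enorm_integral_le_lintegral_enorm _
    _ ≤ _ := h1
    _ = 2 * ∫⁻ y in Icc (x - 1) (x + 1), ‖f y‖ₑ := by
      rw [lintegral_indicator measurableSet_Icc, lintegral_const_mul' _ _ (by simp)]
    _ ≤ 2 * (2 * eLpNorm f 2 volume) := by gcongr
    _ = _ := by rw [← mul_assoc]; norm_num

/-- The difference of two mollifiers has a compactly supported smooth primitive. -/
lemma exists_primitive_sub_normed {x : ℝ} (ρ σ : ContDiffBump x) (hρ : ρ.rOut ≤ 1)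
    (hσ : σ.rOut ≤ 1) : ∃ φ : ℝ → ℝ, ContDiff ℝ (⊤ : ℕ∞) φ ∧ HasCompactSupport φ ∧
      (∀ y, deriv φ y = ρ.normed volume y - σ.normed volume y) ∧ (∀ y, |φ y| ≤ 2) ∧
      ∀ y, y ∉ Icc (x - 1) (x + 1) → φ y = 0 := by
  set d : ℝ → ℝ := fun y => ρ.normed volume y - σ.normed volume y with hd
  have hdc : Continuous d := (ρ.continuous_normed).sub σ.continuous_normed
  have hz : ∀ (τ : ContDiffBump x), τ.rOut ≤ 1 → ∀ y, y ∉ Ioo (x - 1) (x + 1) →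
      τ.normed volume y = 0 := fun τ hτ y hy => by
    have : y ∉ Function.support (τ.normed volume) := by
      rw [τ.support_normed_eq, Real.ball_eq_Ioo]
      exact fun h => hy ⟨by linarith [h.1], by linarith [h.2]⟩
    simpa using this
  have hd0 : ∀ y, y ∉ Ioo (x - 1) (x + 1) → d y = 0 := fun y hy => by
    rw [hd]; simp only [hz ρ hρ y hy, hz σ hσ y hy, sub_self]
  have hdi : Integrable d := ρ.integrable_normed.sub σ.integrable_normed
  set φ : ℝ → ℝ := fun y => ∫ u in (x - 1)..y, d u with hφ
  have hder : ∀ y, HasDerivAt φ (d y) y := fun y =>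
    intervalIntegral.integral_hasDerivAt_right (hdc.intervalIntegrable _ _)
      (hdc.stronglyMeasurableAtFilter _ _) hdc.continuousAt
  have hderiv : deriv φ = d := funext fun y => (hder y).deriv
  have hout : ∀ y, y ∉ Icc (x - 1) (x + 1) → φ y = 0 := by
    intro y hy
    rcases lt_or_ge y (x - 1) with h | h
    · refine intervalIntegral.integral_zero_ae (ae_of_all _ fun u hu => hd0 u fun hu' => ?_)
      rw [uIoc_of_ge h.le] at hu
      linarith [hu.2, hu'.1]
    · have hy1 : x + 1 < y := by by_contra! h1; exact hy ⟨h, h1⟩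
      have e : ∫ u in (x - 1)..y, d u = ∫ u, d u :=
        intervalIntegral.integral_eq_integral_of_support_subset fun u hu => by
          by_contra h1
          refine hu (hd0 u fun h2 => h1 ⟨h2.1, by linarith [h2.2]⟩)
      show ∫ u in (x - 1)..y, d u = 0
      rw [e, hd, integral_sub ρ.integrable_normed σ.integrable_normed, ρ.integral_normed,
        σ.integral_normed, sub_self]
  refine ⟨φ, ?_, HasCompactSupport.intro isCompact_Icc hout, fun y => by rw [hderiv], fun y => ?_,
    hout⟩
  · rw [contDiff_infty_iff_deriv, hderiv]
    exact ⟨fun y => (hder y).differentiableAt, ρ.contDiff_normed.sub σ.contDiff_normed⟩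
  · have h1 : |φ y| ≤ ∫ u, |d u| := by
      rw [← Real.norm_eq_abs]
      refine (intervalIntegral.norm_integral_le_integral_norm_uIoc).trans ?_
      exact setIntegral_le_integral hdi.norm (ae_of_all _ fun u => norm_nonneg _)
    have h2 : ∫ u, |d u| ≤ ∫ u, (ρ.normed volume u + σ.normed volume u) := by
      refine integral_mono hdi.abs (ρ.integrable_normed.add σ.integrable_normed) fun u => ?_
      refine (abs_sub _ _).trans ?_
      rw [abs_of_nonneg (ρ.nonneg_normed u), abs_of_nonneg (σ.nonneg_normed u)]
    rw [integral_add ρ.integrable_normed σ.integrable_normed, ρ.integral_normed,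
      σ.integral_normed] at h2
    linarith

lemma HasWeakDeriv.enorm_le {f f' : ℝ → ℝ} (h : HasWeakDeriv f f') (hf : Continuous f) (x : ℝ) :
    ‖f x‖ₑ ≤ 4 * eLpNorm f 2 volume + 4 * eLpNorm f' 2 volume := by
  refine ENNReal.le_of_forall_pos_le_add fun ε hε _ => ?_
  obtain ⟨r, hr, hrf⟩ := Metric.continuousAt_iff.1 hf.continuousAt ε (NNReal.coe_pos.2 hε)
  -- A fixed mollifier `σ` and a mollifier `ρ` narrow enough that the average of `f` against it is
  -- within `ε` of `f x`. Their difference is `φ'` for a test function `φ`, so the two averages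
  -- differ by `-∫ f' φ`.
  set σ : ContDiffBump x := ⟨1 / 2, 1, by norm_num, by norm_num⟩
  set ρ : ContDiffBump x := ⟨min r 1 / 2, min r 1, by positivity, by
    have : 0 < min r 1 := by positivity
    linarith⟩
  obtain ⟨φ, hφ, hφc, hφd, hφ2, hφ0⟩ := exists_primitive_sub_normed ρ σ (min_le_right _ _) le_rfl
  have key := h.2.2 φ hφ hφc
  have hi : ∀ τ : ContDiffBump x, Integrable fun y => f y * τ.normed volume y := fun τ =>
    (hf.mul τ.continuous_normed).integrable_of_hasCompactSupport τ.hasCompactSupport_normed.mul_left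
  simp only [hφd, mul_sub] at key
  rw [integral_sub (hi ρ) (hi σ)] at key
  have h1 : ‖∫ y, f y * σ.normed volume y‖ₑ ≤ 4 * eLpNorm f 2 volume := by
    refine enorm_integral_mul_le (x := x) hf.aestronglyMeasurable (fun y => ?_) fun y hy => ?_
    · rw [abs_of_nonneg (σ.nonneg_normed y)]
      refine (σ.normed_le_div_measure_closedBall_rIn volume y).trans ?_
      simp [σ, Measure.real, Real.volume_closedBall]
    · have : y ∉ Function.support (σ.normed volume) := by
        rw [σ.support_normed_eq, Real.ball_eq_Ioo]
        exact fun h => hy ⟨by linarith [h.1], by linarith [h.2]⟩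
      simpa using this
  have h2 : ‖∫ y, f' y * φ y‖ₑ ≤ 4 * eLpNorm f' 2 volume :=
    enorm_integral_mul_le h.2.1.aestronglyMeasurable hφ2 hφ0
  have h3 : ‖f x - ∫ y, f y * ρ.normed volume y‖ₑ ≤ ε := by
    have e : f x - ∫ y, f y * ρ.normed volume y = ∫ y, (f x - f y) * ρ.normed volume y := by
      simp only [sub_mul]
      rw [integral_sub (ρ.integrable_normed.const_mul _) (hi ρ), integral_const_mul,
        ρ.integral_normed, mul_one]
    have h4 : ‖∫ y, (f x - f y) * ρ.normed volume y‖ ≤ ∫ y, ε * ρ.normed volume y := by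
      refine norm_integral_le_of_norm_le (ρ.integrable_normed.const_mul _) (ae_of_all _ fun y => ?_)
      rw [norm_mul, Real.norm_of_nonneg (ρ.nonneg_normed y)]
      by_cases hy : y ∈ Metric.ball x ρ.rOut
      · gcongr
        · exact ρ.nonneg_normed y
        · rw [norm_sub_rev, ← dist_eq_norm]
          exact (hrf (lt_of_lt_of_le hy (min_le_left _ _))).le
      · rw [← ρ.support_normed_eq (μ := volume)] at hy
        have : ρ.normed volume y = 0 := by simpa using hy
        simp [this]
    rw [integral_const_mul, ρ.integral_normed, mul_one] at h4
    rw [e]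
    have := ENNReal.ofReal_le_ofReal h4
    rwa [ofReal_norm, ENNReal.ofReal_coe_nnreal] at this
  have e : f x = (f x - ∫ y, f y * ρ.normed volume y) + ((∫ y, f y * σ.normed volume y)
      - ∫ y, f' y * φ y) := by linarith
  calc ‖f x‖ₑ = ‖(f x - ∫ y, f y * ρ.normed volume y) + ((∫ y, f y * σ.normed volume y)
      - ∫ y, f' y * φ y)‖ₑ := by rw [← e]
    _ ≤ ε + (4 * eLpNorm f 2 volume + 4 * eLpNorm f' 2 volume) :=
      (enorm_add_le _ _).trans (add_le_add h3 ((enorm_sub_le).trans (add_le_add h1 h2)))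
    _ = _ := add_comm _ _

lemma le_sqrt_sq_add_sq (a b : ℝ≥0∞) : a ≤ (a ^ 2 + b ^ 2) ^ (1 / 2 : ℝ) := by
  calc a = (a ^ 2) ^ (1 / 2 : ℝ) := by
        rw [← ENNReal.rpow_natCast, ← ENNReal.rpow_mul]; norm_num
    _ ≤ _ := by gcongr; exact le_self_add

lemma eLpNorm_le_h1Norm (f : ℝ → ℝ) : eLpNorm f 2 volume ≤ h1Norm f :=
  le_iInf₂ fun _ _ => le_sqrt_sq_add_sq _ _

lemma enorm_le_h1Norm {f : ℝ → ℝ} (hf : Continuous f) (x : ℝ) : ‖f x‖ₑ ≤ 8 * h1Norm f := by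
  rw [h1Norm, ENNReal.mul_iInf_of_ne (by norm_num) (by norm_num)]
  refine le_iInf fun f' => ?_
  rw [ENNReal.mul_iInf_of_ne (by norm_num) (by norm_num)]
  refine le_iInf fun h => (h.enorm_le hf x).trans ?_
  have h1 := le_sqrt_sq_add_sq (eLpNorm f 2 volume) (eLpNorm f' 2 volume)
  have h2 := le_sqrt_sq_add_sq (eLpNorm f' 2 volume) (eLpNorm f 2 volume)
  rw [add_comm] at h2
  calc _ ≤ 4 * (eLpNorm f 2 volume ^ 2 + eLpNorm f' 2 volume ^ 2) ^ (1 / 2 : ℝ)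
      + 4 * (eLpNorm f 2 volume ^ 2 + eLpNorm f' 2 volume ^ 2) ^ (1 / 2 : ℝ) := by gcongr
    _ = _ := by rw [← add_mul]; norm_num

lemma bd_of_h1Norm_lt_top {f : ℝ → ℝ} (hf : Continuous f) (h : h1Norm f < ⊤) :
    Bd f (8 * (h1Norm f).toReal) where
  meas := hf.aestronglyMeasurable
  sup x := by
    have := ENNReal.toReal_mono (ENNReal.mul_ne_top (by norm_num) h.ne) (enorm_le_h1Norm hf x)
    rwa [ENNReal.toReal_mul, toReal_enorm, ENNReal.toReal_ofNat] at this
  l2 := by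
    rw [ENNReal.ofReal_mul (by norm_num), ENNReal.ofReal_toReal h.ne]
    refine (eLpNorm_le_h1Norm f).trans (le_mul_of_one_le_left' ?_)
    simp

/-! ### Dependence on the initial data -/

section dependence

variable {g U₀ W₀ z₀ : ℝ → ℝ} {U W z : ℝ → ℝ → ℝ} {V A L R δ lam t : ℝ}

lemma IsLinearizedSolution.bd (hz : IsLinearizedSolution γ g U z₀ z) (hU : IsOrbit γ g U₀ U)
    (hg : IsKinetics g) (hγ : 0 < γ) (hA : KernelBounds γ V A) (hV : ∀ u, 0 ≤ u → |g u| ≤ V)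
    (hL : ∀ u, 0 ≤ u → |derivWithin g (Ici 0) u| ≤ L) (hf : Bd U₀ R) (hfc : Continuous U₀)
    (hδ : Bd z₀ δ) (hzc : Continuous z₀) (hlam : 0 < lam)
    (hsmall : layerConst γ A V R * L / √lam ≤ 1 / 2) (ht : 0 ≤ t) :
    Bd (z t) (2 * ((A + 1) * δ) * Real.exp (lam * t)) := by
  obtain ⟨q, hq, hqb, hzq⟩ := hU.eq_linRep hg hγ hA hV ⟨hfc, R, hf⟩ ⟨hzc, δ, hδ⟩ hz
  rw [hzq t ht]
  exact bd_linRep_of_kinetic hA hγ hf hfc hδ hzc (hU.continuous_velocity hg)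
    (hU.abs_velocity_le hV) (hU.abs_slope_le hL) hq
    (fun t ht => by rw [hqb t ht, hzq t ht]) hlam hsmall ht

lemma IsOrbit.abs_velocity_sub_le (hU : IsOrbit γ g U₀ U) (hW : IsOrbit γ g W₀ W)
    (hL : ∀ u w, 0 ≤ u → 0 ≤ w → |g u - g w| ≤ L * |u - w|) (ht : 0 ≤ t) :
    |velocity g U t - velocity g W t| ≤ L * |U t 0 - W t 0| := by
  have := hL _ _ (hU.trace_nonneg t) (hW.trace_nonneg t)
  simpa only [velocity, max_eq_left ht] using this

/-- Lipschitz dependence on the data: `g` being Lipschitz, velocities differ by at most `L` times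
the traces, and the Volterra argument absorbs this feedback. -/
lemma IsOrbit.bd_sub (hU : IsOrbit γ g U₀ U) (hW : IsOrbit γ g W₀ W)
    (hg : IsKinetics g) (hγ : 0 < γ) (hA : KernelBounds γ V A) (hV : ∀ u, 0 ≤ u → |g u| ≤ V)
    (hV' : ∀ u w, 0 ≤ u → 0 ≤ w → |g u - g w| ≤ V) (hL0 : 0 ≤ L)
    (hL : ∀ u w, 0 ≤ u → 0 ≤ w → |g u - g w| ≤ L * |u - w|) (hf : Admissible U₀)
    (hh : Bd W₀ R) (hhc : Continuous W₀) (hδ : Bd (fun x => U₀ x - W₀ x) δ) (hlam : 0 < lam)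
    (hsmall : layerConst γ A V R * L / √lam ≤ 1 / 2) (ht : 0 ≤ t) :
    Bd (fun x => U t x - W t x) (2 * ((A + 1) * δ) * Real.exp (lam * t)) := by
  have hA0 := hA.pos
  refine bd_of_volterra (F := fun t x => U t x - W t x)
    ((continuousOn_trace hU.classical.continuousOn).sub
      (continuousOn_trace hW.classical.continuousOn)) (fun t m ht hm h => ?_) ht
  have h1 := hA.bd_rep_sub_rep hγ hf hh hhc hδ (hU.continuous_velocity hg)
    (hW.continuous_velocity hg) (hW.abs_velocity_le hV)
    (fun t => hV' _ _ (hU.trace_nonneg t) (hW.trace_nonneg t)) ht hlam (Q := L * m) (by positivity)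
    fun τ hτ => (hU.abs_velocity_sub_le hW hL hτ.1).trans (by
      rw [mul_assoc]; exact mul_le_mul_of_nonneg_left (h τ hτ) hL0)
  rw [← hU.eq_rep hg hγ hA hV hf ht, ← hW.eq_rep hg hγ hA hV (.of_bd hhc hh) ht] at h1
  refine h1.mono ?_
  have h3 : (A + 1) * δ ≤ (A + 1) * δ * Real.exp (lam * t) :=
    le_mul_of_one_le_right (mul_nonneg (by positivity) hδ.nonneg) (Real.one_le_exp (by positivity))
  have h4 : layerConst γ A V R * (L * m * Real.exp (lam * t) / √lam) =
      layerConst γ A V R * L / √lam * (m * Real.exp (lam * t)) := by ring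
  have h5 : layerConst γ A V R * L / √lam * (m * Real.exp (lam * t)) ≤
      1 / 2 * (m * Real.exp (lam * t)) := by gcongr
  rw [h4]
  linarith

/-- Uniform in time because the velocity is bounded by `V` for every orbit and the kernel is damped.
It confines the traces to an interval on which the Taylor constant of `g` depends only on `R`. -/
lemma IsOrbit.trace_le (hU : IsOrbit γ g U₀ U) (hg : IsKinetics g) (hγ : 0 < γ)
    (hA : KernelBounds γ V A) (hV : ∀ u, 0 ≤ u → |g u| ≤ V) (hf : Bd U₀ R) (hfc : Continuous U₀)
    (ht : 0 ≤ t) : U t 0 ≤ (A + 1) * R + A * V * √(Real.pi / (γ / 2)) := by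
  rw [hU.eq_rep hg hγ hA hV ⟨hfc, R, hf⟩ ht]
  exact (le_abs_self _).trans ((hA.bd_rep hγ hf hfc (hU.continuous_velocity hg)
    (hU.abs_velocity_le hV) ht).sup 0)

/-- The linearization of the kinetics along two orbits. -/
lemma IsOrbit.abs_velocity_remainder_le (hU : IsOrbit γ g U₀ U) (hW : IsOrbit γ g W₀ W)
    {M N : ℝ} (hN : ∀ u w, 0 ≤ u → u ≤ M → 0 ≤ w → w ≤ M →
      |g u - g w - derivWithin g (Ici 0) u * (u - w)| ≤ N * (u - w) ^ 2)
    (hL : ∀ u, 0 ≤ u → |derivWithin g (Ici 0) u| ≤ L)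
    (hUM : U t 0 ≤ M) (hWM : W t 0 ≤ M) (ht : 0 ≤ t) (ζ : ℝ) :
    |velocity g U t - velocity g W t - slope g U t * ζ| ≤
      L * |U t 0 - W t 0 - ζ| + N * (U t 0 - W t 0) ^ 2 := by
  have h1 := hN _ _ (hU.nonneg t 0 ht) hUM (hW.nonneg t 0 ht) hWM
  have h2 := hU.abs_slope_le hL t
  rw [velocity, velocity, max_eq_left ht]
  rw [slope, max_eq_left ht] at *
  set b := derivWithin g (Ici 0) (U t 0)
  calc _ = |(g (U t 0) - g (W t 0) - b * (U t 0 - W t 0)) + b * (U t 0 - W t 0 - ζ)| := by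
        congr 1; ring
    _ ≤ N * (U t 0 - W t 0) ^ 2 + |b| * |U t 0 - W t 0 - ζ| := by
        rw [← abs_mul]; exact (abs_add_le _ _).trans (by gcongr)
    _ ≤ N * (U t 0 - W t 0) ^ 2 + L * |U t 0 - W t 0 - ζ| := by gcongr
    _ = _ := add_comm _ _

lemma IsOrbit.bd_remainder (hU : IsOrbit γ g U₀ U) (hW : IsOrbit γ g W₀ W)
    (hz : IsLinearizedSolution γ g U (fun x => U₀ x - W₀ x) z)
    (hg : IsKinetics g) (hγ : 0 < γ) (hA : KernelBounds γ V A) (hV : ∀ u, 0 ≤ u → |g u| ≤ V)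
    (hV' : ∀ u w, 0 ≤ u → 0 ≤ w → |g u - g w| ≤ V) (hL0 : 0 ≤ L)
    (hL : ∀ u, 0 ≤ u → |derivWithin g (Ici 0) u| ≤ L)
    (hL' : ∀ u w, 0 ≤ u → 0 ≤ w → |g u - g w| ≤ L * |u - w|) {N : ℝ} (hN0 : 0 ≤ N)
    (hN : ∀ u w, 0 ≤ u → u ≤ (A + 1) * R + A * V * √(Real.pi / (γ / 2)) → 0 ≤ w →
      w ≤ (A + 1) * R + A * V * √(Real.pi / (γ / 2)) →
      |g u - g w - derivWithin g (Ici 0) u * (u - w)| ≤ N * (u - w) ^ 2)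
    (hf : Bd U₀ R) (hfc : Continuous U₀)
    (hh : Bd W₀ R) (hhc : Continuous W₀) (hδ : Bd (fun x => U₀ x - W₀ x) δ) (hlam : 1 ≤ lam)
    (hsmall : ∀ κ, lam ≤ κ → layerConst γ A V R * L / √κ ≤ 1 / 2) (ht : 0 ≤ t) :
    Bd (fun x => U t x - W t x - z t x)
      (2 * ((layerConst γ A V R * N * (2 * (A + 1)) ^ 2 + quadConst γ A V R *
        ((L * (2 * (A + 1))) ^ 2 + L * (2 * (A + 1)))) * δ ^ 2) * Real.exp (2 * lam * t)) := by
  have hA0 := hA.pos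
  have hR := hf.nonneg
  have hδ0 := hδ.nonneg
  have hV0 : 0 ≤ V := (abs_nonneg _).trans (hV 0 le_rfl)
  have hl0 : 0 < lam := by linarith
  have hfa : Admissible U₀ := ⟨hfc, R, hf⟩
  have hha : Admissible W₀ := ⟨hhc, R, hh⟩
  obtain ⟨q, hq, hqb, hzq⟩ := hU.eq_linRep hg hγ hA hV hfa (hfa.sub hha) hz
  have hv := hU.continuous_velocity hg
  have hw := hW.continuous_velocity hg
  set D := 2 * ((A + 1) * δ) with hD
  have hD0 : 0 ≤ D := by positivity
  have hd : ∀ {τ}, 0 ≤ τ → |U τ 0 - W τ 0| ≤ D * Real.exp (lam * τ) := fun hτ =>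
    (hU.bd_sub hW hg hγ hA hV hV' hL0 hL' hfa hh hhc hδ hl0 (hsmall lam le_rfl) hτ).sup 0
  have hzd : ∀ {τ}, 0 ≤ τ → |z τ 0| ≤ D * Real.exp (lam * τ) := fun hτ =>
    (hz.bd hU hg hγ hA hV hL hf hfc hδ (hfc.sub hhc) hl0 (hsmall lam le_rfl) hτ).sup 0
  have hexp : ∀ τ, Real.exp (lam * τ) ^ 2 = Real.exp (2 * lam * τ) := fun τ => by
    rw [← Real.exp_nat_mul]; congr 1; push_cast; ring
  have hlc : 0 ≤ layerConst γ A V R := by unfold layerConst; positivity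
  refine bd_of_volterra (F := fun t x => U t x - W t x - z t x)
    (((continuousOn_trace hU.classical.continuousOn).sub
      (continuousOn_trace hW.classical.continuousOn)).sub
        (continuousOn_trace hz.classical.continuousOn)) (fun t m ht hm h => ?_) ht
  -- `Q = L D` bounds both `v - w` and `q`. In `Q₂` the part `L m` is feedback of the remainder
  -- itself and `N D²` is the Taylor error of `g` along the two orbits.
  have h1 := hA.bd_remainder hγ hfa hh hhc hδ hv hw hq (hW.abs_velocity_le hV)
    (fun t => hV' _ _ (hU.trace_nonneg t) (hW.trace_nonneg t)) ht hlam (Q := L * D)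
    (Q₂ := L * m + N * D ^ 2) (by positivity) (by positivity)
    (fun τ hτ => (hU.abs_velocity_sub_le hW hL' hτ.1).trans (by
      rw [mul_assoc]; exact mul_le_mul_of_nonneg_left (hd hτ.1) hL0))
    (fun τ hτ => by
      rw [hqb τ hτ.1, abs_mul, mul_assoc]
      exact mul_le_mul (hU.abs_slope_le hL τ) (hzd hτ.1) (abs_nonneg _) hL0)
    (fun τ hτ => by
      rw [hqb τ hτ.1]
      refine (hU.abs_velocity_remainder_le hW hN hL (hU.trace_le hg hγ hA hV hf hfc hτ.1)
        (hW.trace_le hg hγ hA hV hh hhc hτ.1) hτ.1 _).trans ?_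
      have h2 : (U τ 0 - W τ 0) ^ 2 ≤ D ^ 2 * Real.exp (2 * lam * τ) := by
        rw [← hexp, ← mul_pow, ← sq_abs]
        exact pow_le_pow_left₀ (abs_nonneg _) (hd hτ.1) 2
      have h3 := h τ hτ
      calc L * |U τ 0 - W τ 0 - z τ 0| + N * (U τ 0 - W τ 0) ^ 2 ≤
          L * (m * Real.exp (2 * lam * τ)) + N * (D ^ 2 * Real.exp (2 * lam * τ)) := by gcongr
        _ = _ := by ring)
  rw [← hU.eq_rep hg hγ hA hV hfa ht, ← hW.eq_rep hg hγ hA hV hha ht, ← hzq t ht] at h1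
  refine h1.mono ?_
  set X := Real.exp (2 * lam * t)
  have h4 : layerConst γ A V R * ((L * m + N * D ^ 2) * X / √(2 * lam)) =
      layerConst γ A V R * L / √(2 * lam) * (m * X)
        + layerConst γ A V R * N * D ^ 2 * X / √(2 * lam) := by ring
  -- Smallness is used at the rate `2λ`, the growth rate of products of two first-order terms; this
  -- is why it is assumed for all `κ ≥ λ`.
  have h5 : layerConst γ A V R * L / √(2 * lam) * (m * X) ≤ 1 / 2 * (m * X) :=
    mul_le_mul_of_nonneg_right (hsmall (2 * lam) (by linarith)) (by positivity)
  have h6 : layerConst γ A V R * N * D ^ 2 * X / √(2 * lam) ≤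
      layerConst γ A V R * N * D ^ 2 * X :=
    div_le_self (by positivity) (Real.one_le_sqrt.2 (by linarith))
  rw [h4]
  calc _ ≤ 1 / 2 * (m * X) + layerConst γ A V R * N * D ^ 2 * X
        + quadConst γ A V R * ((L * D) ^ 2 + δ * (L * D)) * X := by gcongr
    _ = _ := by rw [hD]; ring

end dependence

/-! ### The differential of the time-`t` map -/

open Classical in
/-- The solution operator of the problem linearized about `U`. -/
noncomputable def linFlow (γ : ℝ) (g : ℝ → ℝ) (U : ℝ → ℝ → ℝ) (t : ℝ) (z₀ : ℝ → ℝ) : ℝ → ℝ :=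
  if h : ∃ z, IsLinearizedSolution γ g U z₀ z then h.choose t else 0

lemma isLinearizedSolution_linFlow {g U₀ z₀ : ℝ → ℝ} {U : ℝ → ℝ → ℝ} (hU : IsOrbit γ g U₀ U)
    (hg : IsKinetics g) (hγ : 0 < γ) (hf : Admissible U₀) (hz₀ : Admissible z₀) :
    IsLinearizedSolution γ g U z₀ fun t => linFlow γ g U t z₀ := by
  have h := hU.exists_linearizedSolution hg hγ hf hz₀
  have e : (fun t => linFlow γ g U t z₀) = h.choose := by
    ext t x
    rw [linFlow, dif_pos h]
  rw [e]
  exact h.choose_spec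

lemma MemH1C.admissible {α : ℝ} {f : ℝ → ℝ} (hf : MemH1C α f) : Admissible f :=
  ⟨hf.continuous, _, bd_of_h1Norm_lt_top hf.continuous hf.h1_lt_top⟩

lemma bd_of_h1Norm_le {f : ℝ → ℝ} {R : ℝ≥0} (hf : Continuous f) (h : h1Norm f ≤ R) :
    Bd f (8 * R) := by
  refine (bd_of_h1Norm_lt_top hf (h.trans_lt ENNReal.coe_lt_top)).mono ?_
  have := ENNReal.toReal_mono ENNReal.coe_ne_top h
  rw [ENNReal.coe_toReal] at this
  gcongr

end FreeInterface

/-! ### The main theorem -/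

theorem mainTheorem8 (γ : ℝ) (hγ : 0 < γ) (g : ℝ → ℝ) (hg : FreeInterface.IsKinetics g)
    (α : ℝ) (hα : 0 ≤ α) (R : ℝ≥0) :
    ∃ B C : ℝ, ∀ (U₀ : ℝ → ℝ) (U : ℝ → ℝ → ℝ),
      FreeInterface.MemH1C α U₀ → (∀ x, 0 ≤ U₀ x) →
      FreeInterface.weightedNorm α U₀ ≤ R → FreeInterface.h1Norm U₀ ≤ R →
      FreeInterface.IsOrbit γ g U₀ U →
      -- `D t` is the differential of the time-`t` map at `U₀`
      ∃ D : ℝ → (ℝ → ℝ) → (ℝ → ℝ),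
        -- `t ↦ D t z₀` is the unique solution of the linearized problem with initial data `z₀`
        (∀ z₀, FreeInterface.MemH1C α z₀ →
          FreeInterface.IsLinearizedSolution γ g U z₀ (fun t => D t z₀) ∧
          ∀ z, FreeInterface.IsLinearizedSolution γ g U z₀ z → ∀ t, 0 ≤ t → z t = D t z₀) ∧
        -- `D t` is linear and bounded
        (∀ z₀ z₁, FreeInterface.MemH1C α z₀ → FreeInterface.MemH1C α z₁ →
          ∀ a b t : ℝ, 0 ≤ t → D t (a • z₀ + b • z₁) = a • D t z₀ + b • D t z₁) ∧
        (∀ z₀, FreeInterface.MemH1C α z₀ → ∀ t, 0 ≤ t →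
          eLpNorm (D t z₀) 2 volume ≤
            ENNReal.ofReal (B * Real.exp (C * t)) * FreeInterface.h1Norm z₀) ∧
        -- the quadratic estimate of the remainder
        ∀ (W₀ : ℝ → ℝ) (W : ℝ → ℝ → ℝ),
          FreeInterface.MemH1C α W₀ → (∀ x, 0 ≤ W₀ x) →
          FreeInterface.weightedNorm α W₀ ≤ R → FreeInterface.h1Norm W₀ ≤ R →
          FreeInterface.IsOrbit γ g W₀ W →
          ∀ t, 0 ≤ t →
            eLpNorm (U t - W t - D t (U₀ - W₀)) 2 volume ≤
              ENNReal.ofReal (B * Real.exp (C * t)) *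
                FreeInterface.h1Norm (U₀ - W₀) ^ 2 := by
  obtain ⟨V, hV0, hV, hV'⟩ := hg.exists_bound
  obtain ⟨L, hL0, hL, hL'⟩ := hg.exists_lipschitz
  obtain ⟨A, hA⟩ := FreeInterface.exists_kernelBounds hγ hV0.le
  have hA0 := hA.pos
  -- The endpoint is the a priori bound of the traces for data with `Bd` constant `8R`, the 8 coming
  -- from the Sobolev inequality.
  obtain ⟨N, hN0, hN⟩ := hg.exists_quadratic
    ((A + 1) * (8 * R) + A * V * √(Real.pi / (γ / 2)))
  obtain ⟨lam, hlam, hsmall⟩ := FreeInterface.exists_small (FreeInterface.layerConst γ A V (8 * R) * L)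
  have hlam0 : 0 < lam := by linarith
  set K : ℝ := FreeInterface.layerConst γ A V (8 * R) * N * (2 * (A + 1)) ^ 2 + FreeInterface.quadConst γ A V (8 * R) *
    ((L * (2 * (A + 1))) ^ 2 + L * (2 * (A + 1))) with hK
  have hK0 : 0 ≤ K := by
    rw [hK, FreeInterface.layerConst, FreeInterface.quadConst]; positivity
  -- `16 = 2·8` and `128 = 2·8²`: the 2 from the Volterra argument, the powers of 8 from the Sobolev
  -- inequality applied to one, respectively two, factors of the data.
  set B : ℝ := 16 * (A + 1) + 128 * K with hB
  have hB0 : 0 < B := by positivity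
  refine ⟨B, 2 * lam, fun U₀ U hU₀ _ _ hU₀R hU => ?_⟩
  have hUbd := FreeInterface.bd_of_h1Norm_le hU₀.continuous hU₀R
  have hsol := fun {z₀ : ℝ → ℝ} (hz₀ : FreeInterface.Admissible z₀) =>
    FreeInterface.isLinearizedSolution_linFlow hU hg hγ hU₀.admissible hz₀
  refine ⟨FreeInterface.linFlow γ g U, fun z₀ hz₀ => ⟨hsol hz₀.admissible, fun z hz t ht =>
    hU.linearizedSolution_unique hg hγ hU₀.admissible hz₀.admissible hz (hsol hz₀.admissible) ht⟩,
    fun z₀ z₁ hz₀ hz₁ a b t ht => ?_, fun z₀ hz₀ t ht => ?_,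
    fun W₀ W hW₀ _ _ hW₀R hW t ht => ?_⟩
  · have hc := hz₀.admissible.comb hz₁.admissible a b
    exact hU.linearizedSolution_unique hg hγ hU₀.admissible hc (hsol hc)
      ((hsol hz₀.admissible).comb (hsol hz₁.admissible) a b) ht
  · have hz := hz₀.h1_lt_top
    refine ((hsol hz₀.admissible).bd hU hg hγ hA hV hL hUbd hU₀.continuous
      (FreeInterface.bd_of_h1Norm_lt_top hz₀.continuous hz) hz₀.continuous hlam0 (hsmall lam le_rfl) ht).l2.trans ?_
    rw [← ENNReal.ofReal_toReal hz.ne, ← ENNReal.ofReal_mul (by positivity),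
      ENNReal.toReal_ofReal ENNReal.toReal_nonneg]
    refine ENNReal.ofReal_le_ofReal ?_
    calc _ = 16 * (A + 1) * Real.exp (lam * t) * (FreeInterface.h1Norm z₀).toReal := by ring
      _ ≤ B * Real.exp (2 * lam * t) * (FreeInterface.h1Norm z₀).toReal := by
        gcongr
        · rw [hB]; linarith
        · linarith
  · have hWbd := FreeInterface.bd_of_h1Norm_le hW₀.continuous hW₀R
    have hd : FreeInterface.Admissible (U₀ - W₀) := hU₀.admissible.sub hW₀.admissible
    have hexp : 0 < B * Real.exp (2 * lam * t) := by positivity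
    -- If the norm is infinite the right-hand side is infinite, so additivity of weak derivatives
    -- need not be invoked.
    rcases eq_or_ne (FreeInterface.h1Norm (U₀ - W₀)) ⊤ with htop | htop
    · rw [htop, ENNReal.top_pow two_ne_zero, ENNReal.mul_top (by simpa using hexp)]
      exact le_top
    have hδ : FreeInterface.Bd (fun x => U₀ x - W₀ x) (8 * (FreeInterface.h1Norm (U₀ - W₀)).toReal) :=
      FreeInterface.bd_of_h1Norm_lt_top (hU₀.continuous.sub hW₀.continuous)
        (lt_top_iff_ne_top.2 htop)
    refine (hU.bd_remainder hW (hsol hd) hg hγ hA hV hV' hL0 hL hL' hN0 hN hUbd hU₀.continuous hWbd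
      hW₀.continuous hδ hlam hsmall ht).l2.trans ?_
    rw [← ENNReal.ofReal_toReal htop, ← ENNReal.ofReal_pow ENNReal.toReal_nonneg,
      ← ENNReal.ofReal_mul hexp.le, ENNReal.toReal_ofReal ENNReal.toReal_nonneg]
    refine ENNReal.ofReal_le_ofReal ?_
    calc _ = 128 * K * Real.exp (2 * lam * t) * (FreeInterface.h1Norm (U₀ - W₀)).toReal ^ 2 := by
          rw [← hK]; ring
      _ ≤ _ := by
        gcongr
        rw [hB]; linarith
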